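/- **Definitions.** Let $\mathcal W_n$ be the set of words of length $n$ without repeated letters in the alphabet $\{1,\dots,N\}$, and let $\mathcal S_n$ be the set of permutations of $n$, in one-line notation (the case $N=n$). A *D$_0$ graph* is a graph on a vertex set $W\subseteq\mathcal W_n$ with edges colored from $\{2,\dots,n-1\}$ such that (i) each $i$-edge is one of the pairs $\{v\,bac\,w,\ v\,bca\,w\}$, $\{v\,acb\,w,\ v\,cab\,w\}$, $\{v\,bac\,w,\ v\,acb\,w\}$, $\{v\,bca\,w,\ v\,cab\,w\}$ with letters $a<b<c$ and words $v,w$, $|v|=i-2$; and (ii) for all such $a<b<c$, $v$, $w$, each element of $W\cap\{v\,bac\,w,\ v\,bca\,w,\ v\,acb\,w,\ v\,cab\,w\}$ belongs to exactly one $i$-edge. Its *generating function* is $\sum_{w\in W}Q_{\mathrm{Des}(w)}(\mathbf x)$, where $Q_{\mathrm{Des}(w)}$ is Gessel's fundamental quasisymmetric function of degree $n$ and $\mathrm{Des}(w)=\{i\mid w_i>w_{i+1}\}$. A *signed, colored graph of degree $n$* is a finite graph with edges colored from $\{2,\dots,n-1\}$ and a signature $\sigma(v)\in\{\pm1\}^{n-1}$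 for every vertex $v$. Its generating function is $\sum_v Q_{\{i\,\mid\,\sigma(v)_i=-1\}}(\mathbf x)$. A D$_0$ graph is regarded as one by setting $\sigma(w)_i=-1$ iff $i\in\mathrm{Des}(w)$. *Axiom 0* says that every vertex is in at most one $i$-edge, for each $i$; then $E_i(v)=w$ means that $\{v,w\}$ is an $i$-edge, and $v$ *admits an $i$-neighbor* if $E_i(v)$ is defined. A vertex $v$ *has $i$-type W* if it admits an $i$-neighbor and an $(i-1)$-neighbor and $\sigma(v)_i=-\sigma(E_{i-1}(v))_i$. For $4\le i<n$, a *flat $i$-chain* (resp. *weak flat $i$-chain*) is a sequence $(x^1,\dots,x^{2h})$ of distinct vertices admitting $(i-2)$-neighbors such that $x^{2j-1}=E_i(x^{2j})$ for $1\le j\le h$ and, for $1\le j<h$, - (flat) $x^{2j+1}=E_{i-2}(E_{i-1}E_{i-2})^{m_j}(x^{2j})$ for some $m_j\ge0$ such that $(E_{i-1}E_{i-2})^{m_j}(x^{2j})$ does not have $(i-1)$-type W; - (weak flat) $x^{2j+1}$ lies in the connected component of $x^{2j}$ in the graph of $(i-2)$- and $(i-1)$-edges, and $E_{i-2}(x^{2j+1})$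 does not have $(i-1)$-type W. For an interval $K=\{k+1,\dots,k+d\}\subseteq\{1,\dots,n\}$, the restriction $\mathrm{Res}_K$ is the signed, colored graph of degree $d$ on the same vertices whose $t$-edges ($2\le t\le d-1$) are the $(k+t)$-edges and whose signature is $(\sigma_{k+1},\dots,\sigma_{k+d-1})$. A function is *Schur positive* if it is a linear combination of Schur functions with nonnegative coefficients. The axioms are (all indices of $\sigma$ within $1,\dots,n-1$): - *Axiom 1*: axiom 0 holds, and $w$ admits an $i$-neighbor iff $\sigma(w)_{i-1}=-\sigma(w)_i$. - *Axiom 2*: for each $i$-edge $\{w,x\}$, $\sigma(w)_j=-\sigma(x)_j$ for $j=i-1,i$, and $\sigma(w)_h=\sigma(x)_h$ for $h<i-2$ and $h>i+1$. - *Axiom 3*: for each $i$-edge $\{w,x\}$, if $\sigma(w)_{i-2}=-\sigma(x)_{i-2}$ then $\sigma(w)_{i-2}=-\sigma(w)_{i-1}$, and if $\sigma(w)_{i+1}=-\sigma(x)_{i+1}$ then $\sigma(w)_{i+1}=-\sigma(w)_i$. - *Axiom 4'a*: if $\{w,v\}$ is an $(i-1)$-edge but not an $i$-edge, $\sigma(w)_{i-3}\ne\sigma(v)_{i-3}$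 and $\sigma(w)_i\ne\sigma(v)_i$, then the components of $w$ in $\mathrm{Res}_{[i-3,i]}$ and in $\mathrm{Res}_{[i-2,i+1]}$ have the same generating function. - *Axiom 4'b* (resp. *4''b*): for every flat (resp. weak flat) $i$-chain $(x^1,\dots,x^{2h})$ and every $2<j<2h-1$ such that $x^j$ has $(i+1)$-type W, all of $x^1,\dots,x^j$ or all of $x^j,\dots,x^{2h}$ have $(i+1)$-type W. - *Axiom 5*: if $\{w,x\}$ is an $i$-edge and $\{x,y\}$ a $j$-edge with $|i-j|\ge3$, then there is a vertex $v$ such that $\{w,v\}$ is a $j$-edge and $\{v,y\}$ an $i$-edge. - *LSP$_d$*: every connected component of every restriction to an interval of size $d$ has a Schur positive generating function. A *D graph* (in the sense of Assaf) is a signed, colored graph satisfying axioms 1, 2, 3, 4'a, 4'b, 5, LSP$_4$ and LSP$_5$. **Theorem.** There exists a D$_0$ graph $\mathcal G^*$ whose vertex set consists of 4950 permutations in $\mathcal S_8$ and which satisfies axioms 4''b, 4'b and 5, such that the generating function of $\mathcal G^*$ is a linear combination of Schur functions in which the coefficient of $s_{(2,2,2,2)}$ is $-1$; in particular it is not Schur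 positive. Moreover $\mathcal G^*$ is a D graph. Hence there are D graphs whose generating functions are not Schur positive. -/

import Mathlib

/-! ### Quasisymmetric functions and Schur functions

Power series in countably many commuting variables `x_0, x_1, x_2, …` with integer coefficients. -/

/-- Gessel's fundamental quasisymmetric function of degree `n` attached to `D ⊆ {1, …, n - 1}`: the
sum of the monomials `x_{s_1} ⋯ x_{s_n}` over all `s_1 ≤ ⋯ ≤ s_n` such that `s_j < s_{j+1}` for all
`j ∈ D`.  (The entry `s_{j+1}` is `s ⟨j, _⟩` below.) -/
noncomputable def fundamentalQSym (n : ℕ) (D : Set ℕ) : MvPowerSeries ℕ ℤ := fun m =>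
  (Nat.card {s : Fin n → ℕ // Monotone s ∧
    (∀ (j : ℕ) (hj : j + 1 < n), j + 1 ∈ D → s ⟨j, by omega⟩ < s ⟨j + 1, hj⟩) ∧
    ∑ j, Finsupp.single (s j) 1 = m} : ℤ)

/-- The Schur function `s_μ`, the sum of `x^T` over all semistandard Young tableaux `T` of
shape `μ`. -/
noncomputable def schurFunction (μ : YoungDiagram) : MvPowerSeries ℕ ℤ := fun m =>
  (Nat.card {T : SemistandardYoungTableau μ //
    ∑ c ∈ μ.cells, Finsupp.single (T c.1 c.2) 1 = m} : ℤ)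

/-- `f = ∑_μ c_μ s_μ`, a finite integral combination of Schur functions. -/
def HasSchurExpansion (f : MvPowerSeries ℕ ℤ) (c : YoungDiagram →₀ ℤ) : Prop :=
  f = c.sum fun μ a => a • schurFunction μ

/-- `f` has an expansion in Schur functions, and the coefficient of `s_μ` in it is `a`. -/
def HasSchurCoeff (f : MvPowerSeries ℕ ℤ) (μ : YoungDiagram) (a : ℤ) : Prop :=
  (∃ c, HasSchurExpansion f c) ∧ ∀ c, HasSchurExpansion f c → c μ = a

/-- `f` is Schur positive: a combination of Schur functions with nonnegative coefficients. -/
def SchurPositive (f : MvPowerSeries ℕ ℤ) : Prop :=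
  ∃ c, HasSchurExpansion f c ∧ ∀ μ, 0 ≤ c μ

/-- The partition `(2, 2, 2, 2)`. -/
def shape2222 : YoungDiagram := YoungDiagram.ofRowLens [2, 2, 2, 2] (by decide)

/-! ### Signed, colored graphs -/

/-- A signed, colored graph of degree `n` on `V`: edges colored by `{2, …, n - 1}` (an edge may
carry several colors) and a signature `σ v = (σ v 1, …, σ v (n - 1))` of signs for every vertex.
Values of `σ v` outside the index range `1, …, n - 1` are irrelevant and never used. -/
structure SignedColoredGraph (n : ℕ) (V : Type*) where
  /-- the graph of the `i`-edges -/
  edge : ℕ → SimpleGraph V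
  /-- the signature function -/
  σ : V → ℕ → ℤˣ
  color_mem : ∀ i v w, (edge i).Adj v w → 2 ≤ i ∧ i < n

namespace SignedColoredGraph

variable {n : ℕ} {V : Type*} (G : SignedColoredGraph n V)

/-- `v` admits an `i`-neighbor. -/
def Admits (i : ℕ) (v : V) : Prop := ∃ w, (G.edge i).Adj v w

/-- `v` has `i`-type W: it admits an `i`-neighbor and an `(i-1)`-neighbor, and
`σ(v)_i = -σ(E_{i-1}(v))_i`. -/
def TypeW (i : ℕ) (v : V) : Prop :=
  G.Admits i v ∧ ∃ u, (G.edge (i - 1)).Adj v u ∧ G.σ v i = -G.σ u i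

/-- The graph of all edges, with colors forgotten. -/
def underlying : SimpleGraph V := ⨆ i, G.edge i

/-- The restriction of `G` to the interval `{k + 1, …, k + d}`, a graph of degree `d`: the color
`k + t` becomes `t` for `2 ≤ t ≤ d - 1`, other edges are dropped, and signatures are shifted
accordingly. -/
def restrict (k d : ℕ) : SignedColoredGraph d V where
  edge t := if 2 ≤ t ∧ t < d then G.edge (k + t) else ⊥
  σ v s := G.σ v (k + s)
  color_mem t v w h := by
    by_contra hc
    rw [if_neg hc] at h
    exact h

open Classical in
/-- The generating function of the connected component of `v`. -/
noncomputable def componentGenFun [Fintype V] (v : V) : MvPowerSeries ℕ ℤ :=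
  ∑ w : V with G.underlying.Reachable v w, fundamentalQSym n {i | G.σ w i = -1}

/-- The generating function of `G`. -/
noncomputable def genFun [Fintype V] : MvPowerSeries ℕ ℤ :=
  ∑ w : V, fundamentalQSym n {i | G.σ w i = -1}

/-- Each vertex has at most one `i`-neighbor. -/
def Axiom0 : Prop :=
  ∀ i v w w', (G.edge i).Adj v w → (G.edge i).Adj v w' → w = w'

def Axiom1 : Prop :=
  G.Axiom0 ∧ ∀ i w, 2 ≤ i → i < n → (G.Admits i w ↔ G.σ w (i - 1) = -G.σ w i)

def Axiom2 : Prop :=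
  ∀ i w x, (G.edge i).Adj w x →
    G.σ w (i - 1) = -G.σ x (i - 1) ∧ G.σ w i = -G.σ x i ∧
    ∀ h, 1 ≤ h → h < n → (h + 2 < i ∨ i + 1 < h) → G.σ w h = G.σ x h

def Axiom3 : Prop :=
  ∀ i w x, (G.edge i).Adj w x →
    (3 ≤ i → G.σ w (i - 2) = -G.σ x (i - 2) → G.σ w (i - 2) = -G.σ w (i - 1)) ∧
    (i + 1 < n → G.σ w (i + 1) = -G.σ x (i + 1) → G.σ w (i + 1) = -G.σ w i)

/-- The two restrictions are those to `[i-3, i]` and to `[i-2, i+1]`. -/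
def Axiom4a [Fintype V] : Prop :=
  ∀ i w v, 4 ≤ i → i < n → (G.edge (i - 1)).Adj w v → ¬ (G.edge i).Adj w v →
    G.σ w (i - 3) ≠ G.σ v (i - 3) → G.σ w i ≠ G.σ v i →
    (G.restrict (i - 4) 4).componentGenFun w = (G.restrict (i - 3) 4).componentGenFun w

/-- `z = E_{i-2} (E_{i-1} E_{i-2})^m y` for some `m ≥ 0` for which `(E_{i-1} E_{i-2})^m y` does not
have `(i-1)`-type W; all the `E`'s are applied along edges. -/
def FlatStep (i : ℕ) (y z : V) : Prop :=
  ∃ u, Relation.ReflTransGen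
      (fun p q => ∃ r, (G.edge (i - 2)).Adj p r ∧ (G.edge (i - 1)).Adj r q) y u ∧
    ¬ G.TypeW (i - 1) u ∧ (G.edge (i - 2)).Adj u z

/-- `z` lies on the `(i-2)`-`(i-1)`-string containing `y`, and `E_{i-2} z` does not have
`(i-1)`-type W. -/
def WeakFlatStep (i : ℕ) (y z : V) : Prop :=
  (G.edge (i - 2) ⊔ G.edge (i - 1)).Reachable y z ∧
    ∃ u, (G.edge (i - 2)).Adj z u ∧ ¬ G.TypeW (i - 1) u

/-- `(x 1, …, x (2 * h))` is a sequence of distinct vertices admitting `(i-2)`-neighbors such that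
`x (2 * j - 1) = E_i (x (2 * j))`, and `x (2 * j)`, `x (2 * j + 1)` are related by `step`. -/
def IsChain (step : V → V → Prop) (i h : ℕ) (x : ℕ → V) : Prop :=
  Set.InjOn x (Set.Icc 1 (2 * h)) ∧
  (∀ j, 1 ≤ j → j ≤ 2 * h → G.Admits (i - 2) (x j)) ∧
  (∀ j, 1 ≤ j → j ≤ h → (G.edge i).Adj (x (2 * j)) (x (2 * j - 1))) ∧
  (∀ j, 1 ≤ j → j < h → step (x (2 * j)) (x (2 * j + 1)))

/-- Flat `i`-chains of length `2 * h`. -/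
def FlatChain (i h : ℕ) (x : ℕ → V) : Prop := G.IsChain (G.FlatStep i) i h x

/-- Weak flat `i`-chains of length `2 * h`. -/
def WeakFlatChain (i h : ℕ) (x : ℕ → V) : Prop := G.IsChain (G.WeakFlatStep i) i h x

/-- If `x j` has `(i+1)`-type W for some `2 < j < 2 * h - 1`, then so do all of `x 1, …, x j` or
all of `x j, …, x (2 * h)`. -/
def ChainCondition (i h : ℕ) (x : ℕ → V) : Prop :=
  ∀ j, 2 < j → j < 2 * h - 1 → G.TypeW (i + 1) (x j) →
    (∀ k, 1 ≤ k → k ≤ j → G.TypeW (i + 1) (x k)) ∨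
    (∀ k, j ≤ k → k ≤ 2 * h → G.TypeW (i + 1) (x k))

/-- Axiom 4'b (for graphs that satisfy axiom 0). -/
def Axiom4b : Prop :=
  ∀ i h x, 4 ≤ i → i < n → G.FlatChain i h x → G.ChainCondition i h x

/-- Axiom 4''b (for graphs that satisfy axiom 0). -/
def Axiom4bStrong : Prop :=
  ∀ i h x, 4 ≤ i → i < n → G.WeakFlatChain i h x → G.ChainCondition i h x

def Axiom5 : Prop :=
  ∀ i j w x y, (i + 3 ≤ j ∨ j + 3 ≤ i) → (G.edge i).Adj w x → (G.edge j).Adj x y →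
    ∃ v, (G.edge j).Adj w v ∧ (G.edge i).Adj v y

/-- Local Schur positivity for degree `d`: each component of each restriction of `G` to an interval
of size `d` in `{1, …, n}` has a Schur positive generating function. -/
def LSP [Fintype V] (d : ℕ) : Prop :=
  ∀ k, k + d ≤ n → ∀ v, SchurPositive ((G.restrict k d).componentGenFun v)

/-- D graphs in the sense of Assaf. -/
def IsDGraph [Fintype V] : Prop :=
  G.Axiom1 ∧ G.Axiom2 ∧ G.Axiom3 ∧ G.Axiom4a ∧ G.Axiom4b ∧ G.Axiom5 ∧ G.LSP 4 ∧ G.LSP 5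

end SignedColoredGraph

/-! ### Words and D₀ graphs -/

/-- Words of length `n` without repeated letters in the alphabet `{1, …, N}`; for `N = n` these are
the permutations of `n` in one-line notation. -/
def IsWord (n N : ℕ) (w : List ℕ) : Prop :=
  w.length = n ∧ w.Nodup ∧ ∀ a ∈ w, 1 ≤ a ∧ a ≤ N

/-- The descent set `{i ∈ {1, …, n - 1} | w_i > w_{i+1}}` of a word of length `n`; the letter `w_i`
is `w.getD (i - 1) 0`. -/
def descentSet (w : List ℕ) : Set ℕ :=
  {i | 1 ≤ i ∧ i < w.length ∧ w.getD i 0 < w.getD (i - 1) 0}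

/-- `{x, y}` is `{v bac w, v bca w}` or `{v acb w, v cab w}` with `a < b < c` and `|v| = i - 2`. -/
def KnuthPair (i : ℕ) (x y : List ℕ) : Prop :=
  ∃ (v w : List ℕ) (a b c : ℕ), a < b ∧ b < c ∧ v.length + 2 = i ∧
    (({x, y} : Set (List ℕ)) = {v ++ [b, a, c] ++ w, v ++ [b, c, a] ++ w} ∨
     ({x, y} : Set (List ℕ)) = {v ++ [a, c, b] ++ w, v ++ [c, a, b] ++ w})

/-- `{x, y}` is `{v bac w, v acb w}` or `{v bca w, v cab w}` with `a < b < c` and `|v| = i - 2`. -/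
def RotationPair (i : ℕ) (x y : List ℕ) : Prop :=
  ∃ (v w : List ℕ) (a b c : ℕ), a < b ∧ b < c ∧ v.length + 2 = i ∧
    (({x, y} : Set (List ℕ)) = {v ++ [b, a, c] ++ w, v ++ [a, c, b] ++ w} ∨
     ({x, y} : Set (List ℕ)) = {v ++ [b, c, a] ++ w, v ++ [c, a, b] ++ w})

/-- The four words `v bac w`, `v bca w`, `v acb w`, `v cab w`. -/
def krSquare (v w : List ℕ) (a b c : ℕ) : Set (List ℕ) :=
  {v ++ [b, a, c] ++ w, v ++ [b, c, a] ++ w, v ++ [a, c, b] ++ w, v ++ [c, a, b] ++ w}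

/-- A D₀ graph of degree `n` over the alphabet `{1, …, N}`. -/
structure D0Graph (n N : ℕ) where
  /-- the vertex set -/
  verts : Finset (List ℕ)
  isWord : ∀ w ∈ verts, IsWord n N w
  /-- the graph of the `i`-edges -/
  edge : ℕ → SimpleGraph {w : List ℕ // w ∈ verts}
  color_mem : ∀ i x y, (edge i).Adj x y → 2 ≤ i ∧ i < n
  edge_type : ∀ i x y, (edge i).Adj x y → KnuthPair i x y ∨ RotationPair i x y
  existsUnique_edge : ∀ (v w : List ℕ) (a b c : ℕ), a < b → b < c →
    ∀ x : {w : List ℕ // w ∈ verts}, (x : List ℕ) ∈ krSquare v w a b c →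
      ∃! y, (edge (v.length + 2)).Adj x y

namespace D0Graph

variable {n N : ℕ} (G : D0Graph n N)

/-- The generating function `∑_w Q_{Des(w)}` over the vertices `w`. -/
noncomputable def genFun : MvPowerSeries ℕ ℤ :=
  ∑ w ∈ G.verts, fundamentalQSym n (descentSet w)

open Classical in
/-- A D₀ graph as a signed, colored graph: `σ(w)_i = -1` exactly if `i` is a descent of `w`. -/
noncomputable def toSignedColoredGraph :
    SignedColoredGraph n {w : List ℕ // w ∈ G.verts} where
  edge := G.edge
  σ w i := if i ∈ descentSet w.1 then -1 else 1
  color_mem := G.color_mem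

end D0Graph

/-!
The graph is given by a set of permutations together with the choice, for each vertex `w` and each
`i`, of the kind of its `i`-edge: a Knuth move or a rotation. Axioms 1, 2, 3 hold for every such
system of moves, axiom 5 holds because moves in disjoint windows commute, and LSP₄ and LSP₅ hold
because, after standardization, a component of a restriction to an interval of size `d ≤ 5` is one
of finitely many systems of moves on words of length `d`.

In the counterexample most components are complete Knuth classes; their vertices are the
permutations whose inverse has one of 32 descent sets. There the edges in three consecutive
directions are modelled by the Knuth moves on permutations of 5, weak flat chains have at most four
vertices, and axiom 4''b is void. The rotations are all in an exceptional component of 126 vertices,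
where axioms 4'a and 4''b only concern short paths and are verified vertex by vertex.

The permutations with given inverse descents are enumerated by inserting the letters in increasing
order, which yields the generating function without the list of words. Its Schur expansion is
verified by comparing, for every set `T`, the number of vertices with descent set in `T` with the
corresponding combination of Kostka numbers.
-/

/-! ### Horizontal strips and the branching rule for Schur functions -/

/-- The content of a tableau `T`, that is, the exponent of the monomial `x^T`. -/
noncomputable def content {μ : YoungDiagram} (T : SemistandardYoungTableau μ) : ℕ →₀ ℕ :=
  ∑ c ∈ μ.cells, Finsupp.single (T c.1 c.2) 1

/-- `ν` is contained in `μ` and the skew shape `μ / ν` is a horizontal strip: it has at most one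
cell in each column. -/
structure IsHorizontalStrip (ν μ : YoungDiagram) : Prop where
  le : ν ≤ μ
  mem_of_succ_mem : ∀ i j, (i + 1, j) ∈ μ → (i, j) ∈ ν

section Tableaux

variable {μ ν : YoungDiagram} {N : ℕ}

theorem schurFunction_apply (μ : YoungDiagram) (m : ℕ →₀ ℕ) :
    schurFunction μ m = Nat.card {T : SemistandardYoungTableau μ // content T = m} := rfl

theorem content_apply (T : SemistandardYoungTableau μ) (v : ℕ) :
    content T v = (μ.cells.filter fun c => T c.1 c.2 = v).card := by
  rw [content, Finsupp.finsetSum_apply, Finset.card_filter]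
  exact Finset.sum_congr rfl fun c _ => Finsupp.single_apply

theorem content_entry_ne_zero (T : SemistandardYoungTableau μ) {c : ℕ × ℕ} (hc : c ∈ μ) :
    content T (T c.1 c.2) ≠ 0 := by
  rw [content_apply, Finset.card_ne_zero]
  exact ⟨c, Finset.mem_filter.2 ⟨hc, rfl⟩⟩

instance finite_tableaux_of_content (μ : YoungDiagram) (m : ℕ →₀ ℕ) :
    Finite {T : SemistandardYoungTableau μ // content T = m} := by
  let entries (T : {T : SemistandardYoungTableau μ // content T = m}) (c : μ.cells) : m.support :=
    ⟨T.1 c.1.1 c.1.2, Finsupp.mem_support_iff.2 <|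
      DFunLike.congr_fun T.2 _ ▸ content_entry_ne_zero T.1 c.2⟩
  refine Finite.of_injective entries fun S T h => Subtype.ext (SemistandardYoungTableau.ext ?_)
  intro i j
  by_cases hc : (i, j) ∈ μ
  · exact congrArg Subtype.val (congrFun h ⟨(i, j), hc⟩)
  · rw [S.1.zeros hc, T.1.zeros hc]

/-- The cells of `T` whose entry is smaller than `N`. -/
def shapeBelow (T : SemistandardYoungTableau μ) (N : ℕ) : YoungDiagram where
  cells := μ.cells.filter fun c => T c.1 c.2 < N
  isLowerSet := by
    rintro ⟨i, j⟩ ⟨i', j'⟩ ⟨hi : i' ≤ i, hj : j' ≤ j⟩ hc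
    simp only [Finset.coe_filter, Set.mem_ofPred_eq, YoungDiagram.mem_cells] at hc ⊢
    exact ⟨μ.up_left_mem hi hj hc.1, (T.row_weak_of_le hj (μ.up_left_mem hi le_rfl hc.1)).trans
      (T.col_weak hi hc.1) |>.trans_lt hc.2⟩

theorem mem_shapeBelow {T : SemistandardYoungTableau μ} {c : ℕ × ℕ} :
    c ∈ shapeBelow T N ↔ c ∈ μ ∧ T c.1 c.2 < N := Finset.mem_filter

/-- The restriction of a tableau to a smaller shape. -/
def restrictShape (T : SemistandardYoungTableau μ) (h : ν ≤ μ) : SemistandardYoungTableau ν where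
  entry i j := if (i, j) ∈ ν then T i j else 0
  row_weak' {i j₁ j₂} hj hc := by
    rw [if_pos hc, if_pos (ν.up_left_mem le_rfl hj.le hc)]
    exact T.row_weak hj (h hc)
  col_strict' {i₁ i₂ j} hi hc := by
    rw [if_pos hc, if_pos (ν.up_left_mem hi.le le_rfl hc)]
    exact T.col_strict hi (h hc)
  zeros' hc := if_neg hc

theorem restrictShape_apply {T : SemistandardYoungTableau μ} {h : ν ≤ μ} {i j : ℕ}
    (hc : (i, j) ∈ ν) : restrictShape T h i j = T i j := if_pos hc

/-- The extension of a tableau with entries smaller than `N` by a horizontal strip of `N`'s. -/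
def fillStrip (S : SemistandardYoungTableau ν) (h : IsHorizontalStrip ν μ)
    (hS : ∀ i j, (i, j) ∈ ν → S i j < N) : SemistandardYoungTableau μ where
  entry i j := if (i, j) ∈ ν then S i j else if (i, j) ∈ μ then N else 0
  row_weak' {i j₁ j₂} hj hc := by
    by_cases hν : (i, j₂) ∈ ν
    · have hν' := ν.up_left_mem le_rfl hj.le hν
      simpa only [if_pos hν, if_pos hν'] using S.row_weak hj hν
    · rw [if_neg hν, if_pos hc]
      split_ifs with h₁
      exacts [(hS _ _ h₁).le, le_rfl, Nat.zero_le N]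
  col_strict' {i₁ i₂ j} hi hc := by
    have hν : (i₁, j) ∈ ν := h.mem_of_succ_mem i₁ j (μ.up_left_mem hi le_rfl hc)
    rw [if_pos hν, if_pos hc]
    split_ifs with h₂
    exacts [S.col_strict hi h₂, hS _ _ hν]
  zeros' {i j} hc := by rw [if_neg fun hν => hc (h.le hν), if_neg hc]

theorem fillStrip_apply_of_mem {S : SemistandardYoungTableau ν} {h : IsHorizontalStrip ν μ}
    {hS : ∀ i j, (i, j) ∈ ν → S i j < N} {i j : ℕ} (hc : (i, j) ∈ ν) :
    fillStrip S h hS i j = S i j := if_pos hc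

theorem fillStrip_apply_of_notMem {S : SemistandardYoungTableau ν} {h : IsHorizontalStrip ν μ}
    {hS : ∀ i j, (i, j) ∈ ν → S i j < N} {i j : ℕ} (hμ : (i, j) ∈ μ) (hν : (i, j) ∉ ν) :
    fillStrip S h hS i j = N := (if_neg hν).trans (if_pos hμ)

theorem restrictShape_fillStrip (S : SemistandardYoungTableau ν) (h : IsHorizontalStrip ν μ)
    (hS : ∀ i j, (i, j) ∈ ν → S i j < N) : restrictShape (fillStrip S h hS) h.le = S := by
  refine SemistandardYoungTableau.ext fun i j => ?_
  by_cases hc : (i, j) ∈ ν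
  · rw [restrictShape_apply hc, fillStrip_apply_of_mem hc]
  · rw [SemistandardYoungTableau.zeros _ hc, S.zeros hc]

theorem shapeBelow_fillStrip (S : SemistandardYoungTableau ν) (h : IsHorizontalStrip ν μ)
    (hS : ∀ i j, (i, j) ∈ ν → S i j < N) : shapeBelow (fillStrip S h hS) N = ν := by
  refine SetLike.ext fun ⟨i, j⟩ => ?_
  rw [mem_shapeBelow]
  by_cases hν : (i, j) ∈ ν
  · simp only [fillStrip_apply_of_mem hν, hν, h.le hν, hS i j hν, and_self]
  · refine iff_of_false (fun hc => ?_) hν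
    exact absurd hc.2 (fillStrip_apply_of_notMem hc.1 hν).not_lt

theorem restrictShape_lt {T : SemistandardYoungTableau μ} (h : ν ≤ μ) (hν : ν = shapeBelow T N)
    (i j : ℕ) (hc : (i, j) ∈ ν) : restrictShape T h i j < N := by
  rw [restrictShape_apply hc]
  exact (mem_shapeBelow.1 (hν ▸ hc)).2

theorem fillStrip_restrictShape {T : SemistandardYoungTableau μ} (hT : ∀ c ∈ μ, T c.1 c.2 ≤ N)
    (h : IsHorizontalStrip ν μ) (hν : ν = shapeBelow T N) :
    fillStrip (restrictShape T h.le) h (restrictShape_lt h.le hν) = T := by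
  refine SemistandardYoungTableau.ext fun i j => ?_
  by_cases hc : (i, j) ∈ ν
  · rw [fillStrip_apply_of_mem hc, restrictShape_apply hc]
  · by_cases hμ : (i, j) ∈ μ
    · rw [fillStrip_apply_of_notMem hμ hc]
      rw [hν, mem_shapeBelow] at hc
      exact (not_lt.1 fun hlt => hc ⟨hμ, hlt⟩).antisymm (hT _ hμ)
    · rw [SemistandardYoungTableau.zeros _ hμ, T.zeros hμ]

theorem isHorizontalStrip_shapeBelow {T : SemistandardYoungTableau μ}
    (hT : ∀ c ∈ μ, T c.1 c.2 ≤ N) : IsHorizontalStrip (shapeBelow T N) μ := by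
  refine ⟨fun c hc => (mem_shapeBelow.1 hc).1, fun i j hc => mem_shapeBelow.2 ⟨?_, ?_⟩⟩
  · exact μ.up_left_mem i.le_succ le_rfl hc
  · exact (T.col_strict i.lt_succ_self hc).trans_le (hT _ hc)

theorem content_fillStrip (S : SemistandardYoungTableau ν) (h : IsHorizontalStrip ν μ)
    (hS : ∀ i j, (i, j) ∈ ν → S i j < N) :
    content (fillStrip S h hS) = content S + Finsupp.single N (μ.card - ν.card) := by
  have hsub : ν.cells ⊆ μ.cells := YoungDiagram.cells_subset_iff.2 h.le
  have hstrip : ∑ c ∈ μ.cells \ ν.cells, Finsupp.single (fillStrip S h hS c.1 c.2) 1 =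
      Finsupp.single N (μ.card - ν.card) := by
    rw [Finset.sum_congr rfl fun c hc => by
        rw [fillStrip_apply_of_notMem (Finset.mem_sdiff.1 hc).1 (Finset.mem_sdiff.1 hc).2],
      Finset.sum_const, Finset.card_sdiff_of_subset hsub, Finsupp.smul_single, smul_eq_mul, mul_one]
  rw [content, ← Finset.sum_sdiff hsub, hstrip, add_comm, content]
  exact congrArg (· + _) (Finset.sum_congr rfl fun c hc => by
    rw [fillStrip_apply_of_mem ((YoungDiagram.mem_cells c).1 hc)])

theorem card_shapeBelow_add_content {T : SemistandardYoungTableau μ}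
    (hT : ∀ c ∈ μ, T c.1 c.2 ≤ N) : (shapeBelow T N).card + content T N = μ.card := by
  have hmax : ∀ c ∈ μ.cells, T c.1 c.2 = N ↔ ¬ T c.1 c.2 < N := fun c hc =>
    ⟨fun h => h.not_lt, fun h => (hT c hc).antisymm (not_lt.1 h)⟩
  rw [content_apply, Finset.filter_congr hmax]
  exact Finset.card_filter_add_card_filter_not _

theorem entry_le_of_content {T : SemistandardYoungTableau μ} (hT : ∀ v, N < v → content T v = 0) :
    ∀ c ∈ μ, T c.1 c.2 ≤ N := fun _ hc =>
  not_lt.1 fun hlt => content_entry_ne_zero T hc (hT _ hlt)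

variable {m : ℕ →₀ ℕ}

theorem content_restrictShape {T : SemistandardYoungTableau μ}
    (hT : ∀ v, N < v → content T v = 0) (h : IsHorizontalStrip ν μ) (hν : ν = shapeBelow T N)
    (hcard : ν.card + content T N = μ.card) :
    content (restrictShape T h.le) = (content T).erase N := by
  have hfill := fillStrip_restrictShape (entry_le_of_content hT) h hν
  have hcontent := content_fillStrip (restrictShape T h.le) h (restrictShape_lt h.le hν)
  rw [hfill, ← hcard, Nat.add_sub_cancel_left] at hcontent
  refine add_right_cancel (b := Finsupp.single N (content T N)) ?_
  rw [← hcontent, Finsupp.erase_add_single]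

theorem entry_lt_of_content_eq_erase (hm : ∀ v, N < v → m v = 0) {S : SemistandardYoungTableau ν}
    (hS : content S = m.erase N) (i j : ℕ) (hc : (i, j) ∈ ν) : S i j < N := by
  refine not_le.1 fun hle => content_entry_ne_zero S hc ?_
  rw [hS, Finsupp.erase_apply]
  split_ifs with h
  exacts [rfl, hm _ (lt_of_le_of_ne hle (Ne.symm h))]

/-- Removing the largest letter from the tableaux of content `m` whose remaining letters fill the
shape `ν`. -/
def removeMaxEquiv (hm : ∀ v, N < v → m v = 0) (h : IsHorizontalStrip ν μ)
    (hcard : ν.card + m N = μ.card) :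
    {T : {T : SemistandardYoungTableau μ // content T = m} // shapeBelow T.1 N = ν} ≃
      {S : SemistandardYoungTableau ν // content S = m.erase N} where
  toFun T := ⟨restrictShape T.1.1 h.le, by
    obtain ⟨⟨T, rfl⟩, hν⟩ := T
    exact content_restrictShape hm h hν.symm hcard⟩
  invFun S := ⟨⟨fillStrip S.1 h (entry_lt_of_content_eq_erase hm S.2), by
    rw [content_fillStrip, S.2, ← hcard, Nat.add_sub_cancel_left, Finsupp.erase_add_single]⟩,
    shapeBelow_fillStrip S.1 h (entry_lt_of_content_eq_erase hm S.2)⟩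
  left_inv T := Subtype.ext <| Subtype.ext <|
    fillStrip_restrictShape (entry_le_of_content (T.1.2.symm ▸ hm)) h T.2.symm
  right_inv S := Subtype.ext <|
    restrictShape_fillStrip S.1 h (entry_lt_of_content_eq_erase hm S.2)

theorem schurFunction_apply_eq_sum (hm : ∀ v, N < v → m v = 0) {strips : Finset YoungDiagram}
    (hstrips : ∀ ν, ν ∈ strips ↔ IsHorizontalStrip ν μ ∧ ν.card + m N = μ.card) :
    schurFunction μ m = ∑ ν ∈ strips, schurFunction ν (m.erase N) := by
  classical
  have := Fintype.ofFinite {T : SemistandardYoungTableau μ // content T = m}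
  have hmaps : ∀ T ∈ (Finset.univ : Finset {T : SemistandardYoungTableau μ // content T = m}),
      shapeBelow T.1 N ∈ strips := by
    rintro ⟨T, rfl⟩ -
    have hT := entry_le_of_content hm
    exact (hstrips _).2 ⟨isHorizontalStrip_shapeBelow hT, card_shapeBelow_add_content hT⟩
  rw [schurFunction_apply, Nat.card_eq_fintype_card, ← Finset.card_univ,
    Finset.card_eq_sum_card_fiberwise hmaps, Nat.cast_sum]
  refine Finset.sum_congr rfl fun ν hν => ?_
  obtain ⟨h, hcard⟩ := (hstrips ν).1 hν
  rw [schurFunction_apply, ← Nat.card_congr (removeMaxEquiv hm h hcard), Nat.card_eq_fintype_card,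
    Fintype.card_subtype]

end Tableaux

/-! ### Kostka numbers -/

/-- The `i`-th part of `l`, with `0` beyond the end of the list. -/
def part (l : List ℕ) (i : ℕ) : ℕ := l.getD i 0

theorem part_of_lt {l : List ℕ} {i : ℕ} (h : i < l.length) : part l i = l[i] :=
  List.getD_eq_getElem _ _ h

theorem part_of_length_le {l : List ℕ} {i : ℕ} (h : l.length ≤ i) : part l i = 0 :=
  List.getD_eq_default _ _ h

theorem sortedGE_iff_part_succ_le {l : List ℕ} : l.SortedGE ↔ ∀ i, part l (i + 1) ≤ part l i := by
  rw [List.sortedGE_iff_isChain, List.isChain_iff_getElem]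
  refine ⟨fun h i => ?_, fun h i hi => ?_⟩
  · rcases lt_or_ge (i + 1) l.length with hi | hi
    · rw [part_of_lt hi, part_of_lt (by omega)]
      exact h i hi
    · rw [part_of_length_le hi]
      exact Nat.zero_le _
  · have := h i
    rwa [part_of_lt hi, part_of_lt (by omega)] at this

theorem eq_of_part_eq {l l' : List ℕ} (hlen : l.length = l'.length)
    (h : ∀ i, part l i = part l' i) : l = l' :=
  List.ext_getElem hlen fun i hi hi' => by rw [← part_of_lt hi, ← part_of_lt hi', h]

/-- The partitions `ν`, padded with zeros to the length of `l`, such that `l / ν` is a horizontal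
strip of size `a`. -/
def strips : ℕ → List ℕ → List (List ℕ)
  | 0, [] => [[]]
  | _ + 1, [] => []
  | a, x :: t => (List.range (min a (x - part t 0) + 1)).flatMap fun k =>
      (strips (a - k) t).map ((x - k) :: ·)

/-- The number of semistandard tableaux of shape `l` with `c_1` entries equal to the largest
letter, `c_2` entries equal to the second largest letter, and so on. -/
def kostka : List ℕ → List ℕ → ℕ
  | [], l => if l.sum = 0 then 1 else 0
  | a :: c, l => ((strips a l).map (kostka c)).sum

/-- `l / ν` is a horizontal strip, for partitions padded with zeros to the same length. -/
def Interlaces (ν l : List ℕ) : Prop :=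
  ν.length = l.length ∧ ∀ i, part l (i + 1) ≤ part ν i ∧ part ν i ≤ part l i

theorem Interlaces.sortedGE {ν l : List ℕ} (h : Interlaces ν l) : ν.SortedGE :=
  sortedGE_iff_part_succ_le.2 fun i => (h.2 (i + 1)).2.trans (h.2 i).1

theorem interlaces_nil {ν : List ℕ} : Interlaces ν [] ↔ ν = [] := by
  refine ⟨fun h => List.eq_nil_of_length_eq_zero h.1, ?_⟩
  rintro rfl
  exact ⟨rfl, fun _ => ⟨le_rfl, le_rfl⟩⟩

theorem interlaces_cons {y x : ℕ} {ν t : List ℕ} :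
    Interlaces (y :: ν) (x :: t) ↔ (part t 0 ≤ y ∧ y ≤ x) ∧ Interlaces ν t := by
  simp only [Interlaces, List.length_cons, add_left_inj]
  constructor
  · rintro ⟨hlen, h⟩
    exact ⟨h 0, hlen, fun i => h (i + 1)⟩
  · rintro ⟨h0, hlen, h⟩
    exact ⟨hlen, fun | 0 => h0 | i + 1 => h i⟩

theorem Interlaces.sum_le {ν l : List ℕ} (h : Interlaces ν l) : ν.sum ≤ l.sum := by
  induction l generalizing ν with
  | nil => rw [interlaces_nil.1 h]
  | cons x t ih =>
    obtain _ | ⟨y, ν⟩ := ν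
    · exact absurd h.1 (by simp)
    · obtain ⟨⟨-, hyx⟩, hν⟩ := interlaces_cons.1 h
      simpa only [List.sum_cons] using add_le_add hyx (ih hν)

theorem mem_strips_cons {a x y : ℕ} {ν t : List ℕ} (hx : part t 0 ≤ x) :
    y :: ν ∈ strips a (x :: t) ↔
      (part t 0 ≤ y ∧ y ≤ x) ∧ x ≤ y + a ∧ ν ∈ strips (y + a - x) t := by
  simp only [strips, List.mem_flatMap, List.mem_range, List.mem_map, List.cons.injEq]
  constructor
  · rintro ⟨k, hk, ν', hν', rfl, rfl⟩
    refine ⟨by omega, by omega, ?_⟩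
    rwa [show x - k + a - x = a - k by omega]
  · rintro ⟨hy, hxy, hν⟩
    refine ⟨x - y, by omega, ν, ?_, by omega, rfl⟩
    rwa [show a - (x - y) = y + a - x by omega]

theorem mem_strips {a : ℕ} {l ν : List ℕ} (hl : l.SortedGE) :
    ν ∈ strips a l ↔ Interlaces ν l ∧ ν.sum + a = l.sum := by
  induction l generalizing a ν with
  | nil =>
    rw [interlaces_nil]
    cases a <;> simp +contextual [strips]
  | cons x t ih =>
    have hx : part t 0 ≤ x := sortedGE_iff_part_succ_le.1 hl 0
    have ht : t.SortedGE := hl.pairwise.tail.sortedGE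
    obtain _ | ⟨y, ν⟩ := ν
    · simp [strips, Interlaces]
    · rw [mem_strips_cons hx, interlaces_cons, ih ht, List.sum_cons, List.sum_cons]
      have hle : Interlaces ν t → ν.sum ≤ t.sum := Interlaces.sum_le
      constructor
      · rintro ⟨hy, hxy, hν, hsum⟩
        exact ⟨⟨hy, hν⟩, by omega⟩
      · rintro ⟨⟨hy, hν⟩, hsum⟩
        have := hle hν
        exact ⟨hy, by omega, hν, by omega⟩

theorem nodup_strips (a : ℕ) (l : List ℕ) : (strips a l).Nodup := by
  induction l generalizing a with
  | nil => cases a <;> simp [strips]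
  | cons x t ih =>
    rw [strips, List.nodup_flatMap]
    refine ⟨fun k _ => (ih _).map (List.cons_injective (a := x - k)), ?_⟩
    refine List.Pairwise.imp_of_mem (fun {k k'} hk hk' hne => ?_) List.nodup_range
    rw [Function.onFun, List.disjoint_left]
    intro ν hν hν'
    obtain ⟨_, _, rfl⟩ := List.mem_map.1 hν
    obtain ⟨_, _, hcons⟩ := List.mem_map.1 hν'
    have := (List.cons.inj hcons).1
    rw [List.mem_range] at hk hk'
    omega

/-- The Young diagram with row lengths `l` (the empty one if `l` is not weakly decreasing). -/
def diagram (l : List ℕ) : YoungDiagram :=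
  if h : l.SortedGE then YoungDiagram.ofRowLens l h else ⊥

theorem diagram_of_sortedGE {l : List ℕ} (h : l.SortedGE) :
    diagram l = YoungDiagram.ofRowLens l h := dif_pos h

theorem mem_diagram {l : List ℕ} (h : l.SortedGE) {i j : ℕ} :
    (i, j) ∈ diagram l ↔ j < part l i := by
  rw [diagram_of_sortedGE h, YoungDiagram.mem_ofRowLens]
  rcases lt_or_ge i l.length with hi | hi
  · simp only [hi, exists_true_left, part_of_lt hi]
  · simp only [hi.not_gt, part_of_length_le hi, Nat.not_lt_zero, IsEmpty.exists_iff]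

theorem rowLen_diagram {l : List ℕ} (h : l.SortedGE) (i : ℕ) :
    (diagram l).rowLen i = part l i :=
  eq_of_forall_lt_iff fun j => by rw [← YoungDiagram.mem_iff_lt_rowLen, mem_diagram h]

theorem card_cellsOfRowLens (l : List ℕ) : (YoungDiagram.cellsOfRowLens l).card = l.sum := by
  induction l with
  | nil => rfl
  | cons x t ih =>
    rw [YoungDiagram.cellsOfRowLens, Finset.card_union_of_disjoint, Finset.card_map, ih,
      Finset.card_product, Finset.card_singleton, Finset.card_range, one_mul, List.sum_cons]
    rw [Finset.disjoint_left]
    rintro ⟨i, j⟩ hrow hrest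
    obtain ⟨c, -, hc⟩ := Finset.mem_map.1 hrest
    rw [Finset.mem_product, Finset.mem_singleton] at hrow
    exact Nat.succ_ne_zero c.1 ((congrArg Prod.fst hc).trans hrow.1)

theorem card_diagram {l : List ℕ} (h : l.SortedGE) : (diagram l).card = l.sum := by
  rw [diagram_of_sortedGE h]
  exact card_cellsOfRowLens l

theorem diagram_injective {l l' : List ℕ} (hl : l.SortedGE) (hl' : l'.SortedGE)
    (hlen : l.length = l'.length) (h : diagram l = diagram l') : l = l' :=
  eq_of_part_eq hlen fun i => by rw [← rowLen_diagram hl, ← rowLen_diagram hl', h]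

theorem isHorizontalStrip_diagram {ν l : List ℕ} (hν : ν.SortedGE) (hl : l.SortedGE)
    (hlen : ν.length = l.length) :
    IsHorizontalStrip (diagram ν) (diagram l) ↔ Interlaces ν l := by
  refine ⟨fun h => ⟨hlen, fun i => ⟨?_, ?_⟩⟩, fun h => ⟨?_, fun i j => ?_⟩⟩
  · refine le_of_forall_lt fun j hj => ?_
    rw [← mem_diagram hl] at hj
    exact (mem_diagram hν).1 (h.mem_of_succ_mem i j hj)
  · refine le_of_forall_lt fun j hj => ?_
    rw [← mem_diagram hν] at hj
    exact (mem_diagram hl).1 (h.le hj)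
  · rintro ⟨i, j⟩
    rw [mem_diagram hν, mem_diagram hl]
    exact fun hj => hj.trans_le (h.2 i).2
  · rw [mem_diagram hν, mem_diagram hl]
    exact fun hj => hj.trans_le (h.2 i).1

theorem exists_eq_diagram_of_le {ν : YoungDiagram} {l : List ℕ} (hl : l.SortedGE)
    (h : ν ≤ diagram l) : ∃ p : List ℕ, p.length = l.length ∧ p.SortedGE ∧ ν = diagram p := by
  set p := (List.range l.length).map ν.rowLen with hp
  have hpart : ∀ i, part p i = ν.rowLen i := by
    intro i
    rcases lt_or_ge i l.length with hi | hi
    · rw [part_of_lt (by simpa [hp] using hi)]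
      simp [hp]
    · rw [part_of_length_le (by simpa [hp] using hi), eq_comm, ← Nat.le_zero]
      refine le_of_forall_lt fun j hj => ?_
      have hj := (mem_diagram hl).1 (h (YoungDiagram.mem_iff_lt_rowLen.2 hj))
      rwa [part_of_length_le hi] at hj
  have hsorted : p.SortedGE := sortedGE_iff_part_succ_le.2 fun i => by
    rw [hpart, hpart]
    exact ν.rowLen_anti _ _ i.le_succ
  refine ⟨p, by simp [hp], hsorted, SetLike.ext fun ⟨i, j⟩ => ?_⟩
  rw [mem_diagram hsorted, hpart, YoungDiagram.mem_iff_lt_rowLen]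

theorem mem_map_diagram_strips {l : List ℕ} (hl : l.SortedGE) {a : ℕ} {ν : YoungDiagram} :
    ν ∈ (strips a l).map diagram ↔
      IsHorizontalStrip ν (diagram l) ∧ ν.card + a = (diagram l).card := by
  rw [List.mem_map, card_diagram hl]
  constructor
  · rintro ⟨p, hp, rfl⟩
    obtain ⟨hstrip, hsum⟩ := (mem_strips hl).1 hp
    rw [card_diagram hstrip.sortedGE]
    exact ⟨(isHorizontalStrip_diagram hstrip.sortedGE hl hstrip.1).2 hstrip, hsum⟩
  · rintro ⟨hstrip, hcard⟩
    obtain ⟨p, hlen, hp, rfl⟩ := exists_eq_diagram_of_le hl hstrip.le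
    rw [card_diagram hp] at hcard
    exact ⟨p, (mem_strips hl).2 ⟨(isHorizontalStrip_diagram hp hl hlen).1 hstrip, hcard⟩, rfl⟩

theorem nodup_map_diagram_strips {l : List ℕ} (hl : l.SortedGE) (a : ℕ) :
    ((strips a l).map diagram).Nodup := by
  refine (nodup_strips a l).map_on fun p hp q hq => ?_
  have hp := ((mem_strips hl).1 hp).1
  have hq := ((mem_strips hl).1 hq).1
  exact diagram_injective hp.sortedGE hq.sortedGE (hp.1.trans hq.1.symm)

/-- The list `[m (N - 1), …, m 1, m 0]`. -/
def multiplicities (m : ℕ → ℕ) : ℕ → List ℕ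
  | 0 => []
  | N + 1 => m N :: multiplicities m N

theorem multiplicities_congr {m m' : ℕ → ℕ} {N : ℕ} (h : ∀ v < N, m v = m' v) :
    multiplicities m N = multiplicities m' N := by
  induction N with
  | zero => rfl
  | succ N ih =>
    rw [multiplicities, multiplicities, h N N.lt_succ_self, ih fun v hv => h v (by omega)]

theorem schurFunction_apply_zero (μ : YoungDiagram) :
    schurFunction μ 0 = if μ.card = 0 then 1 else 0 := by
  rw [schurFunction_apply]
  split_ifs with h
  · have hcells : μ.cells = ∅ := Finset.card_eq_zero.1 h
    have : Subsingleton {T : SemistandardYoungTableau μ // content T = 0} := by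
      refine ⟨fun S T => Subtype.ext (SemistandardYoungTableau.ext fun i j => ?_)⟩
      have hc : (i, j) ∉ μ := by
        rw [← YoungDiagram.mem_cells, hcells]
        exact Finset.notMem_empty _
      rw [S.1.zeros hc, T.1.zeros hc]
    have : Nonempty {T : SemistandardYoungTableau μ // content T = 0} :=
      ⟨SemistandardYoungTableau.highestWeight μ, by rw [content, hcells, Finset.sum_empty]⟩
    rw [Nat.card_of_subsingleton (Classical.arbitrary _), Nat.cast_one]
  · rw [Nat.card_eq_zero.2, Nat.cast_zero]
    refine Or.inl ⟨fun ⟨T, hT⟩ => ?_⟩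
    obtain ⟨c, hc⟩ := Finset.card_ne_zero.1 h
    exact content_entry_ne_zero T hc (by rw [hT, Finsupp.zero_apply])

theorem schurFunction_diagram_apply {l : List ℕ} (hl : l.SortedGE) {N : ℕ} {m : ℕ →₀ ℕ}
    (hm : ∀ v, N ≤ v → m v = 0) :
    schurFunction (diagram l) m = kostka (multiplicities m N) l := by
  induction N generalizing l m with
  | zero =>
    obtain rfl : m = 0 := Finsupp.ext fun v => hm v v.zero_le
    rw [schurFunction_apply_zero, card_diagram hl, multiplicities, kostka, Nat.cast_ite,
      Nat.cast_one, Nat.cast_zero]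
  | succ N ih =>
    classical
    rw [schurFunction_apply_eq_sum (N := N) (strips := ((strips (m N) l).map diagram).toFinset) hm
      fun ν => by rw [List.mem_toFinset, mem_map_diagram_strips hl]]
    have herase : multiplicities (m.erase N) N = multiplicities m N :=
      multiplicities_congr fun v hv => Finsupp.erase_ne hv.ne
    rw [List.sum_toFinset _ (nodup_map_diagram_strips hl _), List.map_map, multiplicities, kostka,
      Nat.cast_list_sum, List.map_map]
    refine congrArg List.sum (List.map_congr_left fun p hp => ?_)
    rw [Function.comp_apply, ih ((mem_strips hl).1 hp).1.sortedGE, herase]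
    · rfl
    · intro v hv
      rw [Finsupp.erase_apply]
      split_ifs with h
      exacts [rfl, hm v (by omega)]

/-! ### Coefficients of fundamental quasisymmetric functions -/

/-- `m 0 + ⋯ + m (v - 1)`. A weakly increasing word with `m u` letters `u` for every `u` has this
many letters smaller than `v`, all of them at its beginning. -/
def partialSum (m : ℕ → ℕ) (v : ℕ) : ℕ := ∑ u ∈ Finset.range v, m u

theorem partialSum_succ (m : ℕ → ℕ) (v : ℕ) : partialSum m (v + 1) = partialSum m v + m v :=
  Finset.sum_range_succ m v

theorem partialSum_mono (m : ℕ → ℕ) : Monotone (partialSum m) :=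
  monotone_nat_of_le_succ fun v => (partialSum_succ m v).symm ▸ Nat.le_add_right _ _

theorem partialSum_of_le {m : ℕ → ℕ} {N : ℕ} (hm : ∀ v, N ≤ v → m v = 0) {v : ℕ} (hv : N ≤ v) :
    partialSum m v = partialSum m N := by
  induction v, hv using Nat.le_induction with
  | base => rfl
  | succ v hv ih => rw [partialSum_succ, ih, hm v hv, add_zero]

section WeaklyIncreasingWords

variable {n : ℕ} {s : Fin n → ℕ} {m : ℕ → ℕ}

theorem sum_single_eq_iff {m : ℕ →₀ ℕ} :
    ∑ j, Finsupp.single (s j) 1 = m ↔ ∀ v, (Finset.univ.filter fun j => s j = v).card = m v := by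
  rw [Finsupp.ext_iff]
  refine forall_congr' fun v => ?_
  rw [Finsupp.finsetSum_apply, Finset.card_filter]
  simp only [Finsupp.single_apply]

theorem card_filter_lt (hm : ∀ v, (Finset.univ.filter fun j => s j = v).card = m v) (v : ℕ) :
    (Finset.univ.filter fun j => s j < v).card = partialSum m v := by
  rw [partialSum, Finset.card_eq_sum_card_fiberwise (f := s) (t := Finset.range v) fun j hj =>
    Finset.mem_coe.2 (Finset.mem_range.2 (Finset.mem_filter.1 hj).2)]
  refine Finset.sum_congr rfl fun u hu => ?_
  rw [← hm u, Finset.filter_filter]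
  refine congrArg _ (Finset.filter_congr fun j _ => and_iff_right_of_imp ?_)
  rintro rfl
  exact Finset.mem_range.1 hu

theorem lt_iff_lt_card_filter_lt (hs : Monotone s) (j : Fin n) (v : ℕ) :
    s j < v ↔ (j : ℕ) < (Finset.univ.filter fun j => s j < v).card := by
  constructor
  · intro h
    rw [← Nat.succ_le_iff, Nat.succ_eq_add_one, ← Fin.card_Iic]
    refine Finset.card_le_card fun k hk => Finset.mem_filter.2 ⟨Finset.mem_univ k, ?_⟩
    exact (hs (Finset.mem_Iic.1 hk)).trans_lt h
  · contrapose!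
    intro h
    rw [← Fin.card_Iio]
    refine Finset.card_le_card fun k hk => Finset.mem_Iio.2 (not_le.1 fun hjk => ?_)
    exact (h.trans (hs hjk)).not_gt (Finset.mem_filter.1 hk).2

theorem card_filter_eq_of_lt_iff (hs : ∀ j v, s j < v ↔ (j : ℕ) < partialSum m v) {v : ℕ}
    (hv : partialSum m (v + 1) ≤ n) : (Finset.univ.filter fun j => s j = v).card = m v := by
  have himage : (Finset.univ.filter fun j => s j = v).map Fin.valEmbedding =
      Finset.Ico (partialSum m v) (partialSum m (v + 1)) := by
    ext x
    have hletter : ∀ j : Fin n, s j = v ↔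
        partialSum m v ≤ (j : ℕ) ∧ (j : ℕ) < partialSum m (v + 1) := by
      intro _
      rw [← hs, ← not_lt, ← hs]
      omega
    simp only [Finset.mem_map, Finset.mem_filter, Finset.mem_univ, true_and, hletter,
      Fin.valEmbedding_apply, Finset.mem_Ico]
    exact ⟨fun ⟨_, hj, hx⟩ => hx ▸ hj, fun hx => ⟨⟨x, by omega⟩, hx, rfl⟩⟩
  rw [← Finset.card_map Fin.valEmbedding, himage, Nat.card_Ico, partialSum_succ,
    Nat.add_sub_cancel_left]

theorem monotone_of_lt_iff (hs : ∀ j v, s j < v ↔ (j : ℕ) < partialSum m v) : Monotone s :=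
  fun j k hjk => Nat.lt_succ_iff.1 <| (hs j _).2 <|
    (Fin.le_def.1 hjk).trans_lt ((hs k _).1 (Nat.lt_succ_self _))

theorem exists_lt_iff {N : ℕ} (hn : partialSum m N = n) :
    ∃ s : Fin n → ℕ, ∀ j v, s j < v ↔ (j : ℕ) < partialSum m v := by
  have hex : ∀ j : Fin n, ∃ v, (j : ℕ) < partialSum m (v + 1) := fun j =>
    ⟨N, (hn.symm ▸ j.2 : (j : ℕ) < _).trans_le (partialSum_mono m N.le_succ)⟩
  refine ⟨fun j => Nat.find (hex j), fun j v => ?_⟩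
  rw [Nat.find_lt_iff]
  constructor
  · rintro ⟨u, hu, hj⟩
    exact hj.trans_le (partialSum_mono m hu)
  · intro hj
    obtain _ | v := v
    · exact absurd hj (Nat.not_lt_zero _)
    · exact ⟨v, v.lt_succ_self, hj⟩

theorem lt_succ_iff_exists_partialSum_eq (hs : ∀ j v, s j < v ↔ (j : ℕ) < partialSum m v) (j : ℕ)
    (hj : j + 1 < n) :
    s ⟨j, by omega⟩ < s ⟨j + 1, hj⟩ ↔ ∃ v, partialSum m v = j + 1 := by
  constructor
  · intro h
    have hlt := (hs _ _).1 h
    have hge := (hs ⟨j + 1, hj⟩ (s ⟨j + 1, hj⟩)).not.1 (lt_irrefl _)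
    exact ⟨_, le_antisymm (not_lt.1 hge) hlt⟩
  · rintro ⟨v, hv⟩
    have hlt : s ⟨j, by omega⟩ < v := (hs _ _).2 (by rw [hv]; exact j.lt_succ_self)
    have hge : ¬ s ⟨j + 1, hj⟩ < v := (hs _ _).not.2 (by rw [hv]; exact lt_irrefl _)
    exact hlt.trans_le (not_lt.1 hge)

open Classical in
theorem fundamentalQSym_apply_partialSum (D : Set ℕ) {m : ℕ →₀ ℕ} {N : ℕ}
    (hm : ∀ v, N ≤ v → m v = 0) :
    fundamentalQSym n D m = if partialSum m N = n ∧
      ∀ j, 1 ≤ j → j < n → j ∈ D → ∃ v, partialSum m v = j then 1 else 0 := by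
  have hlt : ∀ s : Fin n → ℕ, Monotone s → ∑ j, Finsupp.single (s j) 1 = m →
      ∀ j v, s j < v ↔ (j : ℕ) < partialSum m v := fun s hs hsm j v => by
    rw [lt_iff_lt_card_filter_lt hs, card_filter_lt (sum_single_eq_iff.1 hsm)]
  rw [fundamentalQSym]
  split_ifs with h
  · obtain ⟨hn, hD⟩ := h
    have hle : ∀ v, partialSum m v ≤ n := fun v => by
      rw [← hn, ← partialSum_of_le hm (le_max_right v N)]
      exact partialSum_mono m (le_max_left v N)
    obtain ⟨s, hs⟩ := exists_lt_iff hn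
    refine congrArg Nat.cast (Nat.card_eq_one_iff_unique.2 ⟨⟨fun t t' => ?_⟩, ⟨s, ?_, ?_, ?_⟩⟩)
    · refine Subtype.ext (funext fun j => eq_of_forall_gt_iff fun v => ?_)
      rw [hlt _ t.2.1 t.2.2.2, hlt _ t'.2.1 t'.2.2.2]
    · exact monotone_of_lt_iff hs
    · exact fun j hj hjD =>
        (lt_succ_iff_exists_partialSum_eq hs j hj).2 (hD _ j.succ_pos hj hjD)
    · exact sum_single_eq_iff.2 fun v => card_filter_eq_of_lt_iff hs (hle _)
  · rw [Nat.card_eq_zero.2, Nat.cast_zero]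
    refine Or.inl ⟨fun ⟨s, hs, hsD, hsm⟩ => h ⟨?_, fun j hj₁ hj hjD => ?_⟩⟩
    · have hcount := sum_single_eq_iff.1 hsm
      rw [← card_filter_lt hcount, Finset.filter_true_of_mem, Finset.card_fin]
      refine fun j _ => not_le.1 fun hj => ?_
      have hzero := (hcount (s j)).trans (hm _ hj)
      have hmem : j ∈ Finset.univ.filter fun k => s k = s j :=
        Finset.mem_filter.2 ⟨Finset.mem_univ j, rfl⟩
      exact Finset.card_ne_zero_of_mem hmem hzero
    · obtain ⟨j, rfl⟩ := Nat.exists_eq_succ_of_ne_zero (Nat.one_le_iff_ne_zero.1 hj₁)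
      exact (lt_succ_iff_exists_partialSum_eq (hlt s hs hsm) j hj).1 (hsD j hj hjD)

end WeaklyIncreasingWords

/-- The sums of the suffixes of a list. -/
def suffixSums : List ℕ → List ℕ
  | [] => [0]
  | a :: c => (a + c.sum) :: suffixSums c

theorem sum_multiplicities (m : ℕ → ℕ) (N : ℕ) : (multiplicities m N).sum = partialSum m N := by
  induction N with
  | zero => rfl
  | succ N ih => rw [multiplicities, List.sum_cons, ih, partialSum_succ, add_comm]

theorem mem_suffixSums_multiplicities {m : ℕ → ℕ} {N x : ℕ} :
    x ∈ suffixSums (multiplicities m N) ↔ ∃ v ≤ N, partialSum m v = x := by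
  induction N with
  | zero => simp [multiplicities, suffixSums, partialSum, eq_comm]
  | succ N ih =>
    simp only [multiplicities, suffixSums, List.mem_cons, ih, sum_multiplicities,
      Nat.le_add_one_iff, or_and_right, exists_or, exists_eq_left, partialSum_succ]
    rw [or_comm, add_comm, eq_comm]

open Classical in
theorem fundamentalQSym_apply (n : ℕ) (D : Set ℕ) {m : ℕ →₀ ℕ} {N : ℕ}
    (hm : ∀ v, N ≤ v → m v = 0) :
    fundamentalQSym n D m = if (multiplicities m N).sum = n ∧
      ∀ j, 1 ≤ j → j < n → j ∈ D → j ∈ suffixSums (multiplicities m N) then 1 else 0 := by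
  have hexists : ∀ j, (∃ v, partialSum m v = j) ↔ ∃ v ≤ N, partialSum m v = j := fun j => by
    refine ⟨fun ⟨v, hv⟩ => ?_, fun ⟨v, _, hv⟩ => ⟨v, hv⟩⟩
    rcases le_total v N with hle | hle
    · exact ⟨v, hle, hv⟩
    · exact ⟨N, le_rfl, (partialSum_of_le hm hle).symm.trans hv⟩
  simp only [fundamentalQSym_apply_partialSum D hm, sum_multiplicities,
    mem_suffixSums_multiplicities, hexists]

theorem sum_filter_pos (c : List ℕ) : (c.filter fun a => 0 < a).sum = c.sum := by
  induction c with
  | nil => rfl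
  | cons a c ih => obtain _ | a := a <;> simp [ih]

theorem sum_mem_suffixSums (c : List ℕ) : c.sum ∈ suffixSums c := by
  cases c <;> simp [suffixSums]

theorem mem_suffixSums_filter_pos {c : List ℕ} {x : ℕ} :
    x ∈ suffixSums (c.filter fun a => 0 < a) ↔ x ∈ suffixSums c := by
  induction c with
  | nil => rfl
  | cons a c ih =>
    obtain _ | a := a
    · have hsum : x = c.sum → x ∈ suffixSums c := fun h => h ▸ sum_mem_suffixSums c
      simpa [suffixSums, ih] using hsum
    · simp [suffixSums, ih, sum_filter_pos]

theorem strips_zero {l : List ℕ} (hl : l.SortedGE) : strips 0 l = [l] := by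
  induction l with
  | nil => rfl
  | cons x t ih => simp [strips, ih hl.pairwise.tail.sortedGE]

theorem kostka_filter_pos {c l : List ℕ} (hl : l.SortedGE) :
    kostka (c.filter fun a => 0 < a) l = kostka c l := by
  induction c generalizing l with
  | nil => rfl
  | cons a c ih =>
    obtain _ | a := a
    · simp [kostka, strips_zero hl, ih hl]
    · rw [List.filter_cons_of_pos (by simp), kostka, kostka]
      exact congrArg _ (List.map_congr_left fun ν hν => ih ((mem_strips hl).1 hν).1.sortedGE)

theorem kostka_eq_zero {c l : List ℕ} (hl : l.SortedGE) (h : c.sum ≠ l.sum) : kostka c l = 0 := by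
  induction c generalizing l with
  | nil => exact if_neg (Ne.symm h)
  | cons a c ih =>
    refine List.sum_eq_zero fun x hx => ?_
    obtain ⟨ν, hν, rfl⟩ := List.mem_map.1 hx
    obtain ⟨hstrip, hsum⟩ := (mem_strips hl).1 hν
    refine ih hstrip.sortedGE fun hc => h ?_
    rw [List.sum_cons, hc, ← hsum, add_comm]

theorem sum_map_smul_schurFunction_apply {L : List (ℤ × List ℕ)} (hL : ∀ p ∈ L, p.2.SortedGE)
    {m : ℕ →₀ ℕ} {N : ℕ} (hm : ∀ v, N ≤ v → m v = 0) :
    (L.map fun p => p.1 • schurFunction (diagram p.2)).sum m =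
      (L.map fun p => p.1 * (kostka (multiplicities m N) p.2 : ℤ)).sum := by
  refine (map_list_sum (MvPowerSeries.coeff (R := ℤ) m) _).trans ?_
  rw [List.map_map]
  refine congrArg List.sum (List.map_congr_left fun p hp => ?_)
  rw [← schurFunction_diagram_apply (hL p hp) hm]
  rfl

open Classical in
/-- Inserting zeros into the exponent of a monomial does not change its coefficient in a
(quasi)symmetric function, so it suffices to compare coefficients for positive exponents. -/
theorem sum_fundamentalQSym_eq {ι : Type*} (S : Finset ι) (D : ι → Set ℕ) (n : ℕ)
    (L : List (ℤ × List ℕ)) (hL : ∀ p ∈ L, p.2.SortedGE ∧ p.2.sum = n)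
    (h : ∀ c : List ℕ, (∀ a ∈ c, 0 < a) → c.sum = n →
      (∑ x ∈ S, if ∀ j, 1 ≤ j → j < n → j ∈ D x → j ∈ suffixSums c then (1 : ℤ) else 0) =
        (L.map fun p => p.1 * (kostka c p.2 : ℤ)).sum) :
    ∑ x ∈ S, fundamentalQSym n (D x) =
      (L.map fun p => p.1 • schurFunction (diagram p.2)).sum := by
  funext m
  obtain ⟨N, hN⟩ : ∃ N, ∀ v, N ≤ v → m v = 0 := by
    obtain ⟨N, hN⟩ := m.support.exists_nat_subset_range
    exact ⟨N, fun v hv => Finsupp.notMem_support_iff.1 fun hmem =>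
      (Finset.mem_range.1 (hN hmem)).not_ge hv⟩
  rw [sum_map_smul_schurFunction_apply (fun p hp => (hL p hp).1) hN]
  refine (map_sum (MvPowerSeries.coeff (R := ℤ) m) _ _).trans ?_
  refine (Finset.sum_congr rfl fun x _ => fundamentalQSym_apply n (D x) hN).trans ?_
  set c := multiplicities m N
  by_cases hn : c.sum = n
  · have hpos := h (c.filter fun a => 0 < a) (fun a ha => by simpa using (List.mem_filter.1 ha).2)
      ((sum_filter_pos c).trans hn)
    simp only [mem_suffixSums_filter_pos] at hpos
    simp only [hn, true_and, hpos]
    exact congrArg List.sum <| List.map_congr_left fun p hp => by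
      rw [kostka_filter_pos (hL p hp).1]
  · simp only [hn, false_and, if_false, Finset.sum_const_zero]
    refine (List.sum_eq_zero fun x hx => ?_).symm
    obtain ⟨p, hp, rfl⟩ := List.mem_map.1 hx
    rw [kostka_eq_zero (hL p hp).1 (by rwa [(hL p hp).2]), Nat.cast_zero, mul_zero]

/-! ### Linear independence of Schur functions -/

section HighestWeight

variable {μ ν : YoungDiagram}

theorem row_le_entry (T : SemistandardYoungTableau μ) {i j : ℕ} (h : (i, j) ∈ μ) : i ≤ T i j := by
  induction i with
  | zero => exact Nat.zero_le _
  | succ i ih =>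
    exact (ih (μ.up_left_mem i.le_succ le_rfl h)).trans_lt (T.col_strict i.lt_succ_self h)

theorem filter_entry_lt_subset (T : SemistandardYoungTableau μ) (k : ℕ) :
    (μ.cells.filter fun c => T c.1 c.2 < k) ⊆ μ.cells.filter fun c => c.1 < k :=
  fun c hc => by
    rw [Finset.mem_filter] at hc ⊢
    exact ⟨hc.1, (row_le_entry T hc.1).trans_lt hc.2⟩

theorem sum_range_content (T : SemistandardYoungTableau μ) (k : ℕ) :
    ∑ v ∈ Finset.range k, content T v = (μ.cells.filter fun c => T c.1 c.2 < k).card := by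
  simp only [content_apply]
  rw [Finset.card_eq_sum_card_fiberwise (s := μ.cells.filter _)
    (f := fun c => T c.1 c.2) (t := Finset.range k) fun c hc =>
    Finset.mem_coe.2 (Finset.mem_range.2 (Finset.mem_filter.1 hc).2)]
  refine Finset.sum_congr rfl fun v hv => ?_
  rw [Finset.filter_filter]
  refine congrArg _ (Finset.filter_congr fun c _ => (and_iff_right_of_imp ?_).symm)
  rintro rfl
  exact Finset.mem_range.1 hv

theorem content_highestWeight (μ : YoungDiagram) (v : ℕ) :
    content (SemistandardYoungTableau.highestWeight μ) v = μ.rowLen v := by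
  rw [content_apply, YoungDiagram.rowLen_eq_card, YoungDiagram.row]
  refine congrArg _ (Finset.filter_congr fun c hc => ?_)
  rw [SemistandardYoungTableau.highestWeight_apply, if_pos ((YoungDiagram.mem_cells c).1 hc)]

theorem sum_range_rowLen (μ : YoungDiagram) (k : ℕ) :
    ∑ v ∈ Finset.range k, μ.rowLen v = (μ.cells.filter fun c => c.1 < k).card := by
  simp only [← content_highestWeight, sum_range_content]
  refine congrArg _ (Finset.filter_congr fun c hc => ?_)
  rw [SemistandardYoungTableau.highestWeight_apply, if_pos ((YoungDiagram.mem_cells c).1 hc)]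

theorem sum_range_content_le_sum_range_rowLen (T : SemistandardYoungTableau μ) (k : ℕ) :
    ∑ v ∈ Finset.range k, content T v ≤ ∑ v ∈ Finset.range k, μ.rowLen v := by
  rw [sum_range_content, sum_range_rowLen]
  exact Finset.card_le_card (filter_entry_lt_subset T k)

theorem eq_highestWeight_of_content_eq (T : SemistandardYoungTableau μ)
    (h : ∀ v, content T v = μ.rowLen v) : T = SemistandardYoungTableau.highestWeight μ := by
  ext i j
  rw [SemistandardYoungTableau.highestWeight_apply]
  split_ifs with hc
  · have hcard := sum_range_content T (i + 1)
    simp only [h, sum_range_rowLen] at hcard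
    have hfilter := Finset.eq_of_subset_of_card_le (filter_entry_lt_subset T (i + 1)) hcard.le
    have hmem : (i, j) ∈ μ.cells.filter fun c => c.1 < i + 1 :=
      Finset.mem_filter.2 ⟨hc, i.lt_succ_self⟩
    rw [← hfilter, Finset.mem_filter] at hmem
    exact (Nat.lt_succ_iff.1 hmem.2).antisymm (row_le_entry T hc)
  · exact T.zeros hc

theorem schurFunction_content_highestWeight (μ : YoungDiagram) :
    schurFunction μ (content (SemistandardYoungTableau.highestWeight μ)) = 1 := by
  rw [schurFunction_apply, Nat.cast_eq_one, Nat.card_eq_one_iff_unique]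
  refine ⟨⟨fun T T' => Subtype.ext ?_⟩, ⟨⟨_, rfl⟩⟩⟩
  rw [eq_highestWeight_of_content_eq T.1 fun v => by rw [T.2, content_highestWeight],
    eq_highestWeight_of_content_eq T'.1 fun v => by rw [T'.2, content_highestWeight]]

theorem sum_range_rowLen_le_of_schurFunction_ne_zero
    (h : schurFunction μ (content (SemistandardYoungTableau.highestWeight ν)) ≠ 0) (k : ℕ) :
    ∑ v ∈ Finset.range k, ν.rowLen v ≤ ∑ v ∈ Finset.range k, μ.rowLen v := by
  rw [schurFunction_apply, Nat.cast_ne_zero] at h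
  obtain ⟨T, hT⟩ := (Nat.card_ne_zero.1 h).1
  simpa only [hT, content_highestWeight] using sum_range_content_le_sum_range_rowLen T k

theorem eq_of_sum_range_rowLen_eq
    (h : ∀ k, ∑ v ∈ Finset.range k, μ.rowLen v = ∑ v ∈ Finset.range k, ν.rowLen v) : μ = ν := by
  have hrow : ∀ i, μ.rowLen i = ν.rowLen i := fun i => by
    have hsucc := h (i + 1)
    rwa [Finset.sum_range_succ, Finset.sum_range_succ, h i, add_right_inj] at hsucc
  refine SetLike.ext fun ⟨i, j⟩ => ?_
  rw [YoungDiagram.mem_iff_lt_rowLen, YoungDiagram.mem_iff_lt_rowLen, hrow]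

end HighestWeight

/-- A Schur function `s_ν` has a nonzero coefficient at the highest weight of `μ` only if `ν`
dominates `μ`, so the dominance-maximal terms of a linear combination do not cancel. -/
theorem linearIndependent_schurFunction : LinearIndependent ℤ schurFunction := by
  refine linearIndependent_iff.2 fun c h => ?_
  by_contra hc
  obtain ⟨μ, hμ, hmax⟩ := c.support.exists_maximalFor
    (fun ν k => ∑ v ∈ Finset.range k, ν.rowLen v) (Finsupp.support_nonempty_iff.2 hc)
  have hcoeff : ∑ ν ∈ c.support,
      c ν * schurFunction ν (content (SemistandardYoungTableau.highestWeight μ)) = 0 :=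
    (map_sum (MvPowerSeries.coeff (R := ℤ) _) (fun ν => c ν • schurFunction ν) _).symm.trans <|
      congrArg _ h
  rw [Finset.sum_eq_single_of_mem μ hμ, schurFunction_content_highestWeight, mul_one] at hcoeff
  · exact Finsupp.mem_support_iff.1 hμ hcoeff
  · intro ν hν hne
    by_contra hterm
    have hdom := sum_range_rowLen_le_of_schurFunction_ne_zero (right_ne_zero_of_mul hterm)
    exact hne (eq_of_sum_range_rowLen_eq fun k => (hmax hν hdom k).antisymm (hdom k))

theorem HasSchurExpansion.unique {f : MvPowerSeries ℕ ℤ} {c c' : YoungDiagram →₀ ℤ}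
    (h : HasSchurExpansion f c) (h' : HasSchurExpansion f c') : c = c' :=
  linearIndependent_schurFunction (h.symm.trans h')

theorem hasSchurExpansion_list_sum (L : List (ℤ × List ℕ)) :
    HasSchurExpansion (L.map fun p => p.1 • schurFunction (diagram p.2)).sum
      (L.map fun p => Finsupp.single (diagram p.2) p.1).sum := by
  change _ = Finsupp.linearCombination ℤ schurFunction _
  rw [map_list_sum, List.map_map]
  exact congrArg List.sum <| List.map_congr_left fun p _ =>
    (Finsupp.linearCombination_single ℤ p.1 (diagram p.2)).symm

theorem schurPositive_list_sum {L : List (ℤ × List ℕ)} (hL : ∀ p ∈ L, 0 ≤ p.1) :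
    SchurPositive (L.map fun p => p.1 • schurFunction (diagram p.2)).sum := by
  refine ⟨_, hasSchurExpansion_list_sum L, ?_⟩
  have hnonneg : 0 ≤ (L.map fun p => Finsupp.single (diagram p.2) p.1).sum := by
    refine List.sum_nonneg fun c hc => ?_
    obtain ⟨p, hp, rfl⟩ := List.mem_map.1 hc
    exact Finsupp.single_nonneg.2 (hL p hp)
  exact hnonneg

theorem diagram_injOn : Set.InjOn diagram {l | l.SortedGE ∧ ∀ a ∈ l, 0 < a} := by
  rintro l ⟨hl, hpos⟩ l' ⟨hl', hpos'⟩ h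
  rw [diagram_of_sortedGE hl, diagram_of_sortedGE hl'] at h
  rw [← YoungDiagram.rowLens_ofRowLens_eq_self (hw := hl) hpos, h,
    YoungDiagram.rowLens_ofRowLens_eq_self hpos']

theorem hasSchurCoeff_list_sum {L : List (ℤ × List ℕ)}
    (hL : ∀ p ∈ L, p.2.SortedGE ∧ ∀ a ∈ p.2, 0 < a) {l : List ℕ}
    (hl : l.SortedGE ∧ ∀ a ∈ l, 0 < a) :
    HasSchurCoeff (L.map fun p => p.1 • schurFunction (diagram p.2)).sum (diagram l)
      ((L.filter fun p => p.2 = l).map Prod.fst).sum := by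
  refine ⟨⟨_, hasSchurExpansion_list_sum L⟩, fun c hc => ?_⟩
  rw [hc.unique (hasSchurExpansion_list_sum L)]
  clear hc c
  induction L with
  | nil => rfl
  | cons p L ih =>
    rw [List.map_cons, List.sum_cons, Finsupp.add_apply,
      ih fun q hq => hL q (List.mem_cons_of_mem _ hq)]
    by_cases h : p.2 = l
    · simp [h]
    · have hne : diagram l ≠ diagram p.2 := fun he =>
        h (diagram_injOn (hL p List.mem_cons_self) hl he.symm)
      simp [h, Finsupp.single_eq_of_ne hne]

theorem HasSchurCoeff.not_schurPositive {f : MvPowerSeries ℕ ℤ} {μ : YoungDiagram} {a : ℤ}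
    (h : HasSchurCoeff f μ a) (ha : a < 0) : ¬ SchurPositive f := by
  rintro ⟨c, hc, hpos⟩
  exact (h.2 c hc ▸ hpos μ).not_gt ha

/-! ### Certified Schur expansions -/

/-- Add `q` times the shape `l` to a formal combination of shapes. -/
def addTerm (q : ℤ) (l : List ℕ) : List (ℤ × List ℕ) → List (ℤ × List ℕ)
  | [] => [(q, l)]
  | p :: L => if p.2 = l then (p.1 + q, l) :: L else p :: addTerm q l L

/-- Remove horizontal strips of size `a` from the shapes of a formal combination in all possible
ways. -/
def peel (a : ℕ) : List (ℤ × List ℕ) → List (ℤ × List ℕ)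
  | [] => []
  | p :: L => (strips a p.2).foldr (addTerm p.1) (peel a L)

theorem sum_addTerm (g : List ℕ → ℤ) (q : ℤ) (l : List ℕ) (L : List (ℤ × List ℕ)) :
    ((addTerm q l L).map fun p => p.1 * g p.2).sum =
      q * g l + (L.map fun p => p.1 * g p.2).sum := by
  induction L with
  | nil => simp [addTerm]
  | cons p L ih =>
    rw [addTerm]
    split_ifs with h
    · rw [List.map_cons, List.sum_cons, List.map_cons, List.sum_cons, h]
      ring
    · rw [List.map_cons, List.sum_cons, ih, List.map_cons, List.sum_cons]
      ring

theorem sum_foldr_addTerm (g : List ℕ → ℤ) (q : ℤ) (M : List (List ℕ)) (L : List (ℤ × List ℕ)) :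
    ((M.foldr (addTerm q) L).map fun p => p.1 * g p.2).sum =
      q * (M.map g).sum + (L.map fun p => p.1 * g p.2).sum := by
  induction M with
  | nil => simp
  | cons l M ih =>
    rw [List.foldr_cons, sum_addTerm, ih, List.map_cons, List.sum_cons]
    ring

theorem sum_peel (a : ℕ) (c : List ℕ) (L : List (ℤ × List ℕ)) :
    ((peel a L).map fun p => p.1 * (kostka c p.2 : ℤ)).sum =
      (L.map fun p => p.1 * (kostka (a :: c) p.2 : ℤ)).sum := by
  induction L with
  | nil => rfl
  | cons p L ih =>
    rw [peel, sum_foldr_addTerm (fun l => (kostka c l : ℤ)), ih, List.map_cons, List.sum_cons,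
      kostka, Nat.cast_list_sum, List.map_map]
    rfl

/-- The sum of the digits `d < m` of `K` in base `X` for which all bits of `2 * d` are bits of
`T`. -/
def submaskSum (X K T : ℕ) : ℕ → ℕ
  | 0 => 0
  | d + 1 => submaskSum X K T d + if 2 * d &&& T = 2 * d then K / X ^ d % X else 0

/-- Verify, for every composition `c` of `r` into at most `fuel` parts, that the formal combination
`L` of shapes has `c`-coefficient the number of descent sets contained in `T ∪ suffixSums c`.
The digit `d < m` of `K` in base `X` is the multiplicity of the descent set whose elements are the
bits of `2 * d`, and `T` is given by its bits. -/
def expansionCheck (X K m : ℕ) : ℕ → ℕ → ℕ → List (ℤ × List ℕ) → Bool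
  | _, 0, T, L => (submaskSum X K T m : ℤ) == (L.map fun p => p.1 * (kostka [] p.2 : ℤ)).sum
  | 0, _ + 1, _, _ => false
  | fuel + 1, r + 1, T, L => (List.range (r + 1)).all fun s =>
      expansionCheck X K m fuel s (T ||| 2 ^ s) (peel (r + 1 - s) L)

section Digits

variable {ι : Type*} (S : Finset ι) (f : ι → ℕ) {X : ℕ}

theorem sum_pow_lt_pow (hS : S.card < X) {d : ℕ} (hf : ∀ x ∈ S, f x < d) :
    ∑ x ∈ S, X ^ f x < X ^ d := by
  have hX : 0 < X := Nat.zero_lt_of_lt hS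
  obtain _ | d := d
  · rw [Finset.sum_eq_zero fun x hx => absurd (hf x hx) (Nat.not_lt_zero _)]
    exact pow_pos hX 0
  · calc ∑ x ∈ S, X ^ f x
        ≤ ∑ _ ∈ S, X ^ d := Finset.sum_le_sum fun x hx =>
          Nat.pow_le_pow_right hX (Nat.lt_succ_iff.1 (hf x hx))
      _ = S.card * X ^ d := by rw [Finset.sum_const, smul_eq_mul]
      _ < X * X ^ d := Nat.mul_lt_mul_of_pos_right hS (pow_pos hX d)
      _ = X ^ (d + 1) := (pow_succ' _ _).symm

theorem sum_pow_div_mod (hS : S.card < X) (d : ℕ) :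
    (∑ x ∈ S, X ^ f x) / X ^ d % X = (S.filter fun x => f x = d).card := by
  have hcard (p : ι → Prop) [DecidablePred p] : (S.filter p).card < X :=
    (Finset.card_filter_le _ _).trans_lt hS
  have hlow : ∑ x ∈ S.filter fun x => f x < d, X ^ f x < X ^ d :=
    sum_pow_lt_pow _ f (hcard _) fun x hx => (Finset.mem_filter.1 hx).2
  have hdigit : ∑ x ∈ S.filter fun x => f x = d, X ^ f x =
      (S.filter fun x => f x = d).card * X ^ d := by
    rw [Finset.sum_congr rfl fun x hx => by rw [(Finset.mem_filter.1 hx).2], Finset.sum_const,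
      smul_eq_mul]
  obtain ⟨B, hhigh⟩ : X ^ (d + 1) ∣ ∑ x ∈ S.filter fun x => d < f x, X ^ f x :=
    Finset.dvd_sum fun x hx => pow_dvd_pow _ (Finset.mem_filter.1 hx).2
  have hsplit : ∑ x ∈ S, X ^ f x = (∑ x ∈ S.filter fun x => f x < d, X ^ f x) +
      X ^ d * ((S.filter fun x => f x = d).card + X * B) := by
    rw [mul_add, mul_comm _ (Finset.card _), ← hdigit, ← mul_assoc, ← pow_succ, ← hhigh]
    simp only [Finset.sum_filter, ← Finset.sum_add_distrib]
    refine Finset.sum_congr rfl fun x _ => ?_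
    rcases lt_trichotomy (f x) d with h | h | h
    · simp [h, h.ne, h.not_gt]
    · simp [h]
    · simp [h, h.ne', h.not_gt]
  rw [hsplit, Nat.add_mul_div_left _ _ (pow_pos (Nat.zero_lt_of_lt hS) d), Nat.div_eq_of_lt hlow,
    zero_add, Nat.add_mul_mod_self_left, Nat.mod_eq_of_lt (hcard _)]

theorem land_eq_left_iff (a b : ℕ) : a &&& b = a ↔ ∀ j, a.testBit j → b.testBit j := by
  refine ⟨fun h j hj => ?_, fun h => Nat.eq_of_testBit_eq fun j => ?_⟩
  · rw [← h, Nat.testBit_and, Bool.and_eq_true] at hj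
    exact hj.2
  · rw [Nat.testBit_and, Bool.and_eq_left_iff_imp]
    exact h j

open Classical in
theorem submaskSum_eq_card (hS : S.card < X) (T m : ℕ) :
    submaskSum X (∑ x ∈ S, X ^ f x) T m =
      (S.filter fun x => f x < m ∧ ∀ j, (2 * f x).testBit j → T.testBit j).card := by
  simp only [← land_eq_left_iff]
  induction m with
  | zero => simp [submaskSum]
  | succ d ih =>
    rw [submaskSum, ih, sum_pow_div_mod S f hS]
    simp only [Finset.card_filter]
    have hstep : ∀ x, (if f x < d + 1 ∧ 2 * f x &&& T = 2 * f x then 1 else 0) =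
        (if f x < d ∧ 2 * f x &&& T = 2 * f x then 1 else 0) +
          if f x = d then (if 2 * d &&& T = 2 * d then 1 else 0) else 0 := fun x => by
      rcases lt_trichotomy (f x) d with h | h | h
      · simp [h, h.ne, h.trans d.lt_succ_self]
      · simp [h]
      · simp [h.ne', h.not_gt, (Nat.succ_le_of_lt h).not_gt]
    simp only [hstep, Finset.sum_add_distrib]
    split_ifs <;> simp

end Digits

open Classical in
theorem card_filter_eq_of_expansionCheck_nil {ι : Type*} {S : Finset ι} {f : ι → ℕ} {X m : ℕ}
    (hS : S.card < X) (hf : ∀ x ∈ S, f x < m) {fuel T : ℕ} {L : List (ℤ × List ℕ)}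
    (h : expansionCheck X (∑ x ∈ S, X ^ f x) m fuel 0 T L = true) :
    ((S.filter fun x => ∀ j, (2 * f x).testBit j → T.testBit j ∨ j ∈ suffixSums []).card : ℤ) =
      (L.map fun p => p.1 * (kostka [] p.2 : ℤ)).sum := by
  rw [expansionCheck, beq_iff_eq, submaskSum_eq_card S f hS] at h
  rw [← h]
  refine congrArg (fun s : Finset ι => (s.card : ℤ)) (Finset.filter_congr fun x hx => ?_)
  rw [and_iff_right (hf x hx)]
  refine forall₂_congr fun j hj => or_iff_left ?_
  rintro h0
  rw [List.mem_singleton.1 h0] at hj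
  simp at hj

theorem testBit_lor_two_pow (T s j : ℕ) : (T ||| 2 ^ s).testBit j ↔ T.testBit j ∨ j = s := by
  rw [Nat.testBit_or, Nat.testBit_two_pow, Bool.or_eq_true, decide_eq_true_eq,
    eq_comm (a := s)]

open Classical in
theorem card_filter_eq_of_expansionCheck {ι : Type*} {S : Finset ι} {f : ι → ℕ} {X m : ℕ}
    (hS : S.card < X) (hf : ∀ x ∈ S, f x < m) {fuel r T : ℕ} {L : List (ℤ × List ℕ)}
    (hT : T.testBit r) (h : expansionCheck X (∑ x ∈ S, X ^ f x) m fuel r T L = true) (c : List ℕ)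
    (hc : ∀ a ∈ c, 0 < a) (hr : c.sum = r) :
    ((S.filter fun x => ∀ j, (2 * f x).testBit j → T.testBit j ∨ j ∈ suffixSums c).card : ℤ) =
      (L.map fun p => p.1 * (kostka c p.2 : ℤ)).sum := by
  induction c generalizing fuel r T L with
  | nil =>
    subst hr
    exact card_filter_eq_of_expansionCheck_nil hS hf h
  | cons a c ih =>
    obtain ⟨ha, hc⟩ := List.forall_mem_cons.1 hc
    rw [List.sum_cons] at hr
    obtain ⟨r, rfl⟩ := Nat.exists_eq_succ_of_ne_zero (n := r) (by omega)
    obtain _ | fuel := fuel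
    · simp [expansionCheck] at h
    rw [expansionCheck, List.all_eq_true] at h
    have hcheck := h c.sum (List.mem_range.2 (by omega))
    rw [show r + 1 - c.sum = a by omega] at hcheck
    rw [← sum_peel, ← ih ((testBit_lor_two_pow _ _ _).2 (.inr rfl)) hcheck hc rfl]
    refine congrArg (fun s : Finset ι => (s.card : ℤ)) <|
      Finset.filter_congr fun x _ => forall₂_congr fun j _ => ?_
    have hcut : ∀ j, j = r + 1 → T.testBit j := fun j hj => hj ▸ hT
    have hsum : ∀ j, j = c.sum → j ∈ suffixSums c := fun j hj => hj ▸ sum_mem_suffixSums c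
    rw [testBit_lor_two_pow, suffixSums, List.mem_cons, hr]
    specialize hcut j
    specialize hsum j
    tauto

open Classical in
theorem sum_fundamentalQSym_eq_of_check {ι : Type*} {S : Finset ι} {D : ι → Set ℕ} {f : ι → ℕ}
    {n m X : ℕ} {L : List (ℤ × List ℕ)} (hS : S.card < X) (hf : ∀ x ∈ S, f x < m)
    (hD : ∀ x ∈ S, ∀ j, (f x).testBit j ↔ j + 1 < n ∧ j + 1 ∈ D x)
    (hL : ∀ p ∈ L, p.2.SortedGE ∧ p.2.sum = n)
    (h : expansionCheck X (∑ x ∈ S, X ^ f x) m n n (2 ^ n) L = true) :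
    ∑ x ∈ S, fundamentalQSym n (D x) =
      (L.map fun p => p.1 • schurFunction (diagram p.2)).sum := by
  refine sum_fundamentalQSym_eq S D n L hL fun c hc hn => ?_
  rw [← card_filter_eq_of_expansionCheck hS hf (Nat.testBit_two_pow_self) h c hc hn,
    Finset.card_filter, Nat.cast_sum]
  refine Finset.sum_congr rfl fun x hx => ?_
  have hsub : (∀ j, 1 ≤ j → j < n → j ∈ D x → j ∈ suffixSums c) ↔
      ∀ j, (2 * f x).testBit j → (2 ^ n).testBit j ∨ j ∈ suffixSums c := by
    refine forall_congr' fun j => ?_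
    obtain _ | j := j
    · simp
    · rw [Nat.testBit_succ, Nat.mul_div_cancel_left _ two_pos, hD x hx, Nat.testBit_two_pow,
        decide_eq_true_eq]
      constructor
      · exact fun h hj => .inr (h j.succ_pos hj.1 hj.2)
      · exact fun h _ hj hjD => (h ⟨hj, hjD⟩).resolve_left hj.ne'
  simp only [hsub, Nat.cast_ite, Nat.cast_one, Nat.cast_zero]

/-! ### Moves on words -/

/-- There is a descent between the letters of indices `p` and `p + 1`. -/
def isDescent : List ℕ → ℕ → Bool
  | x :: y :: _, 0 => Nat.blt y x
  | _ :: t, p + 1 => isDescent t p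
  | _, _ => false

/-- The letters of indices `k`, `k + 1`, `k + 2` exist and do not form a monotone sequence: the word
admits a `(k + 2)`-neighbor, since colors count positions from `1`. -/
def admits : ℕ → List ℕ → Bool
  | 0, x :: y :: z :: _ => Nat.blt y x != Nat.blt z y
  | k + 1, _ :: t => admits k t
  | _, _ => false

/-- The word obtained from the letters `x`, `y`, `z` of indices `k`, `k + 1`, `k + 2` by a Knuth
move if `r` is false, and by a rotation if `r` is true. The condition `x < z ↔ y < x` says that `x`
is the median, that is, that the three letters are `bac` or `bca`. -/
def move (r : Bool) : ℕ → List ℕ → List ℕ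
  | 0, x :: y :: z :: t =>
      bif Nat.blt x z == Nat.blt y x then bif r then y :: z :: x :: t else x :: z :: y :: t
      else bif r then z :: x :: y :: t else y :: x :: z :: t
  | k + 1, x :: t => x :: move r k t
  | _, l => l

/-- The binary number whose bit of index `p` records whether `p + 1` is a descent. -/
def descentMask : List ℕ → ℕ
  | x :: y :: t => bif Nat.blt y x then 2 * descentMask (y :: t) + 1 else 2 * descentMask (y :: t)
  | _ => 0

theorem blt_eq_decide (a b : ℕ) : Nat.blt a b = decide (a < b) := by
  rw [Bool.eq_iff_iff, decide_eq_true_eq, Nat.blt_eq]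

section Moves

variable {k p : ℕ} {w : List ℕ} {r : Bool}

@[simp] theorem isDescent_cons_succ (x : ℕ) (t : List ℕ) (p : ℕ) :
    isDescent (x :: t) (p + 1) = isDescent t p := by
  cases t <;> rfl

@[simp] theorem isDescent_cons_cons_zero (x y : ℕ) (t : List ℕ) :
    isDescent (x :: y :: t) 0 = decide (y < x) := blt_eq_decide y x

@[simp] theorem isDescent_nil (p : ℕ) : isDescent [] p = false := by cases p <;> rfl

@[simp] theorem isDescent_singleton (x p : ℕ) : isDescent [x] p = false := by
  cases p <;> simp [isDescent]

@[simp] theorem admits_cons_succ (x : ℕ) (t : List ℕ) (k : ℕ) :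
    admits (k + 1) (x :: t) = admits k t := rfl

@[simp] theorem admits_zero_cons (x y z : ℕ) (t : List ℕ) :
    admits 0 (x :: y :: z :: t) = true ↔ ¬ (y < x ↔ z < y) := by
  simp [admits, blt_eq_decide]

@[simp] theorem admits_nil (k : ℕ) : admits k [] = false := by cases k <;> rfl

@[simp] theorem move_cons_succ (r : Bool) (x : ℕ) (t : List ℕ) (k : ℕ) :
    move r (k + 1) (x :: t) = x :: move r k t := rfl

theorem move_zero_cons (r : Bool) (x y z : ℕ) (t : List ℕ) :
    move r 0 (x :: y :: z :: t) =
      if (x < z ↔ y < x) then if r then y :: z :: x :: t else x :: z :: y :: t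
      else if r then z :: x :: y :: t else y :: x :: z :: t := by
  simp only [move, blt_eq_decide, Bool.cond_eq_ite, beq_iff_eq, decide_eq_decide]

@[elab_as_elim]
theorem admits_induction {P : ∀ k w, admits k w = true → Prop}
    (zero : ∀ x y z t (h : admits 0 (x :: y :: z :: t) = true), P 0 (x :: y :: z :: t) h)
    (succ : ∀ k x t (h : admits k t = true), P k t h → P (k + 1) (x :: t) h)
    (h : admits k w = true) : P k w h := by
  induction k generalizing w with
  | zero =>
    match w, h with
    | x :: y :: z :: t, h => exact zero x y z t h
  | succ k ih =>
    match w, h with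
    | x :: t, h => exact succ k x t h (ih h)

theorem exists_of_admits (h : admits k w = true) :
    ∃ v x y z t, v.length = k ∧ w = v ++ x :: y :: z :: t ∧ ¬ (y < x ↔ z < y) := by
  induction h using admits_induction with
  | zero x y z t h => exact ⟨[], x, y, z, t, rfl, rfl, (admits_zero_cons x y z t).1 h⟩
  | succ k u _ _ ih =>
    obtain ⟨v, x, y, z, t, hv, rfl, h⟩ := ih
    exact ⟨u :: v, x, y, z, t, congrArg _ hv, rfl, h⟩

theorem lt_length_of_admits (h : admits k w = true) : k + 2 < w.length := by
  obtain ⟨v, x, y, z, t, rfl, rfl, -⟩ := exists_of_admits h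
  simp only [List.length_append, List.length_cons]
  omega

theorem admits_iff (hk : k + 2 < w.length) :
    admits k w = true ↔ isDescent w k ≠ isDescent w (k + 1) := by
  induction k generalizing w with
  | zero =>
    match w, hk with
    | x :: y :: z :: t, _ => simp
  | succ k ih =>
    match w, hk with
    | x :: t, hk => simpa using ih (w := t) (Nat.lt_of_succ_lt_succ hk)

theorem move_perm (r : Bool) (k : ℕ) (w : List ℕ) : (move r k w).Perm w := by
  induction k generalizing w with
  | zero =>
    match w with
    | [] | [_] | [_, _] => rfl
    | x :: y :: z :: t =>
      rw [move_zero_cons]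
      split_ifs
      exacts [List.perm_middle (l₁ := [y, z]), (List.Perm.swap _ _ _).cons _,
        (List.perm_middle (l₁ := [x, y])).symm, List.Perm.swap _ _ _]
  | succ k ih =>
    match w with
    | [] => rfl
    | x :: t => exact (ih t).cons x

theorem admits_move (h : admits k w = true) (hw : w.Nodup) (r : Bool) :
    admits k (move r k w) = true := by
  induction h using admits_induction with
  | zero x y z t h =>
    simp only [List.nodup_cons, List.mem_cons, not_or] at hw
    rw [admits_zero_cons] at h
    rw [move_zero_cons]
    split_ifs <;> rw [admits_zero_cons] <;> omega
  | succ _ _ _ _ ih => exact ih hw.of_cons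

theorem move_move (h : admits k w = true) (hw : w.Nodup) (r : Bool) :
    move r k (move r k w) = w := by
  induction h using admits_induction with
  | zero x y z t h =>
    simp only [List.nodup_cons, List.mem_cons, not_or] at hw
    rw [admits_zero_cons] at h
    rw [move_zero_cons]
    split_ifs <;> rw [move_zero_cons] <;> split_ifs <;> first | rfl | omega
  | succ k x t _ ih => rw [move_cons_succ, move_cons_succ, ih hw.of_cons]

theorem isDescent_move (h : admits k w = true) (hw : w.Nodup) (r : Bool) :
    isDescent (move r k w) k = !isDescent w k ∧
      isDescent (move r k w) (k + 1) = !isDescent w (k + 1) := by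
  induction h using admits_induction with
  | zero x y z t h =>
    simp only [List.nodup_cons, List.mem_cons, not_or] at hw
    rw [admits_zero_cons] at h
    rw [move_zero_cons]
    split_ifs <;> simp <;> grind
  | succ k x t _ ih => simpa using ih hw.of_cons

theorem isDescent_move_of_lt (w : List ℕ) (h : p + 1 < k) :
    isDescent (move r k w) p = isDescent w p := by
  induction k generalizing w p with
  | zero => exact absurd h (Nat.not_lt_zero _)
  | succ k ih =>
    match w with
    | [] => rfl
    | x :: t =>
      obtain _ | p := p
      · obtain ⟨k, rfl⟩ := Nat.exists_eq_succ_of_ne_zero (n := k) (by omega)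
        cases t <;> simp [move]
      · simpa using ih t (Nat.lt_of_succ_lt_succ h)

theorem isDescent_move_of_gt (w : List ℕ) (h : k + 2 < p) :
    isDescent (move r k w) p = isDescent w p := by
  induction k generalizing w p with
  | zero =>
    match w with
    | [] | [_] | [_, _] => rfl
    | x :: y :: z :: t =>
      obtain ⟨p, rfl⟩ := Nat.exists_eq_add_of_le' h
      rw [move_zero_cons]
      split_ifs <;> simp
  | succ k ih =>
    match w with
    | [] => rfl
    | x :: t =>
      obtain ⟨p, rfl⟩ := Nat.exists_eq_add_of_le' (Nat.zero_lt_of_lt h)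
      simpa using ih t (by omega)

theorem isDescent_right_of_isDescent_move_ne (h : admits k w = true) (hw : w.Nodup)
    (hd : isDescent (move r k w) (k + 2) ≠ isDescent w (k + 2)) :
    isDescent w (k + 2) ≠ isDescent w (k + 1) := by
  induction h using admits_induction with
  | zero x y z t h =>
    simp only [List.nodup_cons, List.mem_cons, not_or] at hw
    rw [admits_zero_cons] at h
    rw [move_zero_cons] at hd
    match t with
    | [] => split_ifs at hd <;> simp at hd
    | u :: t =>
      simp only [List.mem_cons, not_or] at hw
      revert hd
      split_ifs <;> simp <;> omega
  | succ k x t _ ih => simpa using ih hw.of_cons (by simpa using hd)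

theorem isDescent_left_of_isDescent_move_ne (h : admits (k + 1) w = true) (hw : w.Nodup)
    (hd : isDescent (move r (k + 1) w) k ≠ isDescent w k) :
    isDescent w k ≠ isDescent w (k + 1) := by
  induction k generalizing w with
  | zero =>
    match w, h with
    | u :: x :: y :: z :: t, h =>
      simp only [List.nodup_cons, List.mem_cons, not_or] at hw
      rw [admits_cons_succ, admits_zero_cons] at h
      rw [move_cons_succ, move_zero_cons] at hd
      revert hd
      split_ifs <;> simp <;> omega
  | succ k ih =>
    match w, h with
    | x :: t, h => simpa using ih h hw.of_cons (by simpa using hd)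

/-- A Knuth move keeps the first or the last of the three letters in place. -/
theorem isDescent_knuthMove (h : admits (k + 1) w = true) :
    isDescent (move false (k + 1) w) k = isDescent w k ∨
      isDescent (move false (k + 1) w) (k + 3) = isDescent w (k + 3) := by
  induction k generalizing w with
  | zero =>
    match w, h with
    | u :: x :: y :: z :: t, _ =>
      rw [move_cons_succ, move_zero_cons, if_neg Bool.false_ne_true, if_neg Bool.false_ne_true]
      split_ifs
      · exact .inl (by simp)
      · exact .inr (by simp [isDescent])
  | succ k ih =>
    match w, h with
    | x :: t, h => simpa using ih h

theorem move_comm {j : ℕ} (h : j + 3 ≤ k) (r s : Bool) (w : List ℕ) :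
    move r j (move s k w) = move s k (move r j w) := by
  induction j generalizing k w with
  | zero =>
    obtain ⟨k, rfl⟩ := Nat.exists_eq_add_of_le' h
    match w with
    | [] | [_] | [_, _] => rfl
    | x :: y :: z :: t =>
      simp only [zero_add, move_cons_succ, move_zero_cons]
      split_ifs <;> rfl
  | succ j ih =>
    obtain ⟨k, rfl⟩ := Nat.exists_eq_add_of_le' (Nat.zero_lt_of_lt h)
    match w with
    | [] => rfl
    | x :: t => simp [ih (Nat.le_of_succ_le_succ h)]

theorem admits_move_of_le {j : ℕ} (h : j + 3 ≤ k) (r : Bool) (w : List ℕ) :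
    admits j (move r k w) = admits j w := by
  induction j generalizing k w with
  | zero =>
    obtain ⟨k, rfl⟩ := Nat.exists_eq_add_of_le' h
    match w with
    | [] | [_] | [_, _] | x :: y :: z :: t => rfl
  | succ j ih =>
    obtain ⟨k, rfl⟩ := Nat.exists_eq_add_of_le' (Nat.zero_lt_of_lt h)
    match w with
    | [] => rfl
    | x :: t => simp [ih (Nat.le_of_succ_le_succ h)]

theorem admits_move_of_ge {j : ℕ} (h : k + 3 ≤ j) (r : Bool) (w : List ℕ) :
    admits j (move r k w) = admits j w := by
  induction k generalizing j w with
  | zero =>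
    obtain ⟨j, rfl⟩ := Nat.exists_eq_add_of_le' h
    match w with
    | [] | [_] | [_, _] => rfl
    | x :: y :: z :: t =>
      rw [move_zero_cons]
      split_ifs <;> rfl
  | succ k ih =>
    obtain ⟨j, rfl⟩ := Nat.exists_eq_add_of_le' (Nat.zero_lt_of_lt h)
    match w with
    | [] => rfl
    | x :: t => simpa using ih (Nat.le_of_succ_le_succ h) t

theorem mem_descentSet : p + 1 ∈ descentSet w ↔ isDescent w p = true := by
  have hgetD : p + 1 ∈ descentSet w ↔ p + 1 < w.length ∧ w.getD (p + 1) 0 < w.getD p 0 := by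
    simp [descentSet]
  rw [hgetD]
  induction p generalizing w with
  | zero =>
    match w with
    | [] | [_] => simp
    | x :: y :: t => simp
  | succ p ih =>
    match w with
    | [] => simp
    | x :: t => simpa using ih (w := t) (by simp [descentSet])

theorem isDescent_eq_false_of_length_le (h : w.length ≤ p + 1) : isDescent w p = false :=
  Bool.eq_false_iff.2 fun hd => h.not_gt (mem_descentSet.2 hd).2.1

theorem testBit_descentMask (w : List ℕ) (p : ℕ) : (descentMask w).testBit p = isDescent w p := by
  induction p generalizing w with
  | zero =>
    match w with
    | [] | [_] => simp [descentMask]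
    | x :: y :: t =>
      rw [descentMask, blt_eq_decide, isDescent_cons_cons_zero]
      by_cases h : y < x <;> simp [h, Nat.testBit_zero]
  | succ p ih =>
    match w with
    | [] | [_] => simp [descentMask]
    | x :: y :: t =>
      rw [descentMask, isDescent_cons_succ, ← ih, Nat.testBit_succ]
      cases Nat.blt y x
      · rw [cond_false, Nat.mul_div_cancel_left _ two_pos]
      · rw [cond_true, Nat.mul_add_div two_pos]
        rfl

theorem descentMask_lt (w : List ℕ) {n : ℕ} (h : w.length ≤ n + 1) : descentMask w < 2 ^ n := by
  refine Nat.lt_pow_two_of_testBit _ fun i hi => ?_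
  rw [testBit_descentMask]
  exact isDescent_eq_false_of_length_le (h.trans (Nat.succ_le_succ hi))

end Moves

/-! ### D₀ graphs from systems of moves -/

theorem admits_length_append (v u : List ℕ) : admits v.length (v ++ u) = admits 0 u := by
  induction v with
  | nil => rfl
  | cons _ _ ih => exact ih

theorem move_length_append (r : Bool) (v u : List ℕ) :
    move r v.length (v ++ u) = v ++ move r 0 u := by
  induction v with
  | nil => rfl
  | cons x v ih => simp [ih]

section Pairs

variable {k : ℕ} {w : List ℕ}

theorem admits_of_mem_krSquare {v t : List ℕ} {a b c : ℕ} (hab : a < b) (hbc : b < c)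
    (h : w ∈ krSquare v t a b c) : admits v.length w = true := by
  simp only [krSquare, Set.mem_insert_iff, Set.mem_singleton_iff] at h
  rcases h with rfl | rfl | rfl | rfl <;>
    rw [List.append_assoc, admits_length_append] <;> simp <;> omega

theorem exists_mem_krSquare_of_admits (h : admits k w = true) (hw : w.Nodup) :
    ∃ v t a b c, a < b ∧ b < c ∧ v.length = k ∧ w ∈ krSquare v t a b c := by
  obtain ⟨v, x, y, z, t, hv, rfl, h⟩ := exists_of_admits h
  obtain ⟨hxy, hxz, hyz⟩ : x ≠ y ∧ x ≠ z ∧ y ≠ z := by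
    have := hw.of_append_right
    simp only [List.nodup_cons, List.mem_cons, not_or] at this
    exact ⟨this.1.1, this.1.2.1, this.2.1.1⟩
  rcases lt_or_gt_of_ne hxy with hxy | hxy <;> rcases lt_or_gt_of_ne hxz with hxz | hxz
  · exact ⟨v, t, x, z, y, by omega, by omega, hv, by simp [krSquare]⟩
  · exact ⟨v, t, z, x, y, by omega, by omega, hv, by simp [krSquare]⟩
  · exact ⟨v, t, y, x, z, by omega, by omega, hv, by simp [krSquare]⟩
  · exact ⟨v, t, y, z, x, by omega, by omega, hv, by simp [krSquare]⟩

theorem knuthPair_move (h : admits k w = true) (hw : w.Nodup) :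
    KnuthPair (k + 2) w (move false k w) := by
  obtain ⟨v, t, a, b, c, hab, hbc, rfl, hw⟩ := exists_mem_krSquare_of_admits h hw
  refine ⟨v, t, a, b, c, hab, hbc, rfl, ?_⟩
  simp only [krSquare, Set.mem_insert_iff, Set.mem_singleton_iff] at hw
  have hac := hab.trans hbc
  rcases hw with rfl | rfl | rfl | rfl
  · simp [move_length_append, move_zero_cons, hab, hbc]
  · simp [move_length_append, move_zero_cons, hab.not_gt, hbc.not_gt, Set.pair_comm]
  · simp [move_length_append, move_zero_cons, hab, hac.not_gt]
  · simp [move_length_append, move_zero_cons, hac, hbc.not_gt, Set.pair_comm]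

theorem rotationPair_move (h : admits k w = true) (hw : w.Nodup) :
    RotationPair (k + 2) w (move true k w) := by
  obtain ⟨v, t, a, b, c, hab, hbc, rfl, hw⟩ := exists_mem_krSquare_of_admits h hw
  refine ⟨v, t, a, b, c, hab, hbc, rfl, ?_⟩
  simp only [krSquare, Set.mem_insert_iff, Set.mem_singleton_iff] at hw
  have hac := hab.trans hbc
  rcases hw with rfl | rfl | rfl | rfl
  · simp [move_length_append, move_zero_cons, hab, hbc]
  · simp [move_length_append, move_zero_cons, hab.not_gt, hbc.not_gt]
  · simp [move_length_append, move_zero_cons, hab, hac.not_gt, Set.pair_comm]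
  · simp [move_length_append, move_zero_cons, hac, hbc.not_gt, Set.pair_comm]

end Pairs

/-- A finite set `S` of permutations of `n`, together with the choice `kind w k` of the kind of move
(Knuth move or rotation, see `move`) applied to `w` in the window at `k`, such that the moves act on
`S` as involutions and the kind of a move is unchanged by moves of disjoint windows. -/
structure IsMoveSystem (n : ℕ) (S : Finset (List ℕ)) (kind : List ℕ → ℕ → Bool) : Prop where
  isWord : ∀ w ∈ S, IsWord n n w
  mem : ∀ w ∈ S, ∀ k, admits k w = true → move (kind w k) k w ∈ S
  kind_move_self : ∀ w ∈ S, ∀ k, admits k w = true → kind (move (kind w k) k w) k = kind w k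
  kind_move_far : ∀ w ∈ S, ∀ j k, admits j w = true → admits k w = true →
    (j + 3 ≤ k ∨ k + 3 ≤ j) → kind (move (kind w j) j w) k = kind w k

namespace IsMoveSystem

variable {n : ℕ} {S : Finset (List ℕ)} {kind : List ℕ → ℕ → Bool}

/-- The D₀ graph of a system of moves: the `i`-edges are the moves of the letters of indices
`i - 2`, `i - 1`, `i`, indices being counted from `0`. -/
def graph (h : IsMoveSystem n S kind) : D0Graph n n where
  verts := S
  isWord := h.isWord
  edge i :=
    { Adj x y := 2 ≤ i ∧ admits (i - 2) x.1 = true ∧ y.1 = move (kind x.1 (i - 2)) (i - 2) x.1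
      symm := ⟨fun x y ⟨hi, hx, hy⟩ => by
        have hnd := (h.isWord x.1 x.2).2.1
        refine ⟨hi, hy ▸ admits_move hx hnd _, ?_⟩
        rw [hy, h.kind_move_self _ x.2 _ hx, move_move hx hnd]⟩
      loopless := ⟨fun x ⟨_, hx, hxx⟩ => by
        have hd := (isDescent_move hx (h.isWord x.1 x.2).2.1 (kind x.1 (i - 2))).1
        rw [← hxx] at hd
        exact Bool.self_ne_not _ hd⟩ }
  color_mem i x _ := fun ⟨_, hx, _⟩ => by
    have := lt_length_of_admits hx
    rw [(h.isWord x.1 x.2).1] at this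
    omega
  edge_type i x y := fun ⟨hi, hx, hy⟩ => by
    have hnd := (h.isWord x.1 x.2).2.1
    obtain ⟨k, rfl⟩ := Nat.exists_eq_add_of_le' hi
    rw [Nat.add_sub_cancel] at hx hy
    cases hr : kind x.1 k <;> rw [hy, hr]
    · exact .inl (knuthPair_move hx hnd)
    · exact .inr (rotationPair_move hx hnd)
  existsUnique_edge v _ _ _ _ hab hbc x hx := by
    have hx : admits (v.length + 2 - 2) x.1 = true := admits_of_mem_krSquare hab hbc hx
    exact ⟨⟨_, h.mem x.1 x.2 _ hx⟩, ⟨by omega, hx, rfl⟩, fun y hy => Subtype.ext hy.2.2⟩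

variable (h : IsMoveSystem n S kind)

/-- The vertices of the graph of a system of moves. -/
abbrev Vertex := {w : List ℕ // w ∈ h.graph.verts}

/-- The signed, colored graph of a system of moves. -/
noncomputable abbrev signed : SignedColoredGraph n h.Vertex := h.graph.toSignedColoredGraph

variable {h} {k p q : ℕ} {x y : h.Vertex}

theorem nodup (x : h.Vertex) : x.1.Nodup := (h.isWord x.1 x.2).2.1

theorem length (x : h.Vertex) : x.1.length = n := (h.isWord x.1 x.2).1

theorem adj_add_two_iff :
    (h.signed.edge (k + 2)).Adj x y ↔ admits k x.1 = true ∧ y.1 = move (kind x.1 k) k x.1 :=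
  and_iff_right (Nat.le_add_left 2 k)

theorem exists_add_two_of_adj {i : ℕ} (hxy : (h.signed.edge i).Adj x y) : ∃ k, i = k + 2 :=
  Nat.exists_eq_add_of_le' hxy.1

theorem admits_add_two_iff : h.signed.Admits (k + 2) x ↔ admits k x.1 = true :=
  ⟨fun ⟨_, hy⟩ => (adj_add_two_iff.1 hy).1,
    fun hx => ⟨⟨_, h.mem x.1 x.2 k hx⟩, adj_add_two_iff.2 ⟨hx, rfl⟩⟩⟩

theorem σ_eq (x : h.Vertex) : h.signed.σ x (p + 1) = if isDescent x.1 p = true then -1 else 1 := by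
  classical exact if_congr mem_descentSet rfl rfl

theorem σ_eq_neg_one_iff : h.signed.σ x (p + 1) = -1 ↔ isDescent x.1 p = true := by
  rw [σ_eq]
  cases isDescent x.1 p <;> decide

theorem σ_eq_σ_iff :
    h.signed.σ x (p + 1) = h.signed.σ y (q + 1) ↔ isDescent x.1 p = isDescent y.1 q := by
  rw [σ_eq, σ_eq]
  cases isDescent x.1 p <;> cases isDescent y.1 q <;> decide

theorem σ_eq_neg_σ_iff :
    h.signed.σ x (p + 1) = -h.signed.σ y (q + 1) ↔ isDescent x.1 p ≠ isDescent y.1 q := by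
  rw [σ_eq, σ_eq]
  cases isDescent x.1 p <;> cases isDescent y.1 q <;> decide

theorem axiom0 : h.signed.Axiom0 := fun _ _ _ _ hw hw' => Subtype.ext (hw.2.2.trans hw'.2.2.symm)

theorem axiom1 : h.signed.Axiom1 := by
  refine ⟨axiom0, fun i w hi hn => ?_⟩
  obtain ⟨k, rfl⟩ := Nat.exists_eq_add_of_le' hi
  rw [admits_add_two_iff, show k + 2 - 1 = k + 1 by omega, σ_eq_neg_σ_iff,
    admits_iff (by rw [length]; omega)]

theorem axiom2 : h.signed.Axiom2 := by
  intro i w x hwx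
  obtain ⟨k, rfl⟩ := exists_add_two_of_adj hwx
  obtain ⟨hw, hx⟩ := adj_add_two_iff.1 hwx
  have hd := isDescent_move hw (nodup w) (kind w.1 k)
  rw [show k + 2 - 1 = k + 1 by omega, σ_eq_neg_σ_iff, σ_eq_neg_σ_iff, hx, hd.1, hd.2]
  refine ⟨by simp, by simp, fun j hj _ hk => ?_⟩
  obtain ⟨p, rfl⟩ := Nat.exists_eq_add_of_le' hj
  rw [σ_eq_σ_iff, hx]
  rcases hk with hk | hk
  · exact (isDescent_move_of_lt _ (by omega)).symm
  · exact (isDescent_move_of_gt _ (by omega)).symm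

theorem axiom3 : h.signed.Axiom3 := by
  intro i w x hwx
  obtain ⟨k, rfl⟩ := exists_add_two_of_adj hwx
  obtain ⟨hw, hx⟩ := adj_add_two_iff.1 hwx
  constructor
  · intro hk
    obtain ⟨k, rfl⟩ : ∃ k', k = k' + 1 := ⟨k - 1, by omega⟩
    rw [show k + 1 + 2 - 2 = k + 1 by omega, show k + 1 + 2 - 1 = k + 1 + 1 by omega,
      σ_eq_neg_σ_iff, σ_eq_neg_σ_iff, hx]
    exact fun hd => isDescent_left_of_isDescent_move_ne hw (nodup w) hd.symm
  · intro _
    rw [σ_eq_neg_σ_iff, σ_eq_neg_σ_iff, hx]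
    exact fun hd => isDescent_right_of_isDescent_move_ne hw (nodup w) hd.symm

theorem axiom5 : h.signed.Axiom5 := by
  intro i j w x y hij hwx hxy
  obtain ⟨k, rfl⟩ := exists_add_two_of_adj hwx
  obtain ⟨l, rfl⟩ := exists_add_two_of_adj hxy
  obtain ⟨hk, hx⟩ := adj_add_two_iff.1 hwx
  obtain ⟨hl, hy⟩ := adj_add_two_iff.1 hxy
  have hkl : k + 3 ≤ l ∨ l + 3 ≤ k := by omega
  replace hl : admits l w.1 = true := by
    rw [← hl, hx]
    rcases hkl with hkl | hkl
    · exact (admits_move_of_ge hkl _ _).symm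
    · exact (admits_move_of_le hkl _ _).symm
  refine ⟨⟨_, h.mem w.1 w.2 l hl⟩, adj_add_two_iff.2 ⟨hl, rfl⟩, adj_add_two_iff.2 ⟨?_, ?_⟩⟩
  · rcases hkl with hkl | hkl
    · exact (admits_move_of_le hkl _ _).trans hk
    · exact (admits_move_of_ge hkl _ _).trans hk
  · rw [hy, hx, h.kind_move_far w.1 w.2 k l hk hl hkl, h.kind_move_far w.1 w.2 l k hl hk hkl.symm]
    rcases hkl with hkl | hkl
    · exact (move_comm hkl _ _ _).symm
    · exact move_comm hkl _ _ _

end IsMoveSystem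

namespace SignedColoredGraph

variable {n : ℕ} {V : Type*} {G : SignedColoredGraph n V}

theorem FlatStep.weakFlatStep {i : ℕ} {y z : V} (h : G.FlatStep i y z) : G.WeakFlatStep i y z := by
  obtain ⟨u, hyu, hu, huz⟩ := h
  refine ⟨.trans ?_ (SimpleGraph.Adj.reachable (Or.inl huz)), u, huz.symm, hu⟩
  clear hu huz
  induction hyu with
  | refl => rfl
  | tail _ hpq ih =>
    obtain ⟨r, hpr, hrq⟩ := hpq
    exact (ih.trans (SimpleGraph.Adj.reachable (Or.inl hpr))).trans
      (SimpleGraph.Adj.reachable (Or.inr hrq))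

theorem Axiom4bStrong.axiom4b (h : G.Axiom4bStrong) : G.Axiom4b :=
  fun i m x hi hn ⟨hinj, hadm, hadj, hstep⟩ => h i m x hi hn
    ⟨hinj, hadm, hadj, fun j hj hm => (hstep j hj hm).weakFlatStep⟩

end SignedColoredGraph

/-! ### Windows and patterns -/

/-- The subword of the letters of indices `k, …, k + d - 1`. -/
def window (k d : ℕ) (w : List ℕ) : List ℕ := (w.drop k).take d

/-- The number of letters of `u` that are at most `x`. -/
def letterRank (u : List ℕ) (x : ℕ) : ℕ := u.countP fun y => Nat.ble y x

/-- The pattern of a word: its `j`-th smallest letter is replaced by `j`. -/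
def standardize (u : List ℕ) : List ℕ := u.map (letterRank u)

section Window

variable {t p d : ℕ}

theorem move_drop (r : Bool) (k t : ℕ) (w : List ℕ) :
    (move r (k + t) w).drop k = move r t (w.drop k) := by
  induction k generalizing w with
  | zero => simp
  | succ k ih =>
    match w with
    | [] => cases t <;> simp [move]
    | x :: w => rw [Nat.succ_add, move_cons_succ, List.drop_succ_cons, List.drop_succ_cons, ih]

theorem move_take (r : Bool) (h : t + 3 ≤ d) (w : List ℕ) :
    (move r t w).take d = move r t (w.take d) := by
  induction t generalizing w d with
  | zero =>
    obtain ⟨d, rfl⟩ := Nat.exists_eq_add_of_le' h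
    match w with
    | [] | [_] | [_, _] => simp [move]
    | x :: y :: z :: w =>
      simp only [List.take_succ_cons, move_zero_cons]
      split_ifs <;> simp
  | succ t ih =>
    obtain ⟨d, rfl⟩ := Nat.exists_eq_add_one_of_ne_zero (n := d) (by omega)
    match w with
    | [] => simp [move]
    | x :: w => simp [ih (by omega : t + 3 ≤ d)]

theorem window_move (r : Bool) (k : ℕ) (h : t + 3 ≤ d) (w : List ℕ) :
    window k d (move r (k + t) w) = move r t (window k d w) := by
  rw [window, move_drop, move_take r h, window]

theorem admits_drop (k t : ℕ) (w : List ℕ) : admits t (w.drop k) = admits (k + t) w := by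
  induction k generalizing w with
  | zero => simp
  | succ k ih =>
    match w with
    | [] => simp
    | x :: w => rw [List.drop_succ_cons, ih, Nat.succ_add, admits_cons_succ]

theorem admits_take (h : t + 3 ≤ d) (w : List ℕ) : admits t (w.take d) = admits t w := by
  induction t generalizing w d with
  | zero =>
    obtain ⟨d, rfl⟩ := Nat.exists_eq_add_of_le' h
    match w with
    | [] | [_] | [_, _] | x :: y :: z :: w => rfl
  | succ t ih =>
    obtain ⟨d, rfl⟩ := Nat.exists_eq_add_one_of_ne_zero (n := d) (by omega)
    match w with
    | [] => simp
    | x :: w => simp [ih (by omega : t + 3 ≤ d)]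

theorem admits_window (k : ℕ) (h : t + 3 ≤ d) (w : List ℕ) :
    admits t (window k d w) = admits (k + t) w := by
  rw [window, admits_take h, admits_drop]

theorem isDescent_drop (k p : ℕ) (w : List ℕ) : isDescent (w.drop k) p = isDescent w (k + p) := by
  induction k generalizing w with
  | zero => simp
  | succ k ih =>
    match w with
    | [] => simp
    | x :: w => rw [List.drop_succ_cons, ih, Nat.succ_add, isDescent_cons_succ]

theorem isDescent_take (h : p + 1 < d) (w : List ℕ) : isDescent (w.take d) p = isDescent w p := by
  induction p generalizing w d with
  | zero =>
    obtain ⟨d, rfl⟩ := Nat.exists_eq_add_of_le' h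
    match w with
    | [] | [_] | x :: y :: w => rfl
  | succ p ih =>
    obtain ⟨d, rfl⟩ := Nat.exists_eq_add_one_of_ne_zero (n := d) (by omega)
    match w with
    | [] => simp
    | x :: w => simp [ih (by omega : p + 1 < d)]

theorem isDescent_window (k : ℕ) (h : p + 1 < d) (w : List ℕ) :
    isDescent (window k d w) p = isDescent w (k + p) := by
  rw [window, isDescent_take h, isDescent_drop]

theorem length_window {k : ℕ} {w : List ℕ} (h : k + d ≤ w.length) :
    (window k d w).length = d := by
  rw [window, List.length_take, List.length_drop]
  omega

theorem nodup_window {k : ℕ} {w : List ℕ} (h : w.Nodup) : (window k d w).Nodup :=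
  h.sublist ((List.take_sublist _ _).trans (List.drop_sublist _ _))

end Window

section StrictMonoOn

variable {f : ℕ → ℕ} {u : List ℕ}

theorem move_map (hf : ∀ x ∈ u, ∀ y ∈ u, f x < f y ↔ x < y) (r : Bool) (k : ℕ) :
    move r k (u.map f) = (move r k u).map f := by
  induction k generalizing u with
  | zero =>
    match u with
    | [] | [_] | [_, _] => rfl
    | x :: y :: z :: t =>
      simp only [List.map_cons, move_zero_cons, hf x (by simp) z (by simp),
        hf y (by simp) x (by simp)]
      split_ifs <;> rfl
  | succ k ih =>
    match u with
    | [] => rfl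
    | x :: t =>
      simp only [List.map_cons, move_cons_succ]
      rw [ih fun a ha b hb => hf a (List.mem_cons_of_mem _ ha) b (List.mem_cons_of_mem _ hb)]

theorem isDescent_map (hf : ∀ x ∈ u, ∀ y ∈ u, f x < f y ↔ x < y) (p : ℕ) :
    isDescent (u.map f) p = isDescent u p := by
  induction p generalizing u with
  | zero =>
    match u with
    | [] | [_] => rfl
    | x :: y :: t => simp [hf y (by simp) x (by simp)]
  | succ p ih =>
    match u with
    | [] => rfl
    | x :: t =>
      simp only [List.map_cons, isDescent_cons_succ]
      exact ih fun a ha b hb => hf a (List.mem_cons_of_mem _ ha) b (List.mem_cons_of_mem _ hb)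

theorem admits_map (hf : ∀ x ∈ u, ∀ y ∈ u, f x < f y ↔ x < y) (k : ℕ) :
    admits k (u.map f) = admits k u := by
  induction k generalizing u with
  | zero =>
    match u with
    | [] | [_] | [_, _] => rfl
    | x :: y :: z :: t =>
      rw [Bool.eq_iff_iff, List.map_cons, List.map_cons, List.map_cons, admits_zero_cons,
        admits_zero_cons, hf y (by simp) x (by simp), hf z (by simp) y (by simp)]
  | succ k ih =>
    match u with
    | [] => rfl
    | x :: t =>
      exact ih fun a ha b hb => hf a (List.mem_cons_of_mem _ ha) b (List.mem_cons_of_mem _ hb)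

end StrictMonoOn

section Standardize

variable {u v : List ℕ}

theorem letterRank_mono (u : List ℕ) : Monotone (letterRank u) := fun x y hxy =>
  List.countP_mono_left fun z _ hz => by
    rw [Nat.ble_eq] at hz ⊢
    exact hz.trans hxy

theorem letterRank_lt_letterRank_iff {x y : ℕ} (hy : y ∈ u) :
    letterRank u x < letterRank u y ↔ x < y := by
  refine ⟨(letterRank_mono u).reflect_lt, fun h => ?_⟩
  obtain ⟨s, t, rfl⟩ := List.append_of_mem hy
  have hs := letterRank_mono s h.le
  have ht := letterRank_mono t h.le
  simp only [letterRank, List.countP_append, List.countP_cons, Nat.ble_eq, le_refl, h.not_ge,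
    if_true, if_false] at hs ht ⊢
  omega

theorem letterRank_injOn (u : List ℕ) : Set.InjOn (letterRank u) {a | a ∈ u} := fun _ ha _ hb hab =>
  le_antisymm (not_lt.1 ((letterRank_lt_letterRank_iff ha).not.1 hab.not_gt))
    (not_lt.1 ((letterRank_lt_letterRank_iff hb).not.1 hab.not_lt))

theorem standardize_eq_map_of_perm (h : v.Perm u) : standardize v = v.map (letterRank u) :=
  List.map_congr_left fun _ _ => h.countP_eq _

theorem standardize_move (r : Bool) (k : ℕ) (u : List ℕ) :
    standardize (move r k u) = move r k (standardize u) := by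
  rw [standardize_eq_map_of_perm (move_perm r k u), standardize,
    move_map fun _ _ _ hy => letterRank_lt_letterRank_iff hy]

theorem isDescent_standardize (u : List ℕ) (p : ℕ) : isDescent (standardize u) p = isDescent u p :=
  isDescent_map (fun _ _ _ hy => letterRank_lt_letterRank_iff hy) p

theorem admits_standardize (k : ℕ) (u : List ℕ) : admits k (standardize u) = admits k u :=
  admits_map (fun _ _ _ hy => letterRank_lt_letterRank_iff hy) k

theorem length_standardize (u : List ℕ) : (standardize u).length = u.length := List.length_map _

theorem eq_of_perm_of_standardize_eq (h : v.Perm u) (he : standardize v = standardize u) :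
    v = u := by
  rw [standardize_eq_map_of_perm h, standardize] at he
  refine List.ext_getElem h.length_eq fun i hv hu => ?_
  have hi : letterRank u v[i] = letterRank u u[i] := by
    simpa [hv, hu] using congrArg (·[i]?) he
  exact letterRank_injOn u (h.subset (List.getElem_mem hv)) (List.getElem_mem hu) hi

theorem standardize_perm_range' (hu : u.Nodup) : (standardize u).Perm (List.range' 1 u.length) := by
  have hnd : (standardize u).Nodup :=
    (List.nodup_map_iff_inj_on hu).2 fun _ hx _ hy => letterRank_injOn u hx hy
  refine (List.subperm_of_subset hnd fun a ha => ?_).perm_of_length_le (by simp [standardize])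
  obtain ⟨x, hx, rfl⟩ := List.mem_map.1 ha
  rw [List.mem_range'_1]
  have hpos : 0 < letterRank u x := List.countP_pos_iff.2 ⟨x, hx, by rw [Nat.ble_eq]⟩
  have hle : letterRank u x ≤ u.length := List.countP_le_length
  omega

theorem nodup_standardize (hu : u.Nodup) : (standardize u).Nodup :=
  (standardize_perm_range' hu).nodup_iff.2 (List.nodup_range' (step := 1))

end Standardize

/-! ### Local Schur positivity -/

/-- The set of cuts (proper suffix sums, shifted by one) of a composition as a binary number, to be
compared with `descentMask`. -/
def cutMask : List ℕ → ℕ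
  | [] => 0
  | a :: c => 2 ^ (a + c.sum) / 2 ||| cutMask c

theorem testBit_cutMask (c : List ℕ) (p : ℕ) :
    (cutMask c).testBit p = true ↔ p + 1 ∈ suffixSums c := by
  induction c with
  | nil => simp [cutMask, suffixSums]
  | cons a c ih =>
    rw [cutMask, Nat.testBit_or, ← Nat.testBit_succ, Nat.testBit_two_pow, Bool.or_eq_true, ih,
      suffixSums, List.mem_cons, decide_eq_true_eq, eq_comm]

theorem forall_mem_suffixSums_iff_land_cutMask {u : List ℕ} {d : ℕ} (hu : u.length = d)
    (c : List ℕ) : (∀ p, p + 1 < d → isDescent u p = true → p + 1 ∈ suffixSums c) ↔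
      descentMask u &&& cutMask c = descentMask u := by
  rw [land_eq_left_iff]
  refine forall_congr' fun p => ?_
  rw [testBit_descentMask, testBit_cutMask]
  refine ⟨fun h hp => h (not_le.1 fun hd => ?_) hp, fun h _ => h⟩
  rw [isDescent_eq_false_of_length_le (hu.trans_le hd)] at hp
  exact Bool.false_ne_true hp

/-- The list of the compositions of `r`. -/
def compositions : ℕ → List (List ℕ)
  | 0 => [[]]
  | r + 1 => (compositions r).flatMap fun
    | [] => [[1]]
    | a :: c => [(a + 1) :: c, 1 :: a :: c]

theorem mem_compositions {c : List ℕ} (hc : ∀ a ∈ c, 0 < a) : c ∈ compositions c.sum := by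
  induction hr : c.sum generalizing c with
  | zero =>
    obtain rfl := List.eq_nil_iff_forall_not_mem.2 fun a ha =>
      (hc a ha).ne' (List.sum_eq_zero_iff.1 hr a ha)
    simp [compositions]
  | succ r ih =>
    rw [compositions, List.mem_flatMap]
    rcases c with _ | ⟨_ | _ | a, c⟩
    · simp at hr
    · simp at hc
    · have hsum : c.sum = r := by
        rw [List.sum_cons] at hr
        omega
      refine ⟨c, ih (fun a ha => hc a (List.mem_cons_of_mem _ ha)) hsum, ?_⟩
      cases c <;> simp
    · have hsum : ((a + 1) :: c).sum = r := by
        rw [List.sum_cons] at hr ⊢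
        omega
      refine ⟨(a + 1) :: c, ih (fun b hb => ?_) hsum, by simp⟩
      rcases List.mem_cons.1 hb with rfl | hb
      · exact Nat.succ_pos a
      · exact hc b (List.mem_cons_of_mem _ hb)

/-- A table of the functions on words that are negated by all moves in the window at `t`. The
entry `(t, u, l)` gives the value at a word with letters `u` outside this window and with a descent
at `t`: for the composition with cut mask `T` it is the sum of the `a` with `(m, a)` in `l` and
`m` a submask of `T`. The value is negated if there is no descent at `t`. -/
abbrev LSPCertificate := List (ℕ × List ℕ × List (ℕ × ℤ))

/-- The sum of the `a` with `(m, a)` in `l` and `m` a submask of `T`. -/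
def submaskWeight (T : ℕ) (l : List (ℕ × ℤ)) : ℤ :=
  (l.map fun p => if p.1 &&& T = p.1 then p.2 else 0).sum

/-- The list found under `t` and `u` in a certificate, empty if there is none. -/
def LSPCertificate.lookup (C : LSPCertificate) (t : ℕ) (u : List ℕ) : List (ℕ × ℤ) :=
  ((C.find? fun e => e.1 == t && e.2.1 == u).map fun e => e.2.2).getD []

/-- The function on words tabulated by a certificate that is negated by the moves in the window at
`t`. -/
def altWeight (C : LSPCertificate) (T t : ℕ) (w : List ℕ) : ℤ :=
  if admits t w then
    let a := submaskWeight T (C.lookup t (w.take t ++ w.drop (t + 3)))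
    if isDescent w t then a else -a
  else 0

/-- For all permutations `w` of `d` and all compositions `c` of `d`, whether the descents of `w`
are cuts of `c` agrees with the sum of `kostka c l` over those `(l, p)` in `P` for which `p w`
holds, up to functions that are negated by moves. -/
def localCheck (d : ℕ) (P : List (List ℕ × (List ℕ → Bool))) (C : LSPCertificate) : Bool :=
  (List.range' 1 d).permutations'.all fun w => (compositions d).all fun c =>
    (if descentMask w &&& cutMask c = descentMask w then (1 : ℤ) else 0) ==
      (P.map fun p => if p.2 w then (kostka c p.1 : ℤ) else 0).sum +
      ((List.range (d - 2)).map fun t => altWeight C (cutMask c) t w).sum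

theorem take_move_self (r : Bool) (t : ℕ) (w : List ℕ) : (move r t w).take t = w.take t := by
  induction t generalizing w with
  | zero => simp
  | succ t ih =>
    match w with
    | [] => rfl
    | x :: w => simp [ih]

theorem drop_move_self (r : Bool) (t : ℕ) (w : List ℕ) :
    (move r t w).drop (t + 3) = w.drop (t + 3) := by
  induction t generalizing w with
  | zero =>
    match w with
    | [] | [_] | [_, _] => rfl
    | x :: y :: z :: w =>
      rw [move_zero_cons]
      split_ifs <;> rfl
  | succ t ih =>
    match w with
    | [] => rfl
    | _ :: w => exact ih w

section AltWeight

variable {t : ℕ} {w : List ℕ} (C : LSPCertificate) (T : ℕ)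

theorem altWeight_eq_zero (h : ¬ admits t w = true) : altWeight C T t w = 0 := if_neg h

theorem altWeight_move (h : admits t w = true) (hw : w.Nodup) (r : Bool) :
    altWeight C T t (move r t w) = -altWeight C T t w := by
  rw [altWeight, altWeight, admits_move h hw, h, (isDescent_move h hw r).1, take_move_self,
    drop_move_self]
  cases isDescent w t <;> simp

end AltWeight

theorem sum_list_sum_comm {α β M : Type*} [AddCommMonoid M] (A : Finset α) (l : List β)
    (f : β → α → M) :
    ∑ x ∈ A, (l.map fun p => f p x).sum = (l.map fun p => ∑ x ∈ A, f p x).sum := by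
  induction l with
  | nil => simp
  | cons p l ih => simp only [List.map_cons, List.sum_cons, Finset.sum_add_distrib, ih]

theorem sum_eq_zero_of_adj_neg {V : Type*} {H : SimpleGraph V}
    (hH : ∀ v w w', H.Adj v w → H.Adj v w' → w = w') {A : Finset V}
    (hA : ∀ x ∈ A, ∀ y, H.Adj x y → y ∈ A) {F : V → ℤ} (hadj : ∀ x y, H.Adj x y → F y = -F x)
    (hisolated : ∀ x, (¬ ∃ y, H.Adj x y) → F x = 0) : ∑ x ∈ A, F x = 0 := by
  classical
  let g x := if hx : ∃ y, H.Adj x y then hx.choose else x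
  have hg {x y} (hxy : H.Adj x y) : g x = y := by
    have hx : ∃ y, H.Adj x y := ⟨y, hxy⟩
    exact (dif_pos hx).trans (hH x _ _ hx.choose_spec hxy)
  have hg' {x} (hx : ¬ ∃ y, H.Adj x y) : g x = x := dif_neg hx
  refine Finset.sum_involution (fun x _ => g x) (fun x _ => ?_) (fun x _ hx hgx => ?_)
    (fun x hx => ?_) (fun x _ => ?_) <;> by_cases hy : ∃ y, H.Adj x y
  · obtain ⟨y, hy⟩ := hy
    rw [hg hy, hadj x y hy, add_neg_cancel]
  · rw [hg' hy, hisolated x hy, add_zero]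
  · obtain ⟨y, hy⟩ := hy
    exact hy.ne ((hg hy).symm.trans hgx).symm
  · exact hx (hisolated x hy)
  · obtain ⟨y, hy⟩ := hy
    exact (hg hy).symm ▸ hA x hx y hy
  · rwa [hg' hy]
  · obtain ⟨y, hy⟩ := hy
    rw [hg hy, hg hy.symm]
  · rw [hg' hy, hg' hy]

namespace SignedColoredGraph

theorem reachable_restrict_of_adj {n : ℕ} {V : Type*} {G : SignedColoredGraph n V} {k d t : ℕ}
    {v w x : V} (ht : 2 ≤ t ∧ t < d) (hw : (G.restrict k d).underlying.Reachable v w)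
    (hx : (G.edge (k + t)).Adj w x) : (G.restrict k d).underlying.Reachable v x := by
  refine hw.trans (SimpleGraph.Adj.reachable (SimpleGraph.iSup_adj.2 ⟨t, ?_⟩))
  change (if 2 ≤ t ∧ t < d then G.edge (k + t) else ⊥).Adj w x
  rwa [if_pos ht]

end SignedColoredGraph

namespace IsMoveSystem

variable {n : ℕ} {S : Finset (List ℕ)} {kind : List ℕ → ℕ → Bool} {h : IsMoveSystem n S kind}

theorem sum_altWeight_eq_zero (C : LSPCertificate) (T k : ℕ) {d t : ℕ} (ht : t + 3 ≤ d)
    {A : Finset h.Vertex}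
    (hA : ∀ x ∈ A, ∀ y, (h.signed.edge (k + t + 2)).Adj x y → y ∈ A) :
    ∑ x ∈ A, altWeight C T t (standardize (window k d x.1)) = 0 := by
  have hiff (x : h.Vertex) : admits t (standardize (window k d x.1)) = true ↔
      h.signed.Admits (k + t + 2) x := by
    rw [admits_standardize, admits_window k ht, admits_add_two_iff]
  refine sum_eq_zero_of_adj_neg (axiom0 (h := h) (k + t + 2)) hA (fun x y hxy => ?_) fun x hx =>
    altWeight_eq_zero C T fun hadm => hx ((hiff x).1 hadm)
  rw [(adj_add_two_iff.1 hxy).2, window_move _ _ ht, standardize_move,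
    altWeight_move C T ((hiff x).2 ⟨y, hxy⟩) (nodup_standardize (nodup_window (nodup x)))]

open Classical in
theorem ite_eq_of_localCheck {d k : ℕ} {P : List (List ℕ × (List ℕ → Bool))} {C : LSPCertificate}
    (hcheck : localCheck d P C = true) (hk : k + d ≤ n) (x : h.Vertex) {c : List ℕ}
    (hc : ∀ a ∈ c, 0 < a) (hs : c.sum = d) :
    (if ∀ j, 1 ≤ j → j < d → j ∈ {i | (h.signed.restrict k d).σ x i = -1} → j ∈ suffixSums c
      then (1 : ℤ) else 0) =
      (P.map fun p => if p.2 (standardize (window k d x.1)) then (kostka c p.1 : ℤ) else 0).sum +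
      ((List.range (d - 2)).map fun t =>
        altWeight C (cutMask c) t (standardize (window k d x.1))).sum := by
  have hlen : (window k d x.1).length = d := length_window (hk.trans_eq (length x).symm)
  have hperm := standardize_perm_range' (nodup_window (k := k) (d := d) (nodup x))
  rw [hlen] at hperm
  have hcomp : c ∈ compositions d := hs ▸ mem_compositions hc
  rw [← beq_iff_eq.1 (List.all_eq_true.1 (List.all_eq_true.1 hcheck _
    (List.mem_permutations'.2 hperm)) c hcomp)]
  congr 1
  refine propext (Iff.trans ?_
    (forall_mem_suffixSums_iff_land_cutMask ((length_standardize _).trans hlen) c))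
  have hσ (p : ℕ) (hp : p + 1 < d) : (h.signed.restrict k d).σ x (p + 1) = -1 ↔
      isDescent (standardize (window k d x.1)) p = true := by
    rw [isDescent_standardize, isDescent_window k hp]
    exact σ_eq_neg_one_iff
  constructor
  · exact fun hj p hp hd => hj (p + 1) (Nat.le_add_left 1 p) hp ((hσ p hp).2 hd)
  · intro hp j hj hjd hmem
    obtain ⟨p, rfl⟩ := Nat.exists_eq_add_of_le' hj
    exact hp p hjd ((hσ p hjd).1 hmem)

/-- Summing the identity of `localCheck` over a component cancels the functions negated by moves and
leaves the quasisymmetric coefficients of a nonnegative combination of Schur functions. -/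
theorem lsp_of_localCheck {d : ℕ} {P : List (List ℕ × (List ℕ → Bool))} {C : LSPCertificate}
    (hP : ∀ p ∈ P, p.1.SortedGE ∧ p.1.sum = d) (hcheck : localCheck d P C = true) :
    h.signed.LSP d := by
  classical
  intro k hk v
  unfold SignedColoredGraph.componentGenFun
  set A := Finset.univ.filter fun w => (h.signed.restrict k d).underlying.Reachable v w with hAdef
  have hA : ∀ t, t + 3 ≤ d → ∀ x ∈ A, ∀ y, (h.signed.edge (k + t + 2)).Adj x y → y ∈ A := by
    intro t ht x hx y hxy
    rw [hAdef, Finset.mem_filter] at hx ⊢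
    exact ⟨Finset.mem_univ _, SignedColoredGraph.reachable_restrict_of_adj (t := t + 2)
      ⟨by omega, by omega⟩ hx.2 hxy⟩
  let L : List (ℤ × List ℕ) := P.map fun p =>
    (((A.filter fun x => p.2 (standardize (window k d x.1)) = true).card : ℤ), p.1)
  have hL : ∀ p ∈ L, 0 ≤ p.1 ∧ p.2.SortedGE ∧ p.2.sum = d := by
    intro p hp
    obtain ⟨q, hq, rfl⟩ := List.mem_map.1 hp
    exact ⟨Int.natCast_nonneg _, hP q hq⟩
  have hexpand : ∑ x ∈ A, fundamentalQSym d {i | (h.signed.restrict k d).σ x i = -1} =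
      (L.map fun p => p.1 • schurFunction (diagram p.2)).sum := by
    refine sum_fundamentalQSym_eq A _ d L (fun p hp => (hL p hp).2) fun c hc hs => ?_
    have hzero (t) (ht : t ∈ List.range (d - 2)) :
        ∑ x ∈ A, altWeight C (cutMask c) t (standardize (window k d x.1)) = 0 := by
      have ht : t + 3 ≤ d := by rw [List.mem_range] at ht; omega
      exact sum_altWeight_eq_zero C (cutMask c) k ht (hA t ht)
    trans ∑ x ∈ A, ((P.map fun p =>
        if p.2 (standardize (window k d x.1)) then (kostka c p.1 : ℤ) else 0).sum +
      ((List.range (d - 2)).map fun t =>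
        altWeight C (cutMask c) t (standardize (window k d x.1))).sum)
    · refine Finset.sum_congr rfl fun x _ => ?_
      convert ite_eq_of_localCheck hcheck hk x hc hs
    rw [Finset.sum_add_distrib, sum_list_sum_comm, sum_list_sum_comm, List.map_congr_left hzero,
      List.map_const', List.sum_replicate, smul_zero, add_zero, List.map_map]
    refine congrArg _ (List.map_congr_left fun p _ => ?_)
    rw [Function.comp_apply, Finset.card_filter, Nat.cast_sum, Finset.sum_mul]
    exact Finset.sum_congr rfl fun x _ => by split_ifs <;> simp
  convert hexpand ▸ schurPositive_list_sum fun p hp => (hL p hp).1 using 2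
  ext w
  simp only [hAdef, Finset.mem_filter]

end IsMoveSystem

/-- The certificate of local Schur positivity for patterns of length 4. -/
def certificate4 : LSPCertificate :=
  [(0, [1], [(3, 1), (5, 1)]), (0, [2], [(3, 1), (5, 1)]), (0, [3], [(1, 1)]), (0, [4], [(1, 1)]),
   (1, [1], [(1, 1), (2, 1)]), (1, [2], [(1, 1), (2, 1)]), (1, [3], [(3, 1)]), (1, [4], [(3, 1)])]

/-- The certificate of local Schur positivity for patterns of length 5. -/
def certificate5 : LSPCertificate :=
  [(0, [1, 2], [(5, 1), (11, 1)]), (0, [1, 3], [(5, 1), (11, 1)]), (0, [1, 4], [(5, 1), (11, 1)]),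
   (0, [1, 5], [(2, -1), (11, 1)]), (0, [2, 1], [(7, 1), (11, 1), (13, 1)]),
   (0, [2, 3], [(3, 1), (5, 1)]), (0, [2, 4], [(3, 1), (5, 1)]), (0, [2, 5], [(2, -1), (3, 1)]),
   (0, [3, 1], [(7, 1), (11, 1), (13, 1)]), (0, [3, 2], [(7, 1), (11, 1), (13, 1)]),
   (0, [3, 4], [(1, 1)]), (0, [3, 5], [(1, 1)]), (0, [4, 1], [(3, 1), (9, 1), (11, -1)]),
   (0, [4, 2], [(9, 1)]), (0, [4, 3], [(9, 1)]), (0, [4, 5], [(1, 1)]),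
   (0, [5, 1], [(2, 1), (3, 1), (5, 1), (9, 1), (11, -1)]), (0, [5, 2], [(2, 1), (5, 1), (9, 1)]),
   (0, [5, 3], [(2, 1), (5, 1), (9, 1)]), (0, [5, 4], [(2, 1), (5, 1), (9, 1)]),
   (1, [1, 2], [(3, 1), (5, 1), (9, 1), (6, 1), (10, 1)]),
   (1, [1, 3], [(3, 1), (5, 1), (9, 1), (6, 1), (10, 1)]), (1, [1, 4], [(1, 1), (2, 1)]),
   (1, [1, 5], [(1, 1), (2, 1)]), (1, [2, 1], [(3, 1), (5, 1), (9, 1), (6, 1), (10, 1)]),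
   (1, [2, 3], [(5, 1), (9, 1), (6, 1), (10, 1), (11, 1)]), (1, [2, 4], [(1, 1), (2, 1)]),
   (1, [2, 5], [(1, 1), (2, 1)]), (1, [3, 1], [(3, 1), (5, 1), (9, 1), (6, 1), (10, 1)]),
   (1, [3, 2], [(5, 1), (9, 1), (6, 1), (10, 1), (11, 1)]), (1, [3, 4], [(2, 1), (3, 1), (5, 1)]),
   (1, [3, 5], [(3, 1)]), (1, [4, 1], [(7, 1), (11, 1)]), (1, [4, 2], [(7, 1), (11, 1)]),
   (1, [4, 3], [(2, 1), (3, 1), (5, 1)]), (1, [4, 5], [(3, 1)]), (1, [5, 1], [(7, 1), (11, 1)]),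
   (1, [5, 2], [(7, 1), (11, 1)]), (1, [5, 3], [(3, 1)]), (1, [5, 4], [(3, 1)]),
   (2, [1, 2], [(1, 1), (2, 1), (4, 1)]), (2, [1, 3], [(1, 1), (2, 1), (4, 1)]),
   (2, [1, 4], [(2, -1), (3, 1), (6, 1)]), (2, [1, 5], [(3, 1), (5, 1), (6, 1)]),
   (2, [2, 1], [(2, 1), (5, 1)]), (2, [2, 3], [(1, 1), (2, 1), (4, 1)]),
   (2, [2, 4], [(2, -1), (6, 1), (11, 1)]), (2, [2, 5], [(5, 1), (6, 1), (11, 1)]),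
   (2, [3, 1], [(2, 1), (5, 1)]), (2, [3, 2], [(2, 1), (3, 1), (5, 1), (11, -1)]),
   (2, [3, 4], [(2, -1), (6, 1), (11, 1)]), (2, [3, 5], [(5, 1), (6, 1), (11, 1)]),
   (2, [4, 1], [(2, 1), (5, 1)]), (2, [4, 2], [(2, 1), (3, 1), (5, 1), (11, -1)]),
   (2, [4, 3], [(7, 1)]), (2, [4, 5], [(5, 1), (6, 1), (11, 1)]), (2, [5, 2], [(3, 1), (11, -1)]),
   (2, [5, 3], [(7, 1)]), (2, [5, 4], [(7, 1)])]

/-- The predicates on patterns of length 4 that count the Schur functions in a component. -/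
def schurWitness4 : List (List ℕ × (List ℕ → Bool)) :=
  [([4], fun w => descentMask w == 0), ([3, 1], fun w => descentMask w == 4),
   ([2, 2], fun w => [[2, 1, 4, 3], [3, 4, 1, 2]].elem w), ([2, 1, 1], fun w => descentMask w == 6),
   ([1, 1, 1, 1], fun w => descentMask w == 7)]

/-- The predicates on patterns of length 5 that count the Schur functions in a component. -/
def schurWitness5 : List (List ℕ × (List ℕ → Bool)) :=
  [([5], fun w => descentMask w == 0), ([4, 1], fun w => descentMask w == 8),
   ([3, 2], fun w => [[1, 3, 2, 5, 4], [1, 4, 5, 2, 3], [2, 3, 1, 5, 4], [2, 4, 5, 1, 3],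
      [3, 4, 5, 1, 2]].elem w),
   ([3, 1, 1], fun w => descentMask w == 12),
   ([2, 2, 1], fun w => [[2, 1, 5, 4, 3], [3, 1, 5, 4, 2], [3, 2, 5, 4, 1], [4, 5, 1, 3, 2],
      [4, 5, 2, 3, 1]].elem w),
   ([2, 1, 1, 1], fun w => descentMask w == 14), ([1, 1, 1, 1, 1], fun w => descentMask w == 15)]

theorem localCheck_four : localCheck 4 schurWitness4 certificate4 = true := by decide +kernel

theorem localCheck_five : localCheck 5 schurWitness5 certificate5 = true := by decide +kernel

theorem IsMoveSystem.lsp_four {n : ℕ} {S : Finset (List ℕ)} {kind : List ℕ → ℕ → Bool}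
    (h : IsMoveSystem n S kind) : h.signed.LSP 4 :=
  lsp_of_localCheck (by decide) localCheck_four

theorem IsMoveSystem.lsp_five {n : ℕ} {S : Finset (List ℕ)} {kind : List ℕ → ℕ → Bool}
    (h : IsMoveSystem n S kind) : h.signed.LSP 5 :=
  lsp_of_localCheck (by decide) localCheck_five

/-! ### Permutations with given inverse descents -/

/-- The word `w` is a permutation of `1, …, bs.length + 1` in which, for `v ≤ bs.length`, the letter
`v + 1` is to the left of `v` if and only if the entry of `bs` with index `bs.length - v` is true.
The list `bs` starts with the largest letters, so that removing the largest letter of `w` removes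
the first entry of `bs`. -/
def hasInverseDescents : List Bool → List ℕ → Bool
  | [], w => w == [1]
  | b :: bs, w => w.elem (bs.length + 2) &&
      (decide (w.idxOf (bs.length + 2) < w.idxOf (bs.length + 1)) == b) &&
      hasInverseDescents bs (w.erase (bs.length + 2))

/-- The indices at which a new letter can be inserted in a word of length `L` to the left (if `b` is
true) or to the right of the letter of index `p`. -/
def insertionSites (b : Bool) (p L : ℕ) : List ℕ :=
  bif b then List.range (p + 1) else List.range' (p + 1) (L - p)

/-- The list of the words `w` with `hasInverseDescents bs w`. -/
def inverseDescentClass : List Bool → List (List ℕ)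
  | [] => [[1]]
  | b :: bs => (inverseDescentClass bs).flatMap fun u =>
      (insertionSites b (u.idxOf (bs.length + 1)) (bs.length + 1)).map fun q =>
        u.insertIdx q (bs.length + 2)

/-- The descent mask of a word of length `L` with descent mask `M` after a new maximal letter has
been inserted at the index `q`. -/
def insertMask : ℕ → ℕ → ℕ → ℕ
  | 0, L, M => bif Nat.blt 0 L then 2 * M + 1 else 2 * M
  | 1, L, M => 2 * insertMask 0 (L - 1) (M / 2)
  | q + 2, L, M => M % 2 + 2 * insertMask (q + 1) (L - 1) (M / 2)

/-- The indices of the maximal letters and the descent masks of the words in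
`inverseDescentClass bs`, computed without the words. -/
def inverseDescentStates : List Bool → List (ℕ × ℕ)
  | [] => [(0, 0)]
  | b :: bs => (inverseDescentStates bs).flatMap fun s =>
      (insertionSites b s.1 (bs.length + 1)).map fun q => (q, insertMask q (bs.length + 1) s.2)

section InverseDescents

variable {b : Bool} {bs : List Bool} {u w : List ℕ}

theorem hasInverseDescents_cons_iff : hasInverseDescents (b :: bs) w = true ↔
    bs.length + 2 ∈ w ∧ decide (w.idxOf (bs.length + 2) < w.idxOf (bs.length + 1)) = b ∧
      hasInverseDescents bs (w.erase (bs.length + 2)) = true := by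
  rw [hasInverseDescents, Bool.and_eq_true, Bool.and_eq_true, List.elem_iff, beq_iff_eq, and_assoc]

theorem perm_range'_of_hasInverseDescents (h : hasInverseDescents bs w = true) :
    w.Perm (List.range' 1 (bs.length + 1)) := by
  induction bs generalizing w with
  | nil => rw [beq_iff_eq.1 h, List.length_nil, List.range'_one]
  | cons b bs ih =>
    obtain ⟨hmem, -, h⟩ := hasInverseDescents_cons_iff.1 h
    rw [List.length_cons, List.range'_1_concat, Nat.add_comm 1]
    exact (List.perm_cons_erase hmem).trans
      (((ih h).cons _).trans (List.perm_append_singleton _ _).symm)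

theorem length_of_hasInverseDescents (h : hasInverseDescents bs w = true) :
    w.length = bs.length + 1 := by
  rw [(perm_range'_of_hasInverseDescents h).length_eq, List.length_range']

theorem mem_iff_of_hasInverseDescents (h : hasInverseDescents bs w = true) {x : ℕ} :
    x ∈ w ↔ 1 ≤ x ∧ x ≤ bs.length + 1 := by
  rw [(perm_range'_of_hasInverseDescents h).mem_iff, List.mem_range'_1, Nat.add_comm 1,
    Nat.lt_succ_iff]

theorem notMem_of_hasInverseDescents (h : hasInverseDescents bs w = true) :
    bs.length + 2 ∉ w := by
  rw [mem_iff_of_hasInverseDescents h]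
  omega

theorem idxOf_lt_of_hasInverseDescents (h : hasInverseDescents bs w = true) :
    w.idxOf (bs.length + 1) < bs.length + 1 := by
  refine (List.idxOf_lt_length_iff.2 ?_).trans_eq (length_of_hasInverseDescents h)
  exact (mem_iff_of_hasInverseDescents h).2 ⟨Nat.le_add_left 1 _, le_rfl⟩

theorem eq_of_hasInverseDescents {bs' : List Bool} (hl : bs.length = bs'.length)
    (h : hasInverseDescents bs w = true) (h' : hasInverseDescents bs' w = true) : bs = bs' := by
  induction bs generalizing bs' w with
  | nil => exact (List.eq_nil_of_length_eq_zero hl.symm).symm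
  | cons b bs ih =>
    match bs', hl with
    | b' :: bs', hl =>
      have hl : bs.length = bs'.length := Nat.succ.inj hl
      rw [hasInverseDescents_cons_iff] at h h'
      rw [← hl] at h'
      rw [← h.2.1, ← h'.2.1, ih hl h.2.2 h'.2.2]

theorem hasInverseDescents_swap (bs : List Bool) (p s : List ℕ) {a c : ℕ} (hac : a + 1 < c) :
    hasInverseDescents bs (p ++ a :: c :: s) = hasInverseDescents bs (p ++ c :: a :: s) := by
  induction bs generalizing p s with
  | nil =>
    have hne (x y : ℕ) : (p ++ x :: y :: s == [1]) = false :=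
      beq_eq_false_iff_ne.2 fun h => by simp [List.append_eq_singleton_iff] at h
    rw [hasInverseDescents, hasInverseDescents, hne, hne]
  | cons b bs ih =>
    have herase (m : ℕ) : hasInverseDescents bs ((p ++ a :: c :: s).erase m) =
        hasInverseDescents bs ((p ++ c :: a :: s).erase m) := by
      by_cases hm : m ∈ p
      · rw [List.erase_append_left _ hm, List.erase_append_left _ hm, ih]
      · rw [List.erase_append_right _ hm, List.erase_append_right _ hm]
        simp only [List.erase_cons, beq_iff_eq]
        split_ifs
        · omega
        · rfl
        · rfl
        · exact ih _ _
    have hidx : (p ++ a :: c :: s).idxOf (bs.length + 2) <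
          (p ++ a :: c :: s).idxOf (bs.length + 1) ↔
        (p ++ c :: a :: s).idxOf (bs.length + 2) < (p ++ c :: a :: s).idxOf (bs.length + 1) := by
      simp only [List.idxOf_append, ← List.idxOf_lt_length_iff, List.idxOf_cons, cond_eq_ite,
        beq_iff_eq]
      split_ifs <;> omega
    have hmem : (p ++ a :: c :: s).elem (bs.length + 2) =
        (p ++ c :: a :: s).elem (bs.length + 2) := by
      rw [Bool.eq_iff_iff, List.elem_iff, List.elem_iff]
      exact ((List.Perm.swap c a s).append_left p).mem_iff
    rw [hasInverseDescents, hasInverseDescents, herase, hmem, decide_eq_decide.2 hidx]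

theorem hasInverseDescents_knuthMove (bs : List Bool) (hw : w.Nodup) {k : ℕ}
    (h : admits k w = true) : hasInverseDescents bs (move false k w) = hasInverseDescents bs w := by
  obtain ⟨v, x, y, z, t, rfl, rfl, hxyz⟩ := exists_of_admits h
  have hne := hw.of_append_right
  simp only [List.nodup_cons, List.mem_cons, not_or] at hne
  rw [move_length_append, move_zero_cons, if_neg Bool.false_ne_true, if_neg Bool.false_ne_true]
  have hswap (p s : List ℕ) (a c : ℕ) (hac : a + 1 < c ∨ c + 1 < a) :
      hasInverseDescents bs (p ++ a :: c :: s) = hasInverseDescents bs (p ++ c :: a :: s) :=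
    hac.elim (hasInverseDescents_swap bs p s) fun hac => (hasInverseDescents_swap bs p s hac).symm
  split_ifs with hx
  · simpa using hswap (v ++ [x]) t z y (by omega)
  · exact hswap v (z :: t) y x (by omega)

theorem mem_insertionSites {p L q : ℕ} (hp : p < L) :
    q ∈ insertionSites b p L ↔ q ≤ L ∧ decide (q ≤ p) = b := by
  cases b
  · rw [insertionSites, cond_false, List.mem_range'_1, decide_eq_false_iff_not]
    omega
  · rw [insertionSites, cond_true, List.mem_range, decide_eq_true_iff]
    omega

section InsertIdx

variable {α : Type*} {l : List α} {m : α} {q : ℕ}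

theorem insertIdx_eq_take_append_cons_drop (hq : q ≤ l.length) (m : α) :
    l.insertIdx q m = l.take q ++ m :: l.drop q := by
  induction q generalizing l with
  | zero => rfl
  | succ q ih =>
    match l with
    | _ :: l =>
      rw [List.insertIdx_succ_cons, ih (Nat.le_of_succ_le_succ hq), List.take_succ_cons,
        List.drop_succ_cons, List.cons_append]

variable [DecidableEq α]

theorem idxOf_insertIdx_self (hm : m ∉ l) (hq : q ≤ l.length) : (l.insertIdx q m).idxOf m = q := by
  rw [insertIdx_eq_take_append_cons_drop hq,
    List.idxOf_append_of_notMem fun h => hm (List.mem_of_mem_take h), List.idxOf_cons_self,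
    List.length_take_of_le hq, Nat.add_zero]

theorem idxOf_insertIdx_of_ne {x : α} (hx : x ≠ m) (hq : q ≤ l.length) :
    (l.insertIdx q m).idxOf x = if l.idxOf x < q then l.idxOf x else l.idxOf x + 1 := by
  induction q generalizing l with
  | zero => rw [List.insertIdx_zero, List.idxOf_cons_ne _ hx.symm, if_neg (Nat.not_lt_zero _)]
  | succ q ih =>
    match l with
    | y :: l =>
      rw [List.insertIdx_succ_cons]
      by_cases hy : y = x
      · rw [hy, List.idxOf_cons_self, List.idxOf_cons_self, if_pos q.succ_pos]
      · rw [List.idxOf_cons_ne _ hy, List.idxOf_cons_ne _ hy, ih (Nat.le_of_succ_le_succ hq)]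
        split_ifs <;> omega

theorem erase_insertIdx_self (hm : m ∉ l) (hq : q ≤ l.length) : (l.insertIdx q m).erase m = l := by
  rw [insertIdx_eq_take_append_cons_drop hq,
    List.erase_append_right _ fun h => hm (List.mem_of_mem_take h), List.erase_cons_head,
    List.take_append_drop]

theorem insertIdx_idxOf_erase (hm : m ∈ l) : (l.erase m).insertIdx (l.idxOf m) m = l := by
  have hlt := List.idxOf_lt_length_iff.2 hm
  conv_rhs => rw [← List.insertIdx_eraseIdx_getElem hlt, List.getElem_idxOf hlt]
  rw [List.erase_eq_eraseIdx_of_idxOf rfl]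

end InsertIdx

theorem hasInverseDescents_insertIdx_iff (hu : hasInverseDescents bs u = true) {q : ℕ}
    (hq : q ≤ bs.length + 1) :
    hasInverseDescents (b :: bs) (u.insertIdx q (bs.length + 2)) = true ↔
      q ∈ insertionSites b (u.idxOf (bs.length + 1)) (bs.length + 1) := by
  have hm := notMem_of_hasInverseDescents hu
  have hqu : q ≤ u.length := hq.trans_eq (length_of_hasInverseDescents hu).symm
  rw [hasInverseDescents_cons_iff, idxOf_insertIdx_self hm hqu, erase_insertIdx_self hm hqu,
    idxOf_insertIdx_of_ne (Nat.succ_ne_self _).symm hqu,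
    mem_insertionSites (idxOf_lt_of_hasInverseDescents hu), and_iff_left hu,
    and_iff_right ((List.mem_insertIdx hqu).2 (.inl rfl)), and_iff_right hq]
  congr! 2
  split_ifs <;> omega

theorem mem_inverseDescentClass : w ∈ inverseDescentClass bs ↔ hasInverseDescents bs w = true := by
  induction bs generalizing w with
  | nil => simp [inverseDescentClass, hasInverseDescents]
  | cons b bs ih =>
    rw [inverseDescentClass, List.mem_flatMap]
    constructor
    · rintro ⟨u, hu, hw⟩
      obtain ⟨q, hq, rfl⟩ := List.mem_map.1 hw
      rw [ih] at hu
      exact (hasInverseDescents_insertIdx_iff hu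
        ((mem_insertionSites (idxOf_lt_of_hasInverseDescents hu)).1 hq).1).2 hq
    · intro hw
      obtain ⟨hm, -, hu⟩ := hasInverseDescents_cons_iff.1 hw
      have hq : w.idxOf (bs.length + 2) ≤ bs.length + 1 := by
        have hlt := List.idxOf_lt_length_iff.2 hm
        rwa [length_of_hasInverseDescents hw, List.length_cons, Nat.lt_succ_iff] at hlt
      refine ⟨_, ih.2 hu, List.mem_map.2 ⟨_, ?_, insertIdx_idxOf_erase hm⟩⟩
      rwa [← hasInverseDescents_insertIdx_iff hu hq, insertIdx_idxOf_erase hm]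

theorem le_of_mem_insertionSites {q : ℕ} (hu : u ∈ inverseDescentClass bs)
    (hq : q ∈ insertionSites b (u.idxOf (bs.length + 1)) (bs.length + 1)) : q ≤ u.length := by
  rw [mem_inverseDescentClass] at hu
  rw [mem_insertionSites (idxOf_lt_of_hasInverseDescents hu)] at hq
  exact hq.1.trans_eq (length_of_hasInverseDescents hu).symm

theorem nodup_inverseDescentClass (bs : List Bool) : (inverseDescentClass bs).Nodup := by
  induction bs with
  | nil => exact List.nodup_singleton _
  | cons b bs ih =>
    have hm (u) (hu : u ∈ inverseDescentClass bs) :=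
      notMem_of_hasInverseDescents (mem_inverseDescentClass.1 hu)
    rw [inverseDescentClass, List.nodup_flatMap]
    constructor
    · intro u hu
      refine (List.nodup_map_iff_inj_on ?_).2 fun q hq q' hq' h => ?_
      · cases b
        exacts [List.nodup_range', List.nodup_range]
      · exact List.injOn_insertIdx_index_of_notMem u _ (hm u hu) (le_of_mem_insertionSites hu hq)
          (le_of_mem_insertionSites hu hq') h
    · refine List.Pairwise.imp_of_mem (fun {u u'} hu hu' hne => ?_) ih
      rw [Function.onFun, List.disjoint_left]
      intro w hw hw'
      obtain ⟨q, hq, rfl⟩ := List.mem_map.1 hw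
      obtain ⟨q', hq', h⟩ := List.mem_map.1 hw'
      rw [← erase_insertIdx_self (hm u hu) (le_of_mem_insertionSites hu hq), ← h,
        erase_insertIdx_self (hm u' hu') (le_of_mem_insertionSites hu' hq')] at hne
      exact hne rfl

theorem descentMask_cons_div_two (x : ℕ) (w : List ℕ) :
    descentMask (x :: w) / 2 = descentMask w := by
  refine Nat.eq_of_testBit_eq fun p => ?_
  rw [← Nat.testBit_succ, testBit_descentMask, testBit_descentMask, isDescent_cons_succ]

theorem descentMask_cons_of_lt {m : ℕ} (hu : ∀ x ∈ u, x < m) :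
    descentMask (m :: u) = insertMask 0 u.length (descentMask u) := by
  match u with
  | [] => rfl
  | x :: t =>
    rw [descentMask, insertMask, blt_eq_decide, decide_eq_true (hu x List.mem_cons_self), cond_true,
      List.length_cons, blt_eq_decide, decide_eq_true (Nat.succ_pos _), cond_true]

theorem descentMask_insertIdx {m : ℕ} (hu : ∀ x ∈ u, x < m) {q : ℕ} (hq : q ≤ u.length) :
    descentMask (u.insertIdx q m) = insertMask q u.length (descentMask u) := by
  induction q generalizing u with
  | zero => exact descentMask_cons_of_lt hu
  | succ q ih =>
    match u, q with
    | x :: t, 0 =>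
      obtain ⟨hx, ht⟩ := List.forall_mem_cons.1 hu
      rw [insertMask, descentMask_cons_div_two, List.length_cons, Nat.add_sub_cancel,
        ← descentMask_cons_of_lt ht, List.insertIdx_succ_cons, List.insertIdx_zero, descentMask,
        blt_eq_decide, decide_eq_false hx.not_gt, cond_false]
    | x :: y :: t, q + 1 =>
      rw [insertMask, descentMask_cons_div_two, List.length_cons, Nat.add_sub_cancel,
        ← ih (List.forall_mem_cons.1 hu).2 (Nat.le_of_succ_le_succ hq), List.insertIdx_succ_cons,
        List.insertIdx_succ_cons, descentMask, descentMask]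
      cases Nat.blt y x
      · rw [cond_false, cond_false, Nat.mul_mod_right, Nat.zero_add]
      · rw [cond_true, cond_true, Nat.mul_add_mod, Nat.add_comm]

theorem map_inverseDescentClass (bs : List Bool) :
    ((inverseDescentClass bs).map fun w => (w.idxOf (bs.length + 1), descentMask w)) =
      inverseDescentStates bs := by
  induction bs with
  | nil => rfl
  | cons b bs ih =>
    rw [inverseDescentClass, inverseDescentStates, ← ih, List.map_flatMap, List.flatMap_map]
    refine List.flatMap_congr fun u hu => ?_
    rw [List.map_map]
    have hu' := mem_inverseDescentClass.1 hu
    have hlt (x) (hx : x ∈ u) : x < bs.length + 2 :=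
      Nat.lt_succ_iff.2 ((mem_iff_of_hasInverseDescents hu').1 hx).2
    refine List.map_congr_left fun q hq => ?_
    have hqu := le_of_mem_insertionSites hu hq
    rw [Function.comp_apply, descentMask_insertIdx hlt hqu, length_of_hasInverseDescents hu',
      List.length_cons, idxOf_insertIdx_self (notMem_of_hasInverseDescents hu') hqu]

end InverseDescents

/-! ### Local checks along moves -/

section LocalChecks

variable (kind : List ℕ → ℕ → Bool) (l : ℕ)

/-- The neighbor of a word along its `(k + 2)`-edge, if the kinds of the moves are given by
`kind`. -/
def neighbor (k : ℕ) (w : List ℕ) : List ℕ := move (kind w k) k w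

/-- The words, apart from `w`, on the path of at most `m` steps from `w` along neighbors that are
alternatingly in the directions `a` and `b`. -/
def walk : ℕ → ℕ → ℕ → List ℕ → List (List ℕ)
  | 0, _, _, _ => []
  | m + 1, a, b, w => if admits a w then neighbor kind a w :: walk m b a (neighbor kind a w) else []

/-- The path through `w` along neighbors in the directions `l` and `l + 1`, truncated after six
steps on both sides of `w`. -/
def string (w : List ℕ) : List (List ℕ) :=
  w :: (walk kind 6 l (l + 1) w ++ walk kind 6 (l + 1) l w)

/-- The list `s` contains all neighbors of its members in the directions `l` and `l + 1`. -/
abbrev ClosedUnderMoves (s : List (List ℕ)) : Prop :=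
  ∀ z ∈ s, ∀ t < 2, admits (l + t) z = true → neighbor kind (l + t) z ∈ s

/-- The condition on consecutive vertices `w` and `E_i(w)` of a flat `i`-chain, where
`i = l + 4`. -/
abbrev IsLinked (w : List ℕ) : Prop :=
  admits l w = true ∧ admits (l + 2) w = true ∧ admits l (neighbor kind (l + 2) w) = true

/-- The condition on the end `z` of a step of a weak flat `i`-chain, where `i = l + 4`: the vertex
`E_{i-2}(z)` does not have `(i-1)`-type W. -/
abbrev IsFlatEnd (z : List ℕ) : Prop :=
  ¬ (admits (l + 1) (neighbor kind l z) = true ∧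
    isDescent (neighbor kind l z) (l + 2) ≠ isDescent z (l + 2))

/-- A vertex of `(i+1)`-type W, where `i = l + 4`. -/
abbrev IsTypeW (w : List ℕ) : Prop :=
  admits (l + 3) w = true ∧ admits (l + 2) w = true ∧
    isDescent w (l + 4) ≠ isDescent (neighbor kind (l + 2) w) (l + 4)

/-- A weak flat `i`-chain, where `i = l + 4`, in which a pair `a, E_i(a)` with `W₁ a` is between
`E_i(y), y` and `z, E_i(z)`, satisfies `W₂ z` and does not continue with another vertex `v`. -/
def ChainCheck (W₁ W₂ : List ℕ → Prop) (a : List ℕ) : Prop :=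
  W₁ a → IsLinked kind l a → IsFlatEnd kind l a →
  ∀ y ∈ string kind l a, IsLinked kind l y →
  ∀ z ∈ string kind l (neighbor kind (l + 2) a), IsLinked kind l z → IsFlatEnd kind l z →
  [neighbor kind (l + 2) y, y, a, neighbor kind (l + 2) a, z].Nodup →
  W₂ z ∧ ∀ v ∈ string kind l (neighbor kind (l + 2) z), IsLinked kind l v → IsFlatEnd kind l v →
    ¬ [neighbor kind (l + 2) y, y, a, neighbor kind (l + 2) a, z, neighbor kind (l + 2) z, v].Nodup

set_option synthInstance.maxSize 1000 in
instance (W₁ W₂ : List ℕ → Prop) [DecidablePred W₁] [DecidablePred W₂] (a : List ℕ) :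
    Decidable (ChainCheck kind l W₁ W₂ a) := by
  delta ChainCheck; infer_instance

/-- The descents at the indices `l`, `l + 1`, `l + 2` of the words of the path through `w`, as
binary numbers. -/
def stringMasks (w : List ℕ) : List ℕ :=
  (string kind l w).map fun u => descentMask (u.drop l) % 8

/-- Axiom 4'a at the `(l + 3)`-edge of `w`, if this is a rotation edge. -/
def ComponentCheck (w : List ℕ) : Prop :=
  kind w (l + 1) = true → admits (l + 1) w = true →
  isDescent w l ≠ isDescent (neighbor kind (l + 1) w) l →
  isDescent w (l + 3) ≠ isDescent (neighbor kind (l + 1) w) (l + 3) →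
  ¬ (admits (l + 2) w = true ∧ neighbor kind (l + 1) w = neighbor kind (l + 2) w) →
  (string kind l w).Nodup ∧ (string kind (l + 1) w).Nodup ∧
    (stringMasks kind l w).Perm (stringMasks kind (l + 1) w)

instance (w : List ℕ) : Decidable (ComponentCheck kind l w) := by
  delta ComponentCheck; infer_instance

end LocalChecks

/-! ### Labelled prefix trees -/

/-- A prefix tree of words labelled by natural numbers, in the first-child next-sibling encoding; it
makes the lookup of a word cheap in the kernel. -/
inductive WordTrie where
  | nil : WordTrie
  | leaf (label : ℕ) : WordTrie
  | cons (letter : ℕ) (child sibling : WordTrie) : WordTrie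

namespace WordTrie

/-- The label of a word. -/
def lookup : WordTrie → List ℕ → Option ℕ
  | leaf c, [] => some c
  | cons a t s, b :: w => if a = b then lookup t w else lookup s (b :: w)
  | _, _ => none

/-- The tree of a single word. -/
def single (c : ℕ) : List ℕ → WordTrie
  | [] => leaf c
  | a :: w => cons a (single c w) nil

/-- Adds a word with the label `c` to a tree of words of the same length. -/
def insert (c : ℕ) : WordTrie → List ℕ → WordTrie
  | nil, w => single c w
  | cons a t s, b :: w => if a = b then cons a (insert c t w) s else cons a t (insert c s (b :: w))
  | T, _ => T

/-- The words in the tree. -/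
def words : WordTrie → List (List ℕ)
  | nil => []
  | leaf _ => [[]]
  | cons a t s => t.words.map (a :: ·) ++ s.words

/-- The kinds of moves encoded by the labels: the bit `k` of the label of `w` is set if the move in
direction `k` is a rotation. -/
def kind (T : WordTrie) (w : List ℕ) (k : ℕ) : Bool :=
  match T.lookup w with
  | some c => c.testBit k
  | none => false

/-- Applies a function to a tree after the tree has been evaluated; this keeps the kernel from
evaluating the tree again at each use of the argument. -/
def force {β : Sort*} : WordTrie → (WordTrie → β) → β
  | nil, f => f nil
  | leaf c, f => f (leaf c)
  | cons a t s, f => force t fun t' => force s fun s' => f (cons a t' s')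

theorem force_eq {β : Sort*} (T : WordTrie) (f : WordTrie → β) : T.force f = f T := by
  induction T generalizing f with
  | nil => rfl
  | leaf c => rfl
  | cons a t s iht ihs => rw [force, iht, ihs]

theorem forall_mem_words_of_force {P : WordTrie → List ℕ → Prop} [∀ T w, Decidable (P T w)]
    {T : WordTrie} (h : (T.force fun T => decide (∀ w ∈ T.words, P T w)) = true) :
    ∀ w ∈ T.words, P T w := by
  rwa [force_eq, decide_eq_true_iff] at h

theorem mem_words_of_isSome_lookup {T : WordTrie} {w : List ℕ} (h : (T.lookup w).isSome = true) :
    w ∈ T.words := by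
  induction T generalizing w with
  | nil => simp [lookup] at h
  | leaf d =>
    cases w with
    | nil => exact List.mem_singleton_self _
    | cons b w => simp [lookup] at h
  | cons a t s iht ihs =>
    cases w with
    | nil => simp [lookup] at h
    | cons b w =>
      rw [lookup] at h
      rw [words, List.mem_append]
      split_ifs at h with hab
      · exact .inl (hab ▸ List.mem_map_of_mem (iht h))
      · exact .inr (ihs h)

theorem kind_eq_false_of_notMem_words {T : WordTrie} {w : List ℕ} (h : w ∉ T.words) (k : ℕ) :
    T.kind w k = false := by
  rw [kind, Option.not_isSome_iff_eq_none.1 (mt mem_words_of_isSome_lookup h)]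

/-- The fields of `IsMoveSystem` on the kinds of moves, at the word `w` of length 8. -/
abbrev EdgeCheck (T : WordTrie) (w : List ℕ) : Prop :=
  ∀ k < 6, admits k w = true → (T.lookup (neighbor T.kind k w)).isSome = true ∧
    T.kind (neighbor T.kind k w) k = T.kind w k ∧
    ∀ j < 6, j + 3 ≤ k ∨ k + 3 ≤ j → T.kind (neighbor T.kind k w) j = T.kind w j

end WordTrie

/-! ### The vertices -/

/-- The vertices of the exceptional component in decimal notation, each with the label that
describes its rotation edges as in `WordTrie.kind`. -/
def coreData : List (ℕ × ℕ) := [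
  (32187654, 0), (32817654, 0), (32871654, 16), (32875164, 48), (32875416, 32), (38217654, 0),
  (38271654, 16), (38275164, 52), (38275416, 36), (38521764, 1), (38527164, 37), (38527416, 45),
  (38542176, 1), (38542716, 9), (53276481, 32), (53276814, 48), (53276841, 0), (53278164, 24),
  (53278614, 0), (53278641, 0), (53281764, 12), (53287164, 32), (53287416, 32), (53726481, 32),
  (53726814, 48), (53726841, 0), (53728164, 24), (53728614, 0), (53728641, 0), (53762481, 32),
  (53762814, 48), (53762841, 0), (53768124, 24), (53768214, 0), (53768241, 0), (53781264, 12),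
  (53781624, 12), (53782164, 0), (53782614, 0), (53782641, 0), (53786124, 0), (53786214, 0),
  (53786241, 0), (53812764, 6), (53817264, 6), (53817624, 6), (53821764, 1), (53827164, 33),
  (53827416, 41), (53842176, 3), (53842716, 11), (53871264, 0), (53871624, 0), (53876124, 0),
  (54321876, 0), (54328176, 0), (54328716, 0), (54382176, 2), (54382716, 2), (57326481, 32),
  (57326814, 48), (57326841, 0), (57328164, 24), (57328614, 0), (57328641, 0), (57362481, 32),
  (57362814, 48), (57362841, 0), (57368124, 24), (57368214, 0), (57368241, 0), (57381264, 12),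
  (57381624, 12), (57382164, 0), (57382614, 0), (57382641, 0), (57386124, 0), (57386214, 0),
  (57386241, 0), (57813264, 6), (57813624, 6), (57831264, 0), (57831624, 0), (57832164, 0),
  (57832614, 0), (57832641, 0), (57836124, 0), (57836214, 0), (57836241, 0), (58132764, 3),
  (58137264, 3), (58137624, 3), (58173264, 3), (58173624, 3), (58312764, 0), (58317264, 0),
  (58317624, 0), (58371264, 0), (58371624, 0), (58376124, 0), (58713264, 0), (58713624, 0),
  (58731264, 0), (58731624, 0), (58736124, 0), (81532764, 1), (81537264, 1), (81537624, 1),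
  (81573264, 1), (81573624, 1), (85132764, 0), (85137264, 0), (85137624, 0), (85173264, 0),
  (85173624, 0), (85312764, 0), (85317264, 0), (85317624, 0), (85371264, 0), (85371624, 0),
  (85376124, 0), (85713264, 0), (85713624, 0), (85731264, 0), (85731624, 0), (85736124, 0)]

/-- The vertices of the exceptional component in a prefix tree. -/
def coreTrie : WordTrie :=
  coreData.foldr (fun p T => T.insert p.2 (Nat.digits 10 p.1).reverse) .nil

/-- The argument of `hasInverseDescents` for the permutations of 8 in which, for `v ≤ 7`, the letter
`v + 1` is to the left of `v` if and only if the bit `v - 1` of `M` is set. -/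
def inverseDescentBits (M : ℕ) : List Bool := (List.range 7).map fun j => M.testBit (6 - j)

/-- The inverse descents of the vertices in the components without rotation edges. -/
def knuthClasses : List (List Bool) :=
  [0, 1, 2, 3, 4, 5, 6, 8, 9, 10, 12, 16, 17, 18, 20, 24, 32, 33, 34, 36, 40, 48, 64, 65, 66, 67,
    68, 72, 79, 80, 96, 97].map inverseDescentBits

/-- The inverse descents of the vertices in the exceptional component. -/
def coreClasses : List (List Bool) := [111, 123, 43, 107, 42, 106].map inverseDescentBits

/-- The vertices in the components without rotation edges. -/
def knuthWords : List (List ℕ) := knuthClasses.flatMap inverseDescentClass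

theorem coreTrie_edgeCheck : ∀ w ∈ coreTrie.words, coreTrie.EdgeCheck w :=
  WordTrie.forall_mem_words_of_force (P := WordTrie.EdgeCheck) (by decide +kernel)

theorem exists_mem_coreClasses :
    ∀ w ∈ coreTrie.words, ∃ bs ∈ coreClasses, hasInverseDescents bs w = true :=
  WordTrie.forall_mem_words_of_force
    (P := fun _ w => ∃ bs ∈ coreClasses, hasInverseDescents bs w = true) (by decide +kernel)

theorem closedUnderMoves_string_core :
    ∀ w ∈ coreTrie.words, ∀ l < 5, ClosedUnderMoves coreTrie.kind l (string coreTrie.kind l w) :=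
  WordTrie.forall_mem_words_of_force
    (P := fun T w => ∀ l < 5, ClosedUnderMoves T.kind l (string T.kind l w)) (by decide +kernel)

theorem coreTrie_componentCheck :
    ∀ w ∈ coreTrie.words, ∀ l < 4, ComponentCheck coreTrie.kind l w :=
  WordTrie.forall_mem_words_of_force
    (P := fun T w => ∀ l < 4, ComponentCheck T.kind l w) (by decide +kernel)

theorem coreTrie_chainCheck : ∀ w ∈ coreTrie.words, ∀ l < 3,
    ChainCheck coreTrie.kind l (IsTypeW coreTrie.kind l) (IsTypeW coreTrie.kind l) w :=
  WordTrie.forall_mem_words_of_force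
    (P := fun T w => ∀ l < 3, ChainCheck T.kind l (IsTypeW T.kind l) (IsTypeW T.kind l) w)
    (by decide +kernel)

theorem closedUnderMoves_string_pattern : ∀ w ∈ (List.range' 1 5).permutations',
    ClosedUnderMoves (fun _ _ => false) 0 (string (fun _ _ => false) 0 w) := by
  decide +kernel

theorem chainCheck_pattern : ∀ w ∈ (List.range' 1 5).permutations',
    ChainCheck (fun _ _ => false) 0 (fun _ => True) (fun _ => False) w := by
  decide +kernel

/-! ### Weak flat chains -/

/-- The words `w 1, …, w (2 * m)` have the properties of a weak flat `i`-chain, where `i = l + 4`,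
that can be checked on words; consecutive words in a component of the graph of `(i-2)`- and
`(i-1)`-edges are required to be members of one `string`. -/
structure IsWordChain (kind : List ℕ → ℕ → Bool) (l m : ℕ) (w : ℕ → List ℕ) : Prop where
  injOn : Set.InjOn w (Set.Icc 1 (2 * m))
  even_eq : ∀ p < m, w (2 * p + 2) = neighbor kind (l + 2) (w (2 * p + 1))
  odd_eq : ∀ p < m, w (2 * p + 1) = neighbor kind (l + 2) (w (2 * p + 2))
  isLinked : ∀ q ∈ Set.Icc 1 (2 * m), IsLinked kind l (w q)
  isFlatEnd : ∀ p, p + 1 < m → IsFlatEnd kind l (w (2 * p + 3))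
  odd_mem : ∀ p, p + 1 < m → w (2 * p + 3) ∈ string kind l (w (2 * p + 2))
  even_mem : ∀ p, p + 1 < m → w (2 * p + 2) ∈ string kind l (w (2 * p + 3))

theorem IsWordChain.nodup {kind : List ℕ → ℕ → Bool} {l m : ℕ} {w : ℕ → List ℕ}
    (C : IsWordChain kind l m w) {q s : ℕ} (hq : 1 ≤ q) (hs : q + s ≤ 2 * m + 1) :
    ((List.range' q s).map w).Nodup := by
  refine List.Nodup.map_on (fun a ha b hb => C.injOn ?_ ?_) List.nodup_range'
  all_goals
    simp only [List.mem_range'_1] at ha hb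
    exact ⟨by omega, by omega⟩

theorem IsWordChain.of_chainCheck {kind : List ℕ → ℕ → Bool} {l m p : ℕ} {w : ℕ → List ℕ}
    {W₁ W₂ : List ℕ → Prop} (C : IsWordChain kind l m w) (hp : p + 2 < m)
    (hcheck : ChainCheck kind l W₁ W₂ (w (2 * p + 3))) (hw : W₁ (w (2 * p + 3))) :
    W₂ (w (2 * p + 5)) ∧ m = p + 3 := by
  have hlinked {q : ℕ} (hq : 1 ≤ q) (hqm : q ≤ 2 * m) : IsLinked kind l (w q) :=
    C.isLinked q ⟨hq, hqm⟩
  have hcheck := hcheck hw (hlinked (by omega) (by omega)) (C.isFlatEnd p (by omega))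
    (w (2 * p + 2)) (C.even_mem p (by omega)) (hlinked (by omega) (by omega)) (w (2 * p + 5))
  have heq₁ : w (2 * p + 1) = neighbor kind (l + 2) (w (2 * p + 2)) := C.odd_eq p (by omega)
  have heq₄ : w (2 * p + 4) = neighbor kind (l + 2) (w (2 * p + 3)) := C.even_eq (p + 1) (by omega)
  have heq₆ : w (2 * p + 6) = neighbor kind (l + 2) (w (2 * p + 5)) := C.even_eq (p + 2) hp
  rw [← heq₁, ← heq₄, ← heq₆] at hcheck
  obtain ⟨hW₂, hend⟩ := hcheck (C.odd_mem (p + 1) hp) (hlinked (by omega) (by omega))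
    (C.isFlatEnd (p + 1) hp) (C.nodup (q := 2 * p + 1) (s := 5) (by omega) (by omega))
  refine ⟨hW₂, ?_⟩
  by_contra hm
  exact hend (w (2 * p + 7)) (C.odd_mem (p + 2) (by omega)) (hlinked (by omega) (by omega))
    (C.isFlatEnd (p + 2) (by omega)) (C.nodup (q := 2 * p + 1) (s := 7) (by omega) (by omega))

namespace IsMoveSystem

variable {n k l l' m : ℕ} {S : Finset (List ℕ)} {kind kind' : List ℕ → ℕ → Bool}
  {h : IsMoveSystem n S kind} {x y : h.Vertex}

theorem typeW_iff (hxy : (h.signed.edge (k + 2)).Adj x y) :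
    h.signed.TypeW (k + 3) x ↔
      admits (k + 1) x.1 = true ∧ isDescent x.1 (k + 2) ≠ isDescent y.1 (k + 2) := by
  refine and_congr (admits_add_two_iff (k := k + 1)) ⟨?_, ?_⟩
  · rintro ⟨z, hxz, hσ⟩
    rw [axiom0 _ _ _ _ hxy hxz]
    exact σ_eq_neg_σ_iff.1 hσ
  · exact fun hd => ⟨y, hxy, σ_eq_neg_σ_iff.2 hd⟩

theorem typeW_iff_of_adj (hxy : (h.signed.edge (k + 2)).Adj x y) (hk : k + 3 < n) :
    h.signed.TypeW (k + 3) x ↔ h.signed.TypeW (k + 3) y := by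
  obtain ⟨hx, hy⟩ := adj_add_two_iff.1 hxy
  have hflip := (isDescent_move hx (nodup x) (kind x.1 k)).2
  rw [← hy] at hflip
  rw [typeW_iff hxy, typeW_iff hxy.symm, admits_iff (by rw [length]; omega),
    admits_iff (by rw [length]; omega), hflip]
  cases isDescent x.1 (k + 1) <;> cases isDescent x.1 (k + 2) <;> cases isDescent y.1 (k + 2) <;>
    simp

theorem isTypeW_iff : IsTypeW kind l x.1 ↔ h.signed.TypeW (l + 5) x := by
  constructor
  · rintro ⟨hl₃, hl₂, hne⟩
    exact (typeW_iff (k := l + 2) (y := ⟨_, h.mem x.1 x.2 _ hl₂⟩)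
      (adj_add_two_iff.2 ⟨hl₂, rfl⟩)).2 ⟨hl₃, hne⟩
  · intro hx
    obtain ⟨y, hxy, -⟩ := hx.2
    obtain ⟨hl₃, hne⟩ := (typeW_iff (k := l + 2) hxy).1 hx
    obtain ⟨hl₂, hy⟩ := adj_add_two_iff (k := l + 2).1 hxy
    refine ⟨hl₃, hl₂, ?_⟩
    rwa [neighbor, ← hy]

/-- A model, by words with moves of the kinds `kind'` in the directions `l'`, `l' + 1`, `l' + 2`,
of the edges in the directions `l`, `l + 1`, `l + 2` between the vertices in `A`. The model may
identify vertices, but not those related by `R`, hence not those of one component of these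
edges. -/
structure IsLocalModel (h : IsMoveSystem n S kind) (l : ℕ) (A : Set h.Vertex)
    (R : h.Vertex → h.Vertex → Prop) (φ : h.Vertex → List ℕ) (kind' : List ℕ → ℕ → Bool)
    (l' : ℕ) : Prop where
  admits_eq : ∀ x ∈ A, ∀ t < 3, admits (l' + t) (φ x) = admits (l + t) x.1
  of_adj : ∀ x ∈ A, ∀ t < 3, ∀ y, (h.signed.edge (l + t + 2)).Adj x y →
    y ∈ A ∧ R x y ∧ φ y = neighbor kind' (l' + t) (φ x)
  isDescent_eq : ∀ x ∈ A, isDescent (φ x) (l' + 2) = isDescent x.1 (l + 2)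
  equivalence : Equivalence R
  inj : ∀ x ∈ A, ∀ y ∈ A, R x y → φ x = φ y → x = y
  closed : ∀ x ∈ A, ClosedUnderMoves kind' l' (string kind' l' (φ x))

namespace IsLocalModel

variable {A : Set h.Vertex} {R : h.Vertex → h.Vertex → Prop} {φ : h.Vertex → List ℕ}

theorem of_reachable (M : IsLocalModel h l A R φ kind' l') (hx : x ∈ A)
    (hxy : (h.signed.edge (l + 2) ⊔ h.signed.edge (l + 3)).Reachable x y) :
    y ∈ A ∧ R x y ∧ φ y ∈ string kind' l' (φ x) := by
  rw [SimpleGraph.reachable_iff_reflTransGen] at hxy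
  induction hxy with
  | refl => exact ⟨hx, M.equivalence.refl _, List.mem_cons_self⟩
  | @tail u z _ huz ih =>
    obtain ⟨huA, hxu, hu⟩ := ih
    obtain ⟨t, ht, huz⟩ : ∃ t < 2, (h.signed.edge (l + t + 2)).Adj u z := by
      rcases huz with huz | huz
      exacts [⟨0, Nat.two_pos, huz⟩, ⟨1, Nat.one_lt_two, huz⟩]
    have ht₃ := ht.trans (Nat.lt_succ_self 2)
    obtain ⟨hzA, huz', hz⟩ := M.of_adj u huA t ht₃ z huz
    refine ⟨hzA, M.equivalence.trans hxu huz', hz ▸ M.closed x hx _ hu t ht ?_⟩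
    rw [M.admits_eq u huA t ht₃]
    exact (adj_add_two_iff.1 huz).1

theorem isLinked (M : IsLocalModel h l A R φ kind' l') (hx : x ∈ A)
    (hxy : (h.signed.edge (l + 4)).Adj x y) (hax : h.signed.Admits (l + 2) x)
    (hay : h.signed.Admits (l + 2) y) : IsLinked kind' l' (φ x) := by
  obtain ⟨hy, -, hφ⟩ := M.of_adj x hx 2 (by omega) y hxy
  refine ⟨(M.admits_eq x hx 0 (by omega)).trans (admits_add_two_iff.1 hax),
    (M.admits_eq x hx 2 (by omega)).trans (adj_add_two_iff (k := l + 2).1 hxy).1, ?_⟩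
  rw [← hφ]
  exact (M.admits_eq y hy 0 (by omega)).trans (admits_add_two_iff.1 hay)

theorem isFlatEnd (M : IsLocalModel h l A R φ kind' l') (hx : x ∈ A)
    (hxy : (h.signed.edge (l + 2)).Adj x y) (hy : ¬ h.signed.TypeW (l + 3) y) :
    IsFlatEnd kind' l' (φ x) := by
  obtain ⟨hyA, -, hφ : φ y = neighbor kind' l' (φ x)⟩ := M.of_adj x hx 0 (by omega) y hxy
  rw [typeW_iff hxy.symm] at hy
  rwa [IsFlatEnd, ← hφ, M.admits_eq y hyA 1 (by omega), M.isDescent_eq y hyA, M.isDescent_eq x hx]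

theorem mem_of_weakFlatChain (M : IsLocalModel h l A R φ kind' l') {x : ℕ → h.Vertex}
    (hx : h.signed.WeakFlatChain (l + 4) m x) (hA : x 1 ∈ A) {q : ℕ} (hq : 1 ≤ q)
    (hqm : q ≤ 2 * m) : x q ∈ A ∧ R (x 1) (x q) := by
  obtain ⟨-, -, hadj, hstep⟩ := hx
  induction q, hq using Nat.le_induction with
  | base => exact ⟨hA, M.equivalence.refl _⟩
  | succ q hq ih =>
    obtain ⟨hqA, hqR⟩ := ih (by omega)
    rcases Nat.even_or_odd' q with ⟨p, rfl | rfl⟩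
    · obtain ⟨hA', hR', -⟩ := M.of_reachable hqA (hstep p (by omega) (by omega)).1
      exact ⟨hA', M.equivalence.trans hqR hR'⟩
    · obtain ⟨hA', hR', -⟩ :=
        M.of_adj _ hqA 2 (by omega) _ (hadj (p + 1) (by omega) (by omega)).symm
      exact ⟨hA', M.equivalence.trans hqR hR'⟩

theorem isWordChain (M : IsLocalModel h l A R φ kind' l') {x : ℕ → h.Vertex}
    (hx : h.signed.WeakFlatChain (l + 4) m x) (hA : x 1 ∈ A) :
    IsWordChain kind' l' m fun q => φ (x q) := by
  have hmem {q : ℕ} := M.mem_of_weakFlatChain hx hA (q := q)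
  obtain ⟨hinj, hadm, hadj, hstep⟩ := hx
  have hadj p (hp : p < m) : (h.signed.edge (l + 4)).Adj (x (2 * p + 2)) (x (2 * p + 1)) :=
    hadj (p + 1) (by omega) (by omega)
  have hstep p (hp : p + 1 < m) :
      h.signed.WeakFlatStep (l + 4) (x (2 * p + 2)) (x (2 * p + 3)) :=
    hstep (p + 1) (by omega) (by omega)
  refine ⟨fun q hq s hs hqs => ?_, fun p hp => ?_, fun p hp => ?_, fun q hq => ?_, fun p hp => ?_,
    fun p hp => ?_, fun p hp => ?_⟩
  · obtain ⟨hqA, hqR⟩ := hmem hq.1 hq.2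
    obtain ⟨hsA, hsR⟩ := hmem hs.1 hs.2
    exact hinj hq hs (M.inj _ hqA _ hsA (M.equivalence.trans (M.equivalence.symm hqR) hsR) hqs)
  · exact (M.of_adj _ (hmem (by omega) (by omega)).1 2 (by omega) _ (hadj p hp).symm).2.2
  · exact (M.of_adj _ (hmem (by omega) (by omega)).1 2 (by omega) _ (hadj p hp)).2.2
  · obtain ⟨hq₁, hqm⟩ := hq
    obtain ⟨p, hpm, rfl | rfl⟩ : ∃ p < m, q = 2 * p + 1 ∨ q = 2 * p + 2 :=
      ⟨(q - 1) / 2, by omega, by omega⟩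
    · exact M.isLinked (hmem hq₁ hqm).1 (hadj p hpm).symm (hadm _ hq₁ hqm)
        (hadm _ (by omega) (by omega))
    · exact M.isLinked (hmem hq₁ hqm).1 (hadj p hpm) (hadm _ hq₁ hqm)
        (hadm _ (by omega) (by omega))
  · obtain ⟨u, hu, huW⟩ := (hstep p hp).2
    exact M.isFlatEnd (hmem (by omega) (by omega)).1 hu huW
  · exact (M.of_reachable (hmem (by omega) (by omega)).1 (hstep p hp).1).2.2
  · exact (M.of_reachable (hmem (by omega) (by omega)).1 (hstep p hp).1.symm).2.2

theorem chainCondition (M : IsLocalModel h l A R φ kind' l') (hl : l + 5 < n)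
    {W₁ W₂ : List ℕ → Prop} (hW₁ : ∀ x ∈ A, h.signed.TypeW (l + 5) x → W₁ (φ x))
    (hW₂ : ∀ x ∈ A, W₂ (φ x) → h.signed.TypeW (l + 5) x)
    (hcheck : ∀ x ∈ A, ChainCheck kind' l' W₁ W₂ (φ x)) {x : ℕ → h.Vertex}
    (hx : h.signed.WeakFlatChain (l + 4) m x) (hA : x 1 ∈ A) :
    h.signed.ChainCondition (l + 4) m x := by
  have hmem {q : ℕ} (hq : 1 ≤ q) (hqm : q ≤ 2 * m) := (M.mem_of_weakFlatChain hx hA hq hqm).1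
  have hW p (hp : p < m) : h.signed.TypeW (l + 5) (x (2 * p + 2)) ↔
      h.signed.TypeW (l + 5) (x (2 * p + 1)) :=
    typeW_iff_of_adj (k := l + 2) (hx.2.2.1 (p + 1) (by omega) (by omega)) hl
  intro j hj₂ hjm hj
  obtain ⟨p, hp⟩ : ∃ p, j = 2 * p + 3 ∨ j = 2 * p + 4 := ⟨(j - 3) / 2, by omega⟩
  have hp₃ : h.signed.TypeW (l + 5) (x (2 * p + 3)) := by
    rcases hp with rfl | rfl
    exacts [hj, (hW (p + 1) (by omega)).1 hj]
  have hA₃ : x (2 * p + 3) ∈ A := hmem (by omega) (by omega)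
  obtain ⟨hp₅, rfl⟩ := (M.isWordChain hx hA).of_chainCheck (p := p) (by omega) (hcheck _ hA₃)
    (hW₁ _ hA₃ hp₃)
  have hp₅ := hW₂ _ (hmem (by omega) (by omega)) hp₅
  refine .inr fun q hjq hqm => ?_
  obtain rfl | rfl | rfl | rfl : q = 2 * p + 3 ∨ q = 2 * p + 4 ∨ q = 2 * p + 5 ∨ q = 2 * p + 6 := by
    omega
  exacts [hp₃, (hW (p + 1) (by omega)).2 hp₃, hp₅, (hW (p + 2) (by omega)).2 hp₅]

end IsLocalModel

end IsMoveSystem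

/-! ### Components of degree 4 -/

theorem fundamentalQSym_congr {n : ℕ} {D D' : Set ℕ}
    (h : ∀ j, 1 ≤ j → j < n → (j ∈ D ↔ j ∈ D')) : fundamentalQSym n D = fundamentalQSym n D' := by
  funext m
  unfold fundamentalQSym
  congr 2
  congr 1
  ext s
  refine and_congr_right fun _ => and_congr_left fun _ => ?_
  refine forall_congr' fun j => forall_congr' fun hj => ?_
  rw [h (j + 1) (by omega) hj]

theorem SignedColoredGraph.componentGenFun_eq_sum {n : ℕ} {V : Type*} [Fintype V]
    (G : SignedColoredGraph n V) {v : V} {s : Finset V}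
    (hs : ∀ w, w ∈ s ↔ G.underlying.Reachable v w) :
    G.componentGenFun v = ∑ w ∈ s, fundamentalQSym n {i | G.σ w i = -1} := by
  unfold SignedColoredGraph.componentGenFun
  refine Finset.sum_congr ?_ fun _ _ => rfl
  ext w
  simp [hs]

theorem SignedColoredGraph.exists_adj_of_restrict_four_adj {n k : ℕ} {V : Type*}
    {G : SignedColoredGraph n V} {v w : V} (hvw : (G.restrict k 4).underlying.Adj v w) :
    ∃ t < 2, (G.edge (k + t + 2)).Adj v w := by
  obtain ⟨t, ht⟩ := SimpleGraph.iSup_adj.1 hvw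
  change (if 2 ≤ t ∧ t < 4 then G.edge (k + t) else ⊥).Adj v w at ht
  split_ifs at ht with htd
  · obtain ⟨t, rfl⟩ := Nat.exists_eq_add_of_le' htd.1
    exact ⟨t, by omega, ht⟩
  · exact ht.elim

namespace IsMoveSystem

variable {n k : ℕ} {S : Finset (List ℕ)} {kind : List ℕ → ℕ → Bool} {h : IsMoveSystem n S kind}

theorem exists_reachable_of_mem_walk (m : ℕ) {s t : ℕ} (hs : s < 2) (ht : t < 2) (x : h.Vertex)
    {w : List ℕ} (hw : w ∈ walk kind m (k + s) (k + t) x.1) :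
    ∃ y : h.Vertex, y.1 = w ∧ (h.signed.restrict k 4).underlying.Reachable x y := by
  induction m generalizing s t x with
  | zero => cases hw
  | succ m ih =>
    rw [walk] at hw
    split_ifs at hw with hx
    · let y : h.Vertex := ⟨neighbor kind (k + s) x.1, h.mem x.1 x.2 _ hx⟩
      have hxy : (h.signed.restrict k 4).underlying.Reachable x y :=
        SignedColoredGraph.reachable_restrict_of_adj (t := s + 2) ⟨by omega, by omega⟩ (.refl x)
          (adj_add_two_iff.2 ⟨hx, rfl⟩)
      rcases List.mem_cons.1 hw with rfl | hw
      · exact ⟨y, rfl, hxy⟩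
      · obtain ⟨z, hz, hyz⟩ := ih ht hs y hw
        exact ⟨z, hz, hxy.trans hyz⟩
    · cases hw

theorem exists_reachable_of_mem_string {x : h.Vertex} {w : List ℕ} (hw : w ∈ string kind k x.1) :
    ∃ y : h.Vertex, y.1 = w ∧ (h.signed.restrict k 4).underlying.Reachable x y := by
  rw [string, List.mem_cons, List.mem_append] at hw
  rcases hw with rfl | hw | hw
  · exact ⟨x, rfl, .refl x⟩
  · exact exists_reachable_of_mem_walk (s := 0) (t := 1) 6 Nat.two_pos Nat.one_lt_two x hw
  · exact exists_reachable_of_mem_walk (s := 1) (t := 0) 6 Nat.one_lt_two Nat.two_pos x hw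

theorem mem_string_of_reachable {x y : h.Vertex}
    (hclosed : ClosedUnderMoves kind k (string kind k x.1))
    (hxy : (h.signed.restrict k 4).underlying.Reachable x y) : y.1 ∈ string kind k x.1 := by
  rw [SimpleGraph.reachable_iff_reflTransGen] at hxy
  induction hxy with
  | refl => exact List.mem_cons_self
  | tail _ huz ih =>
    obtain ⟨t, ht, huz⟩ := SignedColoredGraph.exists_adj_of_restrict_four_adj huz
    obtain ⟨hu, hz⟩ := adj_add_two_iff.1 huz
    exact hz ▸ hclosed _ ih t ht hu

theorem fundamentalQSym_restrict_four (y : h.Vertex) :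
    fundamentalQSym 4 {i | (h.signed.restrict k 4).σ y i = -1} =
      fundamentalQSym 4 {j | (descentMask (y.1.drop k) % 8).testBit (j - 1) = true} := by
  refine fundamentalQSym_congr fun j hj hj₄ => ?_
  obtain ⟨p, rfl⟩ := Nat.exists_eq_add_of_le' hj
  change h.signed.σ y (k + p + 1) = -1 ↔ (descentMask (y.1.drop k) % 2 ^ 3).testBit p = true
  rw [σ_eq_neg_one_iff, Nat.testBit_mod_two_pow, testBit_descentMask, isDescent_drop,
    decide_eq_true (by omega), Bool.true_and]

theorem componentGenFun_restrict_four {x : h.Vertex}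
    (hclosed : ClosedUnderMoves kind k (string kind k x.1)) (hnodup : (string kind k x.1).Nodup) :
    (h.signed.restrict k 4).componentGenFun x =
      ((stringMasks kind k x.1).map fun M =>
        fundamentalQSym 4 {j | M.testBit (j - 1) = true}).sum := by
  classical
  let s : Finset h.Vertex := {y | (h.signed.restrict k 4).underlying.Reachable x y}
  have hs y : y ∈ s ↔ (h.signed.restrict k 4).underlying.Reachable x y := by simp [s]
  rw [SignedColoredGraph.componentGenFun_eq_sum _ hs,
    Finset.sum_congr rfl fun y _ => fundamentalQSym_restrict_four y, stringMasks, List.map_map,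
    ← List.sum_toFinset _ hnodup]
  refine Finset.sum_bij (fun y _ => y.1) (fun y hy => ?_) (fun y _ y' _ hyy => Subtype.ext hyy)
    (fun w hw => ?_) (fun y _ => rfl)
  · exact List.mem_toFinset.2 (mem_string_of_reachable hclosed ((hs y).1 hy))
  · obtain ⟨y, rfl, hy⟩ := exists_reachable_of_mem_string (List.mem_toFinset.1 hw)
    exact ⟨y, (hs y).2 hy, rfl⟩

theorem axiom4a (hcheck : ∀ x ∈ S, ∀ l, l + 4 < n → kind x (l + 1) = true →
    ClosedUnderMoves kind l (string kind l x) ∧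
      ClosedUnderMoves kind (l + 1) (string kind (l + 1) x) ∧ ComponentCheck kind l x) :
    h.signed.Axiom4a := by
  intro i x y hi hin hxy hnot hσ₁ hσ₃
  obtain ⟨l, rfl⟩ := Nat.exists_eq_add_of_le' hi
  obtain ⟨hx, hy⟩ := adj_add_two_iff (k := l + 1).1 hxy
  have hd₁ : ¬ isDescent x.1 l = isDescent y.1 l := mt (σ_eq_σ_iff (p := l) (q := l)).2 hσ₁
  have hd₃ : ¬ isDescent x.1 (l + 3) = isDescent y.1 (l + 3) :=
    mt (σ_eq_σ_iff (p := l + 3) (q := l + 3)).2 hσ₃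
  rw [hy] at hd₁ hd₃
  -- A Knuth move changes at most one of the two adjacent descents.
  have hrot : kind x.1 (l + 1) = true := by
    by_contra hknuth
    rw [Bool.not_eq_true] at hknuth
    rw [hknuth] at hd₁ hd₃
    rcases isDescent_knuthMove hx with hd | hd
    exacts [hd₁ hd.symm, hd₃ hd.symm]
  obtain ⟨hclosed, hclosed', hcheck⟩ := hcheck x.1 x.2 l hin hrot
  obtain ⟨hnodup, hnodup', hperm⟩ := hcheck hrot hx hd₁ hd₃ fun ⟨hx', hxx⟩ =>
    hnot (adj_add_two_iff (k := l + 2).2 ⟨hx', hy.trans hxx⟩)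
  change (h.signed.restrict l 4).componentGenFun x =
    (h.signed.restrict (l + 1) 4).componentGenFun x
  rw [componentGenFun_restrict_four hclosed hnodup, componentGenFun_restrict_four hclosed' hnodup']
  exact (hperm.map _).sum_eq

end IsMoveSystem

namespace IsMoveSystem

variable {n l : ℕ} {S : Finset (List ℕ)} {kind : List ℕ → ℕ → Bool} {h : IsMoveSystem n S kind}
  {A : Set h.Vertex}

theorem isLocalModel_val (hA : ∀ x ∈ A, ∀ k y, (h.signed.edge (k + 2)).Adj x y → y ∈ A)
    (hclosed : ∀ x ∈ A, ClosedUnderMoves kind l (string kind l x.1)) :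
    IsLocalModel h l A (fun _ _ => True) Subtype.val kind l where
  admits_eq _ _ _ _ := rfl
  of_adj x hx _ _ y hxy := ⟨hA x hx _ y hxy, trivial, (adj_add_two_iff.1 hxy).2⟩
  isDescent_eq _ _ := rfl
  equivalence := ⟨fun _ => trivial, fun _ => trivial, fun _ _ => trivial⟩
  inj _ _ _ _ _ hxy := Subtype.ext hxy
  closed := hclosed

theorem standardize_window_mem_permutations' {d : ℕ} (hl : l + d ≤ n) (x : h.Vertex) :
    standardize (window l d x.1) ∈ (List.range' 1 d).permutations' := by
  have hperm := standardize_perm_range' (nodup_window (k := l) (d := d) (nodup x))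
  rw [length_window (by rwa [length])] at hperm
  exact List.mem_permutations'.2 hperm

/-- The Knuth moves in three consecutive directions only involve a window of five letters, so that
there are finitely many local models if there are no rotations. -/
theorem isLocalModel_standardize (hl : l + 5 ≤ n)
    (hA : ∀ x ∈ A, ∀ k y, (h.signed.edge (k + 2)).Adj x y → y ∈ A)
    (hkind : ∀ x ∈ A, ∀ k, kind x.1 k = false) :
    IsLocalModel h l A
      (fun x y => x.1.take l = y.1.take l ∧ x.1.drop (l + 5) = y.1.drop (l + 5) ∧
        (window l 5 x.1).Perm (window l 5 y.1))
      (fun x => standardize (window l 5 x.1)) (fun _ _ => false) 0 where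
  admits_eq x _ t ht := by rw [zero_add, admits_standardize, admits_window l (by omega)]
  of_adj x hx t ht y hxy := by
    obtain ⟨-, hy⟩ := adj_add_two_iff.1 hxy
    rw [hkind x hx] at hy
    have hwindow : window l 5 y.1 = move false t (window l 5 x.1) := by
      rw [hy, window_move false l (by omega)]
    refine ⟨hA x hx _ y hxy, ⟨?_, ?_, ?_⟩, ?_⟩
    · have htake := congrArg (List.take l) (take_move_self false (l + t) x.1)
      rw [List.take_take, List.take_take, Nat.min_eq_left (by omega)] at htake
      rw [hy, htake]
    · have hdrop := congrArg (List.drop (2 - t)) (drop_move_self false (l + t) x.1)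
      rw [List.drop_drop, List.drop_drop, show l + t + 3 + (2 - t) = l + 5 by omega] at hdrop
      rw [hy, hdrop]
    · exact hwindow ▸ (move_perm _ _ _).symm
    · rw [hwindow, standardize_move, zero_add, neighbor]
  isDescent_eq x _ := by rw [isDescent_standardize, isDescent_window l (by omega)]
  equivalence := ⟨fun _ => ⟨rfl, rfl, List.Perm.refl _⟩,
    fun h => ⟨h.1.symm, h.2.1.symm, h.2.2.symm⟩,
    fun h h' => ⟨h.1.trans h'.1, h.2.1.trans h'.2.1, h.2.2.trans h'.2.2⟩⟩
  inj x _ y _ := fun ⟨htake, hdrop, hperm⟩ hxy => by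
    have hwindow := eq_of_perm_of_standardize_eq hperm hxy
    have hsplit (w : List ℕ) : w = w.take l ++ (window l 5 w ++ w.drop (l + 5)) := by
      rw [window, ← List.drop_drop, List.take_append_drop, List.take_append_drop]
    exact Subtype.ext (by rw [hsplit x.1, hsplit y.1, htake, hdrop, hwindow])
  closed x _ := closedUnderMoves_string_pattern _ (standardize_window_mem_permutations' hl x)

end IsMoveSystem

/-! ### The graph -/

section VertexSet

variable {k : ℕ} {w : List ℕ}

/-- The vertex set of the graph: the Knuth classes and the exceptional component. -/
def vertexSet : Finset (List ℕ) := (knuthWords ++ coreTrie.words).toFinset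

theorem mem_vertexSet : w ∈ vertexSet ↔ w ∈ knuthWords ∨ w ∈ coreTrie.words := by
  rw [vertexSet, List.mem_toFinset, List.mem_append]

theorem mem_knuthWords :
    w ∈ knuthWords ↔ ∃ bs ∈ knuthClasses, hasInverseDescents bs w = true := by
  simp only [knuthWords, List.mem_flatMap, mem_inverseDescentClass]

theorem nodup_classes : (knuthClasses ++ coreClasses).Nodup := by decide +kernel

theorem length_of_mem_classes {bs : List Bool} (h : bs ∈ knuthClasses ++ coreClasses) :
    bs.length = 7 := by
  simp only [knuthClasses, coreClasses, List.mem_append, List.mem_map] at h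
  rcases h with ⟨M, -, rfl⟩ | ⟨M, -, rfl⟩ <;> rfl

theorem eq_of_mem_classes {bs bs' : List Bool} (h : bs ∈ knuthClasses ++ coreClasses)
    (h' : bs' ∈ knuthClasses ++ coreClasses) (hw : hasInverseDescents bs w = true)
    (hw' : hasInverseDescents bs' w = true) : bs = bs' :=
  eq_of_hasInverseDescents ((length_of_mem_classes h).trans (length_of_mem_classes h').symm) hw hw'

theorem disjoint_knuthWords_coreTrie_words : knuthWords.Disjoint coreTrie.words := by
  intro w hw hw'
  obtain ⟨bs, hbs, hw⟩ := mem_knuthWords.1 hw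
  obtain ⟨bs', hbs', hw'⟩ := exists_mem_coreClasses w hw'
  have heq := eq_of_mem_classes (List.mem_append_left _ hbs) (List.mem_append_right _ hbs') hw hw'
  exact (List.nodup_append'.1 nodup_classes).2.2 hbs (heq ▸ hbs')

theorem perm_range'_of_mem_vertexSet (h : w ∈ vertexSet) : w.Perm (List.range' 1 8) := by
  obtain ⟨bs, hbs, hw⟩ : ∃ bs ∈ knuthClasses ++ coreClasses, hasInverseDescents bs w = true := by
    rcases mem_vertexSet.1 h with h | h
    · obtain ⟨bs, hbs, hw⟩ := mem_knuthWords.1 h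
      exact ⟨bs, List.mem_append_left _ hbs, hw⟩
    · obtain ⟨bs, hbs, hw⟩ := exists_mem_coreClasses w h
      exact ⟨bs, List.mem_append_right _ hbs, hw⟩
  simpa only [length_of_mem_classes hbs] using perm_range'_of_hasInverseDescents hw

theorem isWord_of_mem_vertexSet (h : w ∈ vertexSet) : IsWord 8 8 w := by
  have hperm := perm_range'_of_mem_vertexSet h
  refine ⟨hperm.length_eq, hperm.nodup_iff.2 List.nodup_range', fun a ha => ?_⟩
  rw [hperm.mem_iff, List.mem_range'_1] at ha
  omega

theorem kind_of_mem_knuthWords (h : w ∈ knuthWords) (k : ℕ) : coreTrie.kind w k = false :=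
  WordTrie.kind_eq_false_of_notMem_words (disjoint_knuthWords_coreTrie_words h) k

theorem move_mem_knuthWords (h : w ∈ knuthWords) (hk : admits k w = true) :
    move false k w ∈ knuthWords := by
  obtain ⟨bs, hbs, hw⟩ := mem_knuthWords.1 h
  have hnodup := (isWord_of_mem_vertexSet (mem_vertexSet.2 (.inl h))).2.1
  exact mem_knuthWords.2 ⟨bs, hbs, by rwa [hasInverseDescents_knuthMove bs hnodup hk]⟩

theorem lt_six_of_admits (h : w ∈ vertexSet) (hk : admits k w = true) : k < 6 := by
  have hlt := lt_length_of_admits hk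
  rw [(isWord_of_mem_vertexSet h).1] at hlt
  omega

theorem move_mem_coreTrie_words (h : w ∈ coreTrie.words) (hk : admits k w = true) :
    move (coreTrie.kind w k) k w ∈ coreTrie.words :=
  WordTrie.mem_words_of_isSome_lookup
    (coreTrie_edgeCheck w h k (lt_six_of_admits (mem_vertexSet.2 (.inr h)) hk) hk).1

theorem isMoveSystem_vertexSet : IsMoveSystem 8 vertexSet coreTrie.kind where
  isWord w := isWord_of_mem_vertexSet
  mem w hw k hk := by
    rw [mem_vertexSet] at hw ⊢
    refine hw.imp (fun hw => ?_) fun hw => move_mem_coreTrie_words hw hk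
    rw [kind_of_mem_knuthWords hw]
    exact move_mem_knuthWords hw hk
  kind_move_self w hw k hk := by
    rcases mem_vertexSet.1 hw with hw' | hw'
    · rw [kind_of_mem_knuthWords hw', kind_of_mem_knuthWords (move_mem_knuthWords hw' hk)]
    · exact (coreTrie_edgeCheck w hw' k (lt_six_of_admits hw hk) hk).2.1
  kind_move_far w hw j k hj hk hjk := by
    rcases mem_vertexSet.1 hw with hw' | hw'
    · rw [kind_of_mem_knuthWords hw', kind_of_mem_knuthWords hw',
        kind_of_mem_knuthWords (move_mem_knuthWords hw' hj)]
    · exact (coreTrie_edgeCheck w hw' j (lt_six_of_admits hw hj) hj).2.2 k (lt_six_of_admits hw hk)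
        hjk.symm

theorem axiom4a_vertexSet : isMoveSystem_vertexSet.signed.Axiom4a := by
  refine IsMoveSystem.axiom4a fun w hw l hl hrot => ?_
  have hcore : w ∈ coreTrie.words :=
    (mem_vertexSet.1 hw).resolve_left fun hw => by simp [kind_of_mem_knuthWords hw] at hrot
  exact ⟨closedUnderMoves_string_core w hcore l (by omega),
    closedUnderMoves_string_core w hcore (l + 1) (by omega),
    coreTrie_componentCheck w hcore l (by omega)⟩

section ChainCondition

variable {l m : ℕ} {x : ℕ → isMoveSystem_vertexSet.Vertex}

theorem chainCondition_of_mem_knuthWords (hl : l < 3)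
    (hx : isMoveSystem_vertexSet.signed.WeakFlatChain (l + 4) m x) (hx₁ : (x 1).1 ∈ knuthWords) :
    isMoveSystem_vertexSet.signed.ChainCondition (l + 4) m x := by
  have hmodel := IsMoveSystem.isLocalModel_standardize (h := isMoveSystem_vertexSet)
    (A := {y | y.1 ∈ knuthWords}) (l := l) (by omega)
    (fun y (hy : y.1 ∈ knuthWords) k z hyz => show z.1 ∈ knuthWords by
      obtain ⟨hk, hz⟩ := IsMoveSystem.adj_add_two_iff.1 hyz
      rw [hz, kind_of_mem_knuthWords hy]
      exact move_mem_knuthWords hy hk)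
    fun y hy => kind_of_mem_knuthWords hy
  exact hmodel.chainCondition (by omega) (fun _ _ _ => trivial) (fun _ _ => False.elim)
    (fun y _ => chainCheck_pattern _
      (IsMoveSystem.standardize_window_mem_permutations' (by omega) y)) hx hx₁

theorem chainCondition_of_mem_coreTrie_words (hl : l < 3)
    (hx : isMoveSystem_vertexSet.signed.WeakFlatChain (l + 4) m x)
    (hx₁ : (x 1).1 ∈ coreTrie.words) :
    isMoveSystem_vertexSet.signed.ChainCondition (l + 4) m x := by
  have hmodel := IsMoveSystem.isLocalModel_val (h := isMoveSystem_vertexSet)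
    (A := {y | y.1 ∈ coreTrie.words}) (l := l)
    (fun y (hy : y.1 ∈ coreTrie.words) k z hyz => show z.1 ∈ coreTrie.words by
      obtain ⟨hk, hz⟩ := IsMoveSystem.adj_add_two_iff.1 hyz
      rw [hz]
      exact move_mem_coreTrie_words hy hk)
    fun y hy => closedUnderMoves_string_core y.1 hy l (by omega)
  exact hmodel.chainCondition (by omega) (fun y _ => IsMoveSystem.isTypeW_iff.2)
    (fun y _ => IsMoveSystem.isTypeW_iff.1) (fun y hy => coreTrie_chainCheck y.1 hy l hl) hx hx₁

end ChainCondition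

theorem axiom4bStrong_vertexSet : isMoveSystem_vertexSet.signed.Axiom4bStrong := by
  intro i m x hi _ hx
  obtain ⟨l, rfl⟩ := Nat.exists_eq_add_of_le' hi
  by_cases hl : l < 3
  · rcases mem_vertexSet.1 (x 1).2 with hx₁ | hx₁
    exacts [chainCondition_of_mem_knuthWords hl hx hx₁,
      chainCondition_of_mem_coreTrie_words hl hx hx₁]
  · intro j _ _ hj
    have hlt := lt_six_of_admits (x j).2 (IsMoveSystem.admits_add_two_iff (k := l + 3).1 hj.1)
    omega

end VertexSet

/-! ### The generating function -/

/-- Applies a function to a natural number after the number has been evaluated; this keeps the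
kernel from evaluating it again at each use of the argument. -/
def forceNat {β : Sort*} (K : ℕ) (f : ℕ → β) : β := K.casesOn (f 0) fun K => f (K + 1)

theorem forceNat_eq {β : Sort*} (K : ℕ) (f : ℕ → β) : forceNat K f = f K := by
  cases K <;> rfl

/-- The numbers of vertices with a given descent set, as the digits in base `X` at the places
`descentMask w`. -/
def descentHistogram (X : ℕ) : ℕ :=
  (knuthClasses.map fun bs => ((inverseDescentStates bs).map fun s => X ^ s.2).sum).sum +
    (coreTrie.words.map fun w => X ^ descentMask w).sum

/-- The expansion of the generating function in Schur functions. -/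
def schurTerms : List (ℤ × List ℕ) :=
  [(1, [8]), (7, [7, 1]), (20, [6, 2]), (21, [6, 1, 1]), (18, [5, 3]), (26, [5, 2, 1]),
   (2, [5, 1, 1, 1]), (7, [4, 4]), (15, [4, 3, 1]), (6, [4, 2, 2]), (4, [3, 3, 2]),
   (1, [3, 2, 2, 1]), (1, [3, 2, 1, 1, 1]), (1, [3, 1, 1, 1, 1, 1]), (-1, [2, 2, 2, 2]),
   (1, [2, 2, 2, 1, 1])]

theorem expansionCheck_schurTerms :
    expansionCheck (2 ^ 16) (descentHistogram (2 ^ 16)) 128 8 8 (2 ^ 8) schurTerms = true := by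
  have h : forceNat (descentHistogram (2 ^ 16))
      (fun K => expansionCheck (2 ^ 16) K 128 8 8 (2 ^ 8) schurTerms) = true := by decide +kernel
  rwa [forceNat_eq] at h

theorem length_inverseDescentStates :
    (knuthClasses.map fun bs => (inverseDescentStates bs).length).sum = 4824 := by decide +kernel

theorem length_coreTrie_words : coreTrie.words.length = 126 := by decide +kernel

theorem nodup_coreTrie_words : coreTrie.words.Nodup := by decide +kernel

theorem sum_knuthWords (g : ℕ → ℕ) : (knuthWords.map fun w => g (descentMask w)).sum =
    (knuthClasses.map fun bs => ((inverseDescentStates bs).map fun s => g s.2).sum).sum := by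
  simp only [knuthWords, List.flatMap_def, List.map_flatten, List.sum_flatten,
    ← map_inverseDescentClass, List.map_map, Function.comp_def]

theorem length_knuthWords : knuthWords.length = 4824 := by
  simpa only [List.map_const', List.sum_replicate, smul_eq_mul, mul_one,
    length_inverseDescentStates] using sum_knuthWords fun _ => 1

theorem nodup_knuthWords : knuthWords.Nodup := by
  refine List.nodup_flatMap.2 ⟨fun bs _ => nodup_inverseDescentClass bs, ?_⟩
  refine (List.nodup_append'.1 nodup_classes).1.imp_of_mem fun hbs hbs' hne w hw hw' => hne ?_
  exact eq_of_mem_classes (List.mem_append_left _ hbs) (List.mem_append_left _ hbs')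
    (mem_inverseDescentClass.1 hw) (mem_inverseDescentClass.1 hw')

theorem nodup_knuthWords_append : (knuthWords ++ coreTrie.words).Nodup :=
  List.nodup_append'.2 ⟨nodup_knuthWords, nodup_coreTrie_words, disjoint_knuthWords_coreTrie_words⟩

theorem card_vertexSet : vertexSet.card = 4950 := by
  rw [vertexSet, List.toFinset_card_of_nodup nodup_knuthWords_append, List.length_append,
    length_knuthWords, length_coreTrie_words]

theorem sum_vertexSet (X : ℕ) : ∑ w ∈ vertexSet, X ^ descentMask w = descentHistogram X := by
  rw [vertexSet, List.sum_toFinset _ nodup_knuthWords_append, List.map_append, List.sum_append,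
    sum_knuthWords fun M => X ^ M, descentHistogram]

theorem genFun_vertexSet : isMoveSystem_vertexSet.graph.genFun =
    (schurTerms.map fun p => p.1 • schurFunction (diagram p.2)).sum := by
  refine sum_fundamentalQSym_eq_of_check (f := descentMask) (X := 2 ^ 16) (m := 128) ?_
    (fun w hw => ?_) (fun w hw j => ?_) (by decide) ?_
  · exact card_vertexSet.trans_lt (by norm_num)
  · exact descentMask_lt w (n := 7) (isWord_of_mem_vertexSet hw).1.le
  · rw [testBit_descentMask, mem_descentSet]
    refine ⟨fun hd => ⟨?_, hd⟩, And.right⟩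
    by_contra hj
    rw [isDescent_eq_false_of_length_le (by rw [(isWord_of_mem_vertexSet hw).1]; omega)] at hd
    exact Bool.false_ne_true hd
  · exact sum_vertexSet _ ▸ expansionCheck_schurTerms

theorem hasSchurCoeff_vertexSet :
    HasSchurCoeff isMoveSystem_vertexSet.graph.genFun shape2222 (-1) := by
  have h := hasSchurCoeff_list_sum (L := schurTerms) (by decide) (l := [2, 2, 2, 2]) (by decide)
  rwa [← genFun_vertexSet, show diagram [2, 2, 2, 2] = shape2222 from dif_pos (by decide)] at h

theorem D0Graph.genFun_toSignedColoredGraph {n N : ℕ} (G : D0Graph n N) :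
    G.toSignedColoredGraph.genFun = G.genFun := by
  unfold SignedColoredGraph.genFun genFun
  rw [← Finset.sum_coe_sort G.verts fun w => fundamentalQSym n (descentSet w)]
  refine Finset.sum_congr rfl fun w _ => congrArg _ ?_
  ext i
  by_cases h : i ∈ descentSet w.1 <;> simp [toSignedColoredGraph, h]

theorem isDGraph_vertexSet : isMoveSystem_vertexSet.signed.IsDGraph :=
  ⟨IsMoveSystem.axiom1, IsMoveSystem.axiom2, IsMoveSystem.axiom3, axiom4a_vertexSet,
    axiom4bStrong_vertexSet.axiom4b, IsMoveSystem.axiom5,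
    isMoveSystem_vertexSet.lsp_four, isMoveSystem_vertexSet.lsp_five⟩

theorem mainTheorem1 :
    (∃ G : D0Graph 8 8,
      G.verts.card = 4950 ∧
      G.toSignedColoredGraph.Axiom4bStrong ∧
      G.toSignedColoredGraph.Axiom4b ∧
      G.toSignedColoredGraph.Axiom5 ∧
      HasSchurCoeff G.genFun shape2222 (-1) ∧
      ¬ SchurPositive G.genFun ∧
      G.toSignedColoredGraph.IsDGraph) ∧
    ∃ (n : ℕ) (V : Type) (_ : Fintype V) (H : SignedColoredGraph n V),
      H.IsDGraph ∧ ¬ SchurPositive H.genFun := by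
  have hneg : ¬ SchurPositive isMoveSystem_vertexSet.graph.genFun :=
    hasSchurCoeff_vertexSet.not_schurPositive (by norm_num)
  refine ⟨⟨isMoveSystem_vertexSet.graph, card_vertexSet, axiom4bStrong_vertexSet,
    axiom4bStrong_vertexSet.axiom4b, IsMoveSystem.axiom5, hasSchurCoeff_vertexSet, hneg,
    isDGraph_vertexSet⟩, 8, _, _, isMoveSystem_vertexSet.signed, isDGraph_vertexSet, ?_⟩
  rwa [D0Graph.genFun_toSignedColoredGraph]
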